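/- Let $r_{\rm hc}\ge 0$ and let $v:(0,\infty)\to\mathbb R\cup\{+\infty\}$ be equal to $+\infty$ on $(0,r_{\rm hc}]$ and a (finite) $C^2$ function on $(r_{\rm hc},\infty)$. Assume that there are $r_{\rm hc}<z_{\min}<z_{\max}<2z_{\min}$, $\alpha_1,\alpha_2>0$ and $s>2$ such that (monotonicity being understood in the weak sense): (i) $z_{\max}$ is the unique minimizer of $v$ and $v(z_{\max})<0$; $v$ is decreasing on $(0,z_{\max})$ and increasing and non-positive on $(z_{\max},\infty)$; (ii) $v(z)\ge-\alpha_1z^{-s}$ for all $z>0$, and $v(z)+v(z_{\max})-2\alpha_1\sum_{n=2}^\infty(nz)^{-s}>0$ for all $0<z<z_{\min}$; (iii) $v''$ is decreasing on $[z_{\min},z_{\max}]$ and increasing and non-positive on $[2z_{\min},\infty)$; (iv) $v''(z)\ge-\alpha_2z^{-s-2}$ for all $z>r_{\rm hc}$, and $v''(z_{\max})+\sum_{n=2}^\infty n^2v''(nz_{\min})>0$. Let $m\in\{1,2,3,\ldots\}\cup\{\infty\}$ and $0\le p<|v(z_{\max})|/z_{\max}$. For $N\ge1$ put $$E_N=\inf_{z_1,\ldots,z_{N-1}>0}\Bigl(\sum_{1\le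 i<j\le N,\ j-i\le m}v(z_i+\cdots+z_{j-1})+p\sum_{j=1}^{N-1}z_j\Bigr).$$ Then the map $r\mapsto pr+\sum_{k=1}^mv(kr)$ on $(0,\infty)$ has a unique minimizer $a$, and $e_0:=pa+\sum_{k=1}^mv(ka)=\lim_{N\to\infty}E_N/N$. Let $\mathcal D_0$ be the set of sequences $(z_j)_{j\in\mathbb N}\in(r_{\rm hc},\infty)^{\mathbb N}$ with at most finitely many entries different from $a$, let $\mathcal D=\{(z_j)_{j\in\mathbb N}\in(r_{\rm hc},\infty)^{\mathbb N}:\sum_j(z_j-a)^2<\infty\}$, equipped with the $\ell^2$-metric, and for $z\in\mathcal D_0$ define $$\mathcal E_{\rm surf}(z)=\sum_{j=1}^\infty\Bigl(pz_j+\sum_{k=1}^mv(z_j+\cdots+z_{j+k-1})-e_0\Bigr).$$ Then: (a) $\mathcal E_{\rm surf}$ extends to a continuous functional on $\mathcal D$ (again denoted $\mathcal E_{\rm surf}$). (b) $\mathcal E_{\rm surf}$ is strictly convex on $\mathcal D\cap[z_{\min},z_{\max}]^{\mathbb N}$. (c) $\mathcal E_{\rm surf}$ has a unique minimizer on $\mathcal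 D$, and it lies in $\mathcal D\cap[z_{\min},z_{\max}]^{\mathbb N}$. (d) The limit $e_{\rm surf}=\lim_{N\to\infty}(E_N-Ne_0)$ exists and $$e_{\rm surf}=2\min_{\mathcal D}\mathcal E_{\rm surf}-pa-\sum_{k=1}^mk\,v(ka).$$ -/

import Mathlib

open Filter Topology

noncomputable section

namespace AtomChain

/-- The pair potential `(0, ∞) → ℝ ∪ {+∞}`: it is `+∞` on `(0, rhc]` and is given by the
real function `v` on `(rhc, ∞)`. The values of `v` outside `(rhc, ∞)` play no role. -/
def pairPotential (rhc : ℝ) (v : ℝ → ℝ) (r : ℝ) : EReal :=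
  if r ≤ rhc then ⊤ else (v r : EReal)

/-- The standing assumption on the pair potential. Since the potential is `+∞` on `(0, rhc]`,
monotonicity and lower bounds only have to be required on `(rhc, ∞)`. -/
structure IsAdmissible (v : ℝ → ℝ) (rhc zmin zmax α₁ α₂ s : ℝ) : Prop where
  rhc_nonneg : 0 ≤ rhc
  rhc_lt_zmin : rhc < zmin
  zmin_lt_zmax : zmin < zmax
  zmax_lt : zmax < 2 * zmin
  α₁_pos : 0 < α₁
  α₂_pos : 0 < α₂
  two_lt_s : 2 < s
  contDiffOn : ContDiffOn ℝ 2 v (Set.Ioi rhc)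
  -- shape of `v`
  zmax_unique_min : ∀ r, rhc < r → r ≠ zmax → v zmax < v r
  v_zmax_neg : v zmax < 0
  antitone : AntitoneOn v (Set.Ioo rhc zmax)
  monotone : MonotoneOn v (Set.Ioi zmax)
  nonpos : ∀ r, zmax < r → v r ≤ 0
  -- growth of `v`
  lower_bound : ∀ r, rhc < r → -α₁ * r ^ (-s) ≤ v r
  repulsion : ∀ r, rhc < r → r < zmin →
    0 < v r + v zmax - 2 * α₁ * ∑' n : ℕ, (((n : ℝ) + 2) * r) ^ (-s)
  -- shape of `v''`
  deriv2_antitone : AntitoneOn (deriv (deriv v)) (Set.Icc zmin zmax)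
  deriv2_monotone : MonotoneOn (deriv (deriv v)) (Set.Ici (2 * zmin))
  deriv2_nonpos : ∀ r, 2 * zmin ≤ r → deriv (deriv v) r ≤ 0
  -- growth of `v''`
  deriv2_lower_bound : ∀ r, rhc < r → -α₂ * r ^ (-s - 2) ≤ deriv (deriv v) r
  deriv2_sum_pos :
    0 < deriv (deriv v) zmax +
      ∑' n : ℕ, ((n : ℝ) + 2) ^ 2 * deriv (deriv v) (((n : ℝ) + 2) * zmin)

open Classical in
/-- `∑_{k=1}^m f k`, where `m` may be `∞`. -/
def sumTo (m : ℕ∞) (f : ℕ → ℝ) : ℝ :=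
  ∑' k : ℕ, if 1 ≤ k ∧ (k : ℕ∞) ≤ m then f k else 0

open Classical in
/-- The Gibbs energy of `N` particles with spacings `z 0, …, z (N - 2)`: particles are labelled
`0, …, N - 1`, and `i < j` interact if `j - i ≤ m`. Later entries of `z` do not enter. -/
def chainEnergy (rhc : ℝ) (v : ℝ → ℝ) (m : ℕ∞) (p : ℝ) (N : ℕ) (z : ℕ → ℝ) : EReal :=
  (∑ j ∈ Finset.range N, ∑ i ∈ Finset.range j,
    if ((j - i : ℕ) : ℕ∞) ≤ m then pairPotential rhc v (∑ l ∈ Finset.Ico i j, z l) else 0)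
  + ((p * ∑ l ∈ Finset.range (N - 1), z l : ℝ) : EReal)

/-- `E_N`, the infimum of the Gibbs energy over all positive spacings. -/
def minEnergy (rhc : ℝ) (v : ℝ → ℝ) (m : ℕ∞) (p : ℝ) (N : ℕ) : EReal :=
  ⨅ z ∈ {z : ℕ → ℝ | ∀ j, 0 < z j}, chainEnergy rhc v m p N z

/-- `p r + ∑_{k=1}^m v(k r)` for `r > rhc`. -/
def bulkEnergy (v : ℝ → ℝ) (m : ℕ∞) (p r : ℝ) : ℝ :=
  p * r + sumTo m (fun k => v (k * r))

/-- The map `r ↦ p r + ∑_{k=1}^m v(k r)` on `(0, ∞)`, with value `+∞` for `r ≤ rhc`, where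
already the term `k = 1` is infinite. -/
def bulkEnergyExt (rhc : ℝ) (v : ℝ → ℝ) (m : ℕ∞) (p r : ℝ) : EReal :=
  if r ≤ rhc then ⊤ else (bulkEnergy v m p r : EReal)

/-- `h(z₁, …, z_m) = p z₁ + ∑_{k=1}^m v(z₁ + ⋯ + z_k)`; the spacing `z_j` is `z (j - 1)`. -/
def headEnergy (v : ℝ → ℝ) (m : ℕ∞) (p : ℝ) (z : ℕ → ℝ) : ℝ :=
  p * z 0 + sumTo m (fun k => v (∑ i ∈ Finset.range k, z i))

/-- The sequences in `(rhc, ∞)^ℕ` with at most finitely many entries different from `a`. -/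
def finiteStrains (rhc a : ℝ) : Set (ℕ → ℝ) :=
  {z | (∀ j, rhc < z j) ∧ {j | z j ≠ a}.Finite}

/-- The surface functional `∑_j (h(z_j, z_{j+1}, …) - e₀)`; on `finiteStrains rhc a` with
`e₀ = bulkEnergy v m p a` only finitely many terms are nonzero. -/
def surfaceEnergy (v : ℝ → ℝ) (m : ℕ∞) (p e₀ : ℝ) (z : ℕ → ℝ) : ℝ :=
  ∑' j : ℕ, (headEnergy v m p (fun i => z (j + i)) - e₀)

/-- The sequences in `(rhc, ∞)^ℕ` with square summable strain `z - a`. -/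
def squareSummableStrains (rhc a : ℝ) : Set (ℕ → ℝ) :=
  {z | (∀ j, rhc < z j) ∧ Summable (fun j => (z j - a) ^ 2)}

/-- The set `squareSummableStrains rhc a` as a type of its own, which carries the `ℓ²` metric
(and not the topology of pointwise convergence). -/
def StrainSpace (rhc a : ℝ) : Type := {z : ℕ → ℝ // z ∈ squareSummableStrains rhc a}

/-- The strain `z - a` as an element of `ℓ²(ℕ)`. -/
def StrainSpace.strain {rhc a : ℝ} (z : StrainSpace rhc a) : lp (fun _ : ℕ => ℝ) 2 :=
  ⟨fun j => z.1 j - a, memℓp_gen (by simpa using z.2.2)⟩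

theorem StrainSpace.strain_injective (rhc a : ℝ) :
    Function.Injective (StrainSpace.strain : StrainSpace rhc a → lp (fun _ : ℕ => ℝ) 2) := by
  intro z w h
  apply Subtype.ext
  funext j
  have hj : z.1 j - a = w.1 j - a := congrArg (fun f : lp (fun _ : ℕ => ℝ) 2 => f j) h
  linarith

/-- The `ℓ²` metric `dist z w = ‖z - w‖_{ℓ²}`. -/
instance (rhc a : ℝ) : MetricSpace (StrainSpace rhc a) :=
  MetricSpace.induced StrainSpace.strain (StrainSpace.strain_injective rhc a) inferInstance

end AtomChain

end

/-!
Exchange arguments confine the spacings of energy minimizers to `[zmin, zmax]`: clipping a spacing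
above `zmax` lowers the energy, and so does moving a particle with a spacing below `zmin` to the
left end of the chain. On `[zmin, zmax]` the curvature of the nearest-neighbour bonds outweighs the
negative curvature of all longer ones, because `(x₁ + ⋯ + x_k) ^ 2 ≤ k * (x₁ ^ 2 + ⋯ + x_k ^ 2)`
reduces the Hessian to the series of `deriv2_sum_pos`. All chain energies are therefore strongly
convex there with one modulus, independent of the number of particles.

The force vanishes at the bulk spacing `a`, so a second-order expansion bounds the difference of two
chain energies by a multiple of the `ℓ²` distance of the strains, again uniformly in the number of
particles. This extends the surface functional to square summable strains, and together with strong
convexity it makes minimizing sequences Cauchy.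

A minimizing chain of `N` particles has bounded strain, hence contains a block of about `√N`
spacings with small strain. Replacing this block by `a` costs little energy and cuts the chain into
two half-infinite chains, up to the energy of the bonds across the cut, which gives the lower
bound on `E_N - N e₀`; gluing two mirrored copies of the optimal half-infinite chain gives the upper
bound.
-/

noncomputable section

namespace AtomChain

open Finset

variable {v : ℝ → ℝ} {rhc zmin zmax α₁ α₂ s : ℝ}

theorem strongConvexOn_of_hasDerivAt2 {f f' f'' : ℝ → ℝ} {D : Set ℝ} (hD : Convex ℝ D)
    (hf : ∀ x ∈ D, HasDerivAt f (f' x) x) (hf' : ∀ x ∈ D, HasDerivAt f' (f'' x) x)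
    {c : ℝ} (hc : ∀ x ∈ D, c ≤ f'' x) : StrongConvexOn D c f := by
  rw [strongConvexOn_iff_convex]
  simp only [Real.norm_eq_abs, sq_abs]
  have hderiv : ∀ x ∈ D, HasDerivAt (fun x => f x - c / 2 * x ^ 2) (f' x - c * x) x := fun x hx =>
    ((hf x hx).sub ((hasDerivAt_pow 2 x).const_mul (c / 2))).congr_deriv (by simp; ring)
  have hderiv2 : ∀ x ∈ D, HasDerivAt (fun x => f' x - c * x) (f'' x - c) x := fun x hx =>
    ((hf' x hx).sub ((hasDerivAt_id x).const_mul c)).congr_deriv (by simp)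
  exact convexOn_of_hasDerivWithinAt2_nonneg hD
    (fun x hx => (hderiv x hx).continuousAt.continuousWithinAt)
    (fun x hx => (hderiv x (interior_subset hx)).hasDerivWithinAt)
    (fun x hx => (hderiv2 x (interior_subset hx)).hasDerivWithinAt)
    (fun x hx => sub_nonneg.2 (hc x (interior_subset hx)))

theorem exists_forall_abs_le_mul_rpow {f : ℝ → ℝ} {r R A t : ℝ} (hr : 0 < r)
    (hf : ContinuousOn f (Set.Ici r)) (hA : ∀ x, R ≤ x → |f x| ≤ A * x ^ (-t)) :
    ∃ C, 0 ≤ C ∧ ∀ x, r ≤ x → |f x| ≤ C * x ^ (-t) := by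
  have hcont : ContinuousOn (fun x => f x * x ^ t) (Set.Icc r R) :=
    (hf.mono Set.Icc_subset_Ici_self).mul fun x hx =>
      (Real.continuousAt_rpow_const x t (Or.inl (hr.trans_le hx.1).ne')).continuousWithinAt
  obtain ⟨B, hB⟩ := isCompact_Icc.exists_bound_of_continuousOn hcont
  refine ⟨max (max A B) 0, le_max_right _ _, fun x hx => ?_⟩
  have hx0 : 0 < x := hr.trans_le hx
  suffices h : |f x| ≤ max A B * x ^ (-t) from
    h.trans (mul_le_mul_of_nonneg_right (le_max_left _ _) (Real.rpow_nonneg hx0.le _))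
  rcases le_total x R with hxR | hRx
  · have hle := hB x ⟨hx, hxR⟩
    rw [Real.norm_eq_abs, abs_mul, abs_of_pos (Real.rpow_pos_of_pos hx0 t)] at hle
    rw [Real.rpow_neg hx0.le, ← div_eq_mul_inv, le_div_iff₀ (Real.rpow_pos_of_pos hx0 t)]
    exact hle.trans (le_max_right A B)
  · exact (hA x hRx).trans
      (mul_le_mul_of_nonneg_right (le_max_left A B) (Real.rpow_nonneg hx0.le _))

namespace IsAdmissible

theorem zmin_pos (hv : IsAdmissible v rhc zmin zmax α₁ α₂ s) : 0 < zmin :=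
  hv.rhc_nonneg.trans_lt hv.rhc_lt_zmin

theorem zmax_pos (hv : IsAdmissible v rhc zmin zmax α₁ α₂ s) : 0 < zmax :=
  hv.zmin_pos.trans hv.zmin_lt_zmax

theorem rhc_lt_zmax (hv : IsAdmissible v rhc zmin zmax α₁ α₂ s) : rhc < zmax :=
  hv.rhc_lt_zmin.trans hv.zmin_lt_zmax

theorem contDiffOn_deriv (hv : IsAdmissible v rhc zmin zmax α₁ α₂ s) :
    ContDiffOn ℝ 1 (deriv v) (Set.Ioi rhc) :=
  ((contDiffOn_succ_iff_deriv_of_isOpen (n := 1) isOpen_Ioi).1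
    (by simpa [one_add_one_eq_two] using hv.contDiffOn)).2.2

theorem continuousOn_deriv2 (hv : IsAdmissible v rhc zmin zmax α₁ α₂ s) :
    ContinuousOn (deriv (deriv v)) (Set.Ioi rhc) :=
  (((contDiffOn_succ_iff_deriv_of_isOpen (n := 0) isOpen_Ioi).1
    (by simpa using hv.contDiffOn_deriv)).2.2).continuousOn

theorem hasDerivAt (hv : IsAdmissible v rhc zmin zmax α₁ α₂ s) {x : ℝ} (hx : rhc < x) :
    HasDerivAt v (deriv v x) x :=
  ((hv.contDiffOn.differentiableOn (by norm_num)).differentiableAt (Ioi_mem_nhds hx)).hasDerivAt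

theorem hasDerivAt_deriv (hv : IsAdmissible v rhc zmin zmax α₁ α₂ s) {x : ℝ} (hx : rhc < x) :
    HasDerivAt (deriv v) (deriv (deriv v) x) x :=
  ((hv.contDiffOn_deriv.differentiableOn (by norm_num)).differentiableAt
    (Ioi_mem_nhds hx)).hasDerivAt

theorem apply_zmax_le (hv : IsAdmissible v rhc zmin zmax α₁ α₂ s) {x : ℝ} (hx : rhc < x) :
    v zmax ≤ v x := by
  rcases eq_or_ne x zmax with rfl | hne
  · exact le_rfl
  · exact (hv.zmax_unique_min x hx hne).le

theorem apply_min_zmax_le (hv : IsAdmissible v rhc zmin zmax α₁ α₂ s) {x : ℝ} (hx : rhc < x) :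
    v (min x zmax) ≤ v x := by
  rcases le_total x zmax with hle | hle
  · rw [min_eq_left hle]
  · rw [min_eq_right hle]
    exact hv.apply_zmax_le hx

theorem monotoneOn_Ici (hv : IsAdmissible v rhc zmin zmax α₁ α₂ s) :
    MonotoneOn v (Set.Ici zmax) := by
  intro x hx y _ hxy
  rcases (Set.mem_Ici.1 hx).eq_or_lt with rfl | hlt
  · exact hv.apply_zmax_le (hv.rhc_lt_zmax.trans_le hxy)
  · exact hv.monotone hlt (hlt.trans_le hxy) hxy

theorem antitoneOn_Ioc (hv : IsAdmissible v rhc zmin zmax α₁ α₂ s) :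
    AntitoneOn v (Set.Ioc rhc zmax) := by
  intro x hx y hy hxy
  rcases hy.2.eq_or_lt with rfl | hlt
  · exact hv.apply_zmax_le hx.1
  · exact hv.antitone ⟨hx.1, hxy.trans_lt hlt⟩ ⟨hy.1, hlt⟩ hxy

theorem nonpos_of_zmax_le (hv : IsAdmissible v rhc zmin zmax α₁ α₂ s) {x : ℝ} (hx : zmax ≤ x) :
    v x ≤ 0 := by
  rcases hx.eq_or_lt with rfl | hlt
  · exact hv.v_zmax_neg.le
  · exact hv.nonpos x hlt

theorem lt_zmax_of_pos (hv : IsAdmissible v rhc zmin zmax α₁ α₂ s) {x : ℝ} (hx : 0 < v x) :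
    x < zmax :=
  lt_of_not_ge fun hle => hx.not_ge (hv.nonpos_of_zmax_le hle)

theorem exists_abs_le_rpow (hv : IsAdmissible v rhc zmin zmax α₁ α₂ s) {r : ℝ} (hr : rhc < r) :
    ∃ C, 0 ≤ C ∧ ∀ x, r ≤ x → |v x| ≤ C * x ^ (-s) := by
  refine exists_forall_abs_le_mul_rpow (R := zmax) (A := α₁) (hv.rhc_nonneg.trans_lt hr)
    (hv.contDiffOn.continuousOn.mono (Set.Ici_subset_Ioi.2 hr)) fun x hx => ?_
  rw [abs_of_nonpos (hv.nonpos_of_zmax_le hx)]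
  linarith [hv.lower_bound x (hv.rhc_lt_zmax.trans_le hx)]

theorem exists_abs_deriv2_le_rpow (hv : IsAdmissible v rhc zmin zmax α₁ α₂ s) {r : ℝ}
    (hr : rhc < r) : ∃ C, 0 ≤ C ∧ ∀ x, r ≤ x → |deriv (deriv v) x| ≤ C * x ^ (-s - 2) := by
  simp only [← neg_add']
  refine exists_forall_abs_le_mul_rpow (R := 2 * zmin) (A := α₂) (hv.rhc_nonneg.trans_lt hr)
    (hv.continuousOn_deriv2.mono (Set.Ici_subset_Ioi.2 hr)) fun x hx => ?_
  rw [abs_of_nonpos (hv.deriv2_nonpos x hx), neg_add']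
  linarith [hv.deriv2_lower_bound x (by linarith [hv.rhc_lt_zmin, hv.zmin_pos])]

theorem deriv_nonneg (hv : IsAdmissible v rhc zmin zmax α₁ α₂ s) {x : ℝ} (hx : zmax < x) :
    0 ≤ deriv v x := by
  rw [← derivWithin_of_isOpen isOpen_Ioi (s := Set.Ioi zmax) hx]
  exact hv.monotone.derivWithin_nonneg

theorem antitoneOn_deriv (hv : IsAdmissible v rhc zmin zmax α₁ α₂ s) :
    AntitoneOn (deriv v) (Set.Ici (2 * zmin)) := by
  have hderiv : ∀ x ∈ Set.Ici (2 * zmin), HasDerivAt (deriv v) (deriv (deriv v) x) x :=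
    fun x hx => hv.hasDerivAt_deriv (by linarith [hv.rhc_lt_zmin, hv.zmin_pos, Set.mem_Ici.1 hx])
  exact antitoneOn_of_deriv_nonpos (convex_Ici _)
    (fun x hx => (hderiv x hx).continuousAt.continuousWithinAt)
    (fun x hx => (hderiv x (interior_subset hx)).differentiableAt.differentiableWithinAt)
    (fun x hx => hv.deriv2_nonpos x (interior_subset hx))

/- `v'` decreases on `[x / 2, x]`, so it is at most the slope of `v` between `x / 2` and `x`. -/
theorem deriv_mul_le (hv : IsAdmissible v rhc zmin zmax α₁ α₂ s) {x : ℝ} (hx : 4 * zmin ≤ x) :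
    deriv v x * (x / 2) ≤ α₁ * (x / 2) ^ (-s) := by
  have hz := hv.zmin_pos
  have hlt : ∀ y, x / 2 ≤ y → rhc < y := fun y hy => by linarith [hv.rhc_lt_zmin]
  obtain ⟨ξ, hξ, hslope⟩ := exists_hasDerivAt_eq_slope v (deriv v) (a := x / 2) (b := x)
    (by linarith) (fun y hy => (hv.hasDerivAt (hlt y hy.1)).continuousAt.continuousWithinAt)
    (fun y hy => hv.hasDerivAt (hlt y hy.1.le))
  have hle : deriv v x ≤ deriv v ξ :=
    hv.antitoneOn_deriv (Set.mem_Ici.2 (by linarith [hξ.1])) (Set.mem_Ici.2 (by linarith)) hξ.2.le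
  rw [hslope, le_div_iff₀ (by linarith)] at hle
  linarith [hv.lower_bound (x / 2) (hlt _ le_rfl),
    hv.nonpos_of_zmax_le (x := x) (by linarith [hv.zmax_lt])]

theorem exists_abs_deriv_le_rpow (hv : IsAdmissible v rhc zmin zmax α₁ α₂ s) {r : ℝ}
    (hr : rhc < r) : ∃ C, 0 ≤ C ∧ ∀ x, r ≤ x → |deriv v x| ≤ C * x ^ (-s - 1) := by
  have hz := hv.zmin_pos
  refine (exists_forall_abs_le_mul_rpow (R := 4 * zmin) (A := α₁ * 2 ^ (s + 1)) (t := s + 1)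
    (hv.rhc_nonneg.trans_lt hr) (hv.contDiffOn_deriv.continuousOn.mono (Set.Ici_subset_Ioi.2 hr))
    fun x hx => ?_).imp fun C hC => by simpa only [neg_add'] using hC
  have hx0 : 0 < x := by linarith
  have hscale : (2 : ℝ) ^ (s + 1) * x ^ (-(s + 1)) = (x / 2) ^ (-(s + 1)) := by
    rw [Real.div_rpow hx0.le zero_le_two, Real.rpow_neg zero_le_two, div_inv_eq_mul, mul_comm]
  rw [abs_of_nonneg (hv.deriv_nonneg (by linarith [hv.zmax_lt])), mul_assoc, hscale, neg_add',
    Real.rpow_sub_one (by positivity), ← mul_div_assoc, le_div_iff₀ (by positivity)]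
  exact hv.deriv_mul_le hx

end IsAdmissible

/-! ### Windows of consecutive spacings -/

/-- The `ℓ²` norm of the first `L` entries of a sequence. -/
def partialNorm (L : ℕ) (ζ : ℕ → ℝ) : ℝ := √(∑ l ∈ range L, ζ l ^ 2)

theorem partialNorm_nonneg (L : ℕ) (ζ : ℕ → ℝ) : 0 ≤ partialNorm L ζ := Real.sqrt_nonneg _

theorem sq_partialNorm (L : ℕ) (ζ : ℕ → ℝ) : partialNorm L ζ ^ 2 = ∑ l ∈ range L, ζ l ^ 2 :=
  Real.sq_sqrt (sum_nonneg fun _ _ => sq_nonneg _)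

theorem partialNorm_le_iff {L : ℕ} {ζ : ℕ → ℝ} {M : ℝ} (hM : 0 ≤ M) :
    partialNorm L ζ ≤ M ↔ ∑ l ∈ range L, ζ l ^ 2 ≤ M ^ 2 :=
  Real.sqrt_le_left hM

theorem partialNorm_le_partialNorm {L : ℕ} {ζ η : ℕ → ℝ} (h : ∀ l < L, |ζ l| ≤ |η l|) :
    partialNorm L ζ ≤ partialNorm L η :=
  Real.sqrt_le_sqrt (sum_le_sum fun l hl => sq_le_sq.2 (h l (mem_range.1 hl)))

theorem partialNorm_mono (ζ : ℕ → ℝ) {L N : ℕ} (h : L ≤ N) : partialNorm L ζ ≤ partialNorm N ζ :=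
  Real.sqrt_le_sqrt (sum_le_sum_of_subset_of_nonneg (range_mono h) fun _ _ _ => sq_nonneg _)

theorem partialNorm_congr {L : ℕ} {ζ η : ℕ → ℝ} (h : ∀ l < L, ζ l = η l) :
    partialNorm L ζ = partialNorm L η :=
  congrArg Real.sqrt (sum_congr rfl fun l hl => by rw [h l (mem_range.1 hl)])

theorem partialNorm_smul {t : ℝ} (ht : 0 ≤ t) (L : ℕ) (ζ : ℕ → ℝ) :
    partialNorm L (t • ζ) = t * partialNorm L ζ := by
  simp only [partialNorm, Pi.smul_apply, smul_eq_mul, mul_pow, ← mul_sum]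
  rw [Real.sqrt_mul (sq_nonneg t), Real.sqrt_sq ht]

theorem exists_partialNorm_pos {ζ : ℕ → ℝ} (hζ : ζ ≠ 0) : ∃ L, 0 < partialNorm L ζ := by
  obtain ⟨l, hl⟩ := Function.ne_iff.1 hζ
  refine ⟨l + 1, Real.sqrt_pos.2 (sum_pos' (fun _ _ => sq_nonneg _) ⟨l, by simp, ?_⟩)⟩
  exact sq_pos_of_ne_zero hl

/-- The length of the window of `k` consecutive spacings that starts at `i`. -/
def window (z : ℕ → ℝ) (i k : ℕ) : ℝ := ∑ l ∈ range k, z (i + l)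

theorem window_zero (z : ℕ → ℝ) (i : ℕ) : window z i 0 = 0 := by simp [window]

theorem window_one (z : ℕ → ℝ) (i : ℕ) : window z i 1 = z i := by simp [window]

theorem window_add (z : ℕ → ℝ) (i k l : ℕ) :
    window z i (k + l) = window z i k + window z (i + k) l := by
  simp [window, sum_range_add, add_assoc]

theorem window_combo (z w : ℕ → ℝ) (t u : ℝ) (i k : ℕ) :
    window (t • z + u • w) i k = t * window z i k + u * window w i k := by
  simp [window, sum_add_distrib, mul_sum]

theorem window_sub (z w : ℕ → ℝ) (i k : ℕ) : window (z - w) i k = window z i k - window w i k := by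
  simp [window]

theorem window_const (a : ℝ) (i k : ℕ) : window (fun _ => a) i k = k * a := by
  simp [window]

theorem window_sub_const (z : ℕ → ℝ) (a : ℝ) (i k : ℕ) :
    window (fun l => z l - a) i k = window z i k - k * a := by
  simp [window]

theorem window_mono {z w : ℕ → ℝ} {i k : ℕ} (h : ∀ l < k, z (i + l) ≤ w (i + l)) :
    window z i k ≤ window w i k :=
  sum_le_sum fun l hl => h l (mem_range.1 hl)

theorem mul_le_window {z : ℕ → ℝ} {r : ℝ} {i k : ℕ} (h : ∀ l < k, r ≤ z (i + l)) :
    k * r ≤ window z i k :=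
  (window_const r i k).symm.le.trans (window_mono h)

theorem window_congr {z w : ℕ → ℝ} {i j k : ℕ} (h : ∀ l < k, z (i + l) = w (j + l)) :
    window z i k = window w j k :=
  sum_congr rfl fun l hl => h l (mem_range.1 hl)

theorem window_reflect (z : ℕ → ℝ) {n i k : ℕ} (h : i + k ≤ n) :
    window (fun l => z (n - 1 - l)) i k = window z (n - k - i) k := by
  unfold window
  rw [← sum_range_reflect]
  refine sum_congr rfl fun l hl => congrArg z ?_
  have hlk := mem_range.1 hl
  omega

theorem sum_range_add_right (ζ : ℕ → ℝ) (n l : ℕ) :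
    ∑ i ∈ range n, ζ (i + l) = ∑ i ∈ Ico l (n + l), ζ i := by
  rw [range_eq_Ico, sum_Ico_add', zero_add]

theorem Ico_window_subset {L k l : ℕ} (hl : l < k) : Ico l (L + 1 - k + l) ⊆ range L := by
  intro i hi
  simp only [mem_Ico, mem_range] at hi ⊢
  omega

theorem sum_window_eq (ζ : ℕ → ℝ) (n k : ℕ) :
    ∑ i ∈ range n, window ζ i k = ∑ l ∈ range k, ∑ i ∈ Ico l (n + l), ζ i := by
  simp only [window, ← sum_range_add_right]
  exact sum_comm

theorem sum_sq_window_le (ζ : ℕ → ℝ) (L k : ℕ) :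
    ∑ i ∈ range (L + 1 - k), window ζ i k ^ 2 ≤ (k : ℝ) ^ 2 * ∑ l ∈ range L, ζ l ^ 2 :=
  calc ∑ i ∈ range (L + 1 - k), window ζ i k ^ 2
      ≤ ∑ i ∈ range (L + 1 - k), k * window (fun l => ζ l ^ 2) i k :=
        sum_le_sum fun i _ => by
          simpa [window] using sq_sum_le_card_mul_sum_sq (s := range k) (f := fun l => ζ (i + l))
    _ = k * ∑ l ∈ range k, ∑ i ∈ Ico l (L + 1 - k + l), ζ i ^ 2 := by
        rw [← mul_sum, sum_window_eq]
    _ ≤ k * ∑ _l ∈ range k, ∑ i ∈ range L, ζ i ^ 2 := by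
        gcongr with l hl
        exact Ico_window_subset (mem_range.1 hl)
    _ = (k : ℝ) ^ 2 * ∑ l ∈ range L, ζ l ^ 2 := by
        rw [sum_const, card_range, nsmul_eq_mul]
        ring

theorem abs_sum_sub_sum_le {ι : Type*} [DecidableEq ι] {S T : Finset ι} (hST : S ⊆ T) (ζ : ι → ℝ) :
    |∑ i ∈ S, ζ i - ∑ i ∈ T, ζ i| ≤ #(T \ S) * √(∑ i ∈ T, ζ i ^ 2) := by
  have habs : ∀ i ∈ T \ S, |ζ i| ≤ √(∑ i ∈ T, ζ i ^ 2) := fun i hi =>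
    Real.abs_le_sqrt (single_le_sum (f := fun i => ζ i ^ 2) (fun _ _ => sq_nonneg _)
      (sdiff_subset hi))
  rw [← sum_sdiff hST, sub_add_cancel_right, abs_neg, ← nsmul_eq_mul]
  exact (abs_sum_le_sum_abs _ _).trans (sum_le_card_nsmul _ _ _ habs)

theorem abs_sum_window_sub_le (ζ : ℕ → ℝ) (L k : ℕ) :
    |∑ i ∈ range (L + 1 - k), window ζ i k - k * ∑ l ∈ range L, ζ l|
      ≤ (k : ℝ) ^ 2 * partialNorm L ζ := by
  have hshift : ∀ l ∈ range k, |∑ i ∈ Ico l (L + 1 - k + l), ζ i - ∑ i ∈ range L, ζ i|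
      ≤ k * partialNorm L ζ := by
    intro l hl
    have hsub := Ico_window_subset (L := L) (mem_range.1 hl)
    have hcard : #(range L \ Ico l (L + 1 - k + l)) ≤ k := by
      rw [card_sdiff_of_subset hsub, card_range, Nat.card_Ico]
      omega
    exact (abs_sum_sub_sum_le hsub ζ).trans
      (mul_le_mul_of_nonneg_right (Nat.cast_le.2 hcard) (partialNorm_nonneg L ζ))
  calc |∑ i ∈ range (L + 1 - k), window ζ i k - k * ∑ l ∈ range L, ζ l|
      = |∑ l ∈ range k, (∑ i ∈ Ico l (L + 1 - k + l), ζ i - ∑ i ∈ range L, ζ i)| := by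
        rw [sum_window_eq, sum_sub_distrib, sum_const, card_range, nsmul_eq_mul]
    _ ≤ ∑ l ∈ range k, |∑ i ∈ Ico l (L + 1 - k + l), ζ i - ∑ i ∈ range L, ζ i| :=
        abs_sum_le_sum_abs _ _
    _ ≤ #(range k) • (k * partialNorm L ζ) := sum_le_card_nsmul _ _ _ hshift
    _ = (k : ℝ) ^ 2 * partialNorm L ζ := by
        rw [card_range, nsmul_eq_mul]
        ring

theorem sum_abs_window_mul_le (ζ η : ℕ → ℝ) (L k : ℕ) :
    ∑ i ∈ range (L + 1 - k), |window ζ i k| * |window η i k|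
      ≤ (k : ℝ) ^ 2 * (partialNorm L ζ * partialNorm L η) := by
  have hnorm : ∀ ξ : ℕ → ℝ,
      √(∑ i ∈ range (L + 1 - k), |window ξ i k| ^ 2) ≤ k * partialNorm L ξ := fun ξ => by
    simp only [sq_abs]
    refine Real.sqrt_le_iff.2 ⟨mul_nonneg k.cast_nonneg (partialNorm_nonneg L ξ), ?_⟩
    rw [mul_pow, sq_partialNorm]
    exact sum_sq_window_le ξ L k
  calc ∑ i ∈ range (L + 1 - k), |window ζ i k| * |window η i k|
      ≤ (k * partialNorm L ζ) * (k * partialNorm L η) :=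
        (Real.sum_mul_le_sqrt_mul_sqrt _ _ _).trans
          (mul_le_mul (hnorm ζ) (hnorm η) (Real.sqrt_nonneg _)
            (mul_nonneg k.cast_nonneg (partialNorm_nonneg L ζ)))
    _ = (k : ℝ) ^ 2 * (partialNorm L ζ * partialNorm L η) := by ring

/-! ### Energies of finite chains -/

/-- The energy of `N` particles with spacings `z`, where particles whose labels differ by `k`
interact through `V k` and a pressure `p` acts on the total length. -/
def pairEnergy (V : ℕ → ℝ → ℝ) (p : ℝ) (N : ℕ) (z : ℕ → ℝ) : ℝ :=
  ∑ j ∈ range N, ∑ i ∈ range j, V (j - i) (window z i (j - i)) + p * ∑ l ∈ range (N - 1), z l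

theorem sum_pairs_eq_sum_left {f : ℕ → ℕ → ℝ} (hf : ∀ i, f i 0 = 0) (N : ℕ) :
    ∑ j ∈ range N, ∑ i ∈ range j, f i (j - i) = ∑ i ∈ range N, ∑ k ∈ range (N - i), f i k := by
  rw [← sum_range_diag_flip]
  exact sum_congr rfl fun j _ => by rw [sum_range_succ, Nat.sub_self, hf, add_zero]

theorem pairEnergy_eq_sum_left {V : ℕ → ℝ → ℝ} (hV : ∀ x, V 0 x = 0) (p : ℝ) (N : ℕ)
    (z : ℕ → ℝ) :
    pairEnergy V p N z = ∑ i ∈ range N, ∑ k ∈ range (N - i), V k (window z i k)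
      + p * ∑ l ∈ range (N - 1), z l := by
  rw [pairEnergy, sum_pairs_eq_sum_left (f := fun i k => V k (window z i k)) fun _ => hV _]

theorem pairEnergy_eq_sum_diff {V : ℕ → ℝ → ℝ} (hV : ∀ x, V 0 x = 0) (p : ℝ) (N : ℕ)
    (z : ℕ → ℝ) :
    pairEnergy V p N z = ∑ k ∈ range N, ∑ i ∈ range (N - k), V k (window z i k)
      + p * ∑ l ∈ range (N - 1), z l := by
  rw [pairEnergy_eq_sum_left hV]
  congr 1
  refine sum_comm' fun i k => ?_
  simp only [mem_range]
  omega

theorem pairEnergy_congr (V : ℕ → ℝ → ℝ) (p : ℝ) {N : ℕ} {z w : ℕ → ℝ}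
    (h : ∀ l, l + 1 < N → z l = w l) : pairEnergy V p N z = pairEnergy V p N w := by
  unfold pairEnergy
  congr 1
  · refine sum_congr rfl fun j hj => sum_congr rfl fun i hi => congrArg _ ?_
    rw [mem_range] at hj hi
    exact window_congr fun l hl => h _ (by omega)
  · refine congrArg _ (sum_congr rfl fun l hl => h l ?_)
    rw [mem_range] at hl
    omega

theorem tsum_mul_sum_sq_le {c : ℕ → ℝ} (hc : ∀ k, 2 ≤ k → c k ≤ 0)
    (hcs : Summable fun k : ℕ => (k : ℝ) ^ 2 * c k) (L : ℕ) (ζ : ℕ → ℝ) :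
    (∑' k : ℕ, (k : ℝ) ^ 2 * c k) * ∑ l ∈ range L, ζ l ^ 2
      ≤ ∑ k ∈ range (L + 1), c k * ∑ i ∈ range (L + 1 - k), window ζ i k ^ 2 := by
  have hterm : ∀ k ∈ range (L + 1), (k : ℝ) ^ 2 * c k * ∑ l ∈ range L, ζ l ^ 2
      ≤ c k * ∑ i ∈ range (L + 1 - k), window ζ i k ^ 2 := by
    rintro (_ | _ | k) -
    · simp [window_zero]
    · simp [window_one]
    · rw [mul_comm _ (c _), mul_assoc]
      exact mul_le_mul_of_nonpos_left (sum_sq_window_le ζ L _) (hc _ (by omega))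
  have htail : (∑' k : ℕ, (k : ℝ) ^ 2 * c k) * ∑ l ∈ range L, ζ l ^ 2
      ≤ (∑ k ∈ range (L + 1), (k : ℝ) ^ 2 * c k) * ∑ l ∈ range L, ζ l ^ 2 := by
    rcases L.eq_zero_or_pos with rfl | hL
    · simp
    · refine mul_le_mul_of_nonneg_right ?_ (sum_nonneg fun _ _ => sq_nonneg _)
      rw [← hcs.sum_add_tsum_nat_add (L + 1)]
      exact add_le_of_nonpos_right (tsum_nonpos fun k =>
        mul_nonpos_of_nonneg_of_nonpos (sq_nonneg _) (hc _ (by omega)))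
  rw [sum_mul] at htail
  exact htail.trans (sum_le_sum hterm)

theorem pairEnergy_combo_le {V : ℕ → ℝ → ℝ} (hV : ∀ x, V 0 x = 0) {p : ℝ} {c : ℕ → ℝ}
    {L : ℕ} {z w : ℕ → ℝ} {t u : ℝ}
    (h : ∀ k i, 1 ≤ k → i + k ≤ L → V k (t * window z i k + u * window w i k)
      ≤ t * V k (window z i k) + u * V k (window w i k)
        - t * u * (c k / 2 * (window z i k - window w i k) ^ 2)) :
    pairEnergy V p (L + 1) (t • z + u • w)
      ≤ t * pairEnergy V p (L + 1) z + u * pairEnergy V p (L + 1) w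
        - t * u / 2 * ∑ k ∈ range (L + 1), c k * ∑ i ∈ range (L + 1 - k),
          window (z - w) i k ^ 2 := by
  have hpair : ∀ k ∈ range (L + 1), ∀ i ∈ range (L + 1 - k),
      V k (window (t • z + u • w) i k) ≤ t * V k (window z i k) + u * V k (window w i k)
        - t * u / 2 * (c k * window (z - w) i k ^ 2) := by
    intro k _ i hi
    rw [mem_range] at hi
    rcases k.eq_zero_or_pos with rfl | hk
    · simp [hV, window_zero]
    · rw [window_combo, window_sub]
      exact (h k i hk (by omega)).trans_eq (by ring)
  have hsum := sum_le_sum fun k hk => sum_le_sum (hpair k hk)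
  have hlength : ∑ l ∈ range L, (t • z + u • w) l
      = t * ∑ l ∈ range L, z l + u * ∑ l ∈ range L, w l := by
    simp [sum_add_distrib, mul_sum]
  simp only [sum_sub_distrib, sum_add_distrib, ← mul_sum] at hsum
  simp only [pairEnergy_eq_sum_diff hV, Nat.add_sub_cancel, hlength]
  linarith

theorem pairEnergy_strong_convexity {V : ℕ → ℝ → ℝ} (hV : ∀ x, V 0 x = 0) {p : ℝ} {c : ℕ → ℝ}
    (hc : ∀ k, 2 ≤ k → c k ≤ 0) (hcs : Summable fun k : ℕ => (k : ℝ) ^ 2 * c k)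
    {L : ℕ} {z w : ℕ → ℝ} {t u : ℝ} (ht : 0 ≤ t) (hu : 0 ≤ u)
    (h : ∀ k i, 1 ≤ k → i + k ≤ L → V k (t * window z i k + u * window w i k)
      ≤ t * V k (window z i k) + u * V k (window w i k)
        - t * u * (c k / 2 * (window z i k - window w i k) ^ 2)) :
    pairEnergy V p (L + 1) (t • z + u • w)
      ≤ t * pairEnergy V p (L + 1) z + u * pairEnergy V p (L + 1) w
        - t * u * ((∑' k : ℕ, (k : ℝ) ^ 2 * c k) / 2 * partialNorm L (z - w) ^ 2) := by
  have hconv := pairEnergy_combo_le hV (p := p) h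
  have hmod := mul_le_mul_of_nonneg_left (tsum_mul_sum_sq_le hc hcs L (z - w)) (mul_nonneg ht hu)
  rw [sq_partialNorm]
  linarith

/-- Replacing every window sum by `k` times the total strain costs at most `k ^ 2` norms of the
strain, and the resulting total is zero because `a` is critical, that is `p + ∑ k D k = 0`. -/
theorem abs_sum_mul_window_add_le {p : ℝ} {D : ℕ → ℝ}
    (hD : Summable fun k : ℕ => (k : ℝ) ^ 2 * |D k|) (hp : p + ∑' k : ℕ, k * D k = 0)
    (L : ℕ) (ζ : ℕ → ℝ) :
    |∑ k ∈ range (L + 1), D k * ∑ i ∈ range (L + 1 - k), window ζ i k + p * ∑ l ∈ range L, ζ l|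
      ≤ (∑' k : ℕ, (k : ℝ) ^ 2 * |D k|) * partialNorm L ζ := by
  set T : ℕ → ℝ := fun k => ∑ i ∈ range (L + 1 - k), window ζ i k
  set σ := ∑ l ∈ range L, ζ l
  have hkD : Summable fun k : ℕ => k * D k := by
    refine hD.of_norm_bounded fun k => ?_
    rw [Real.norm_eq_abs, abs_mul, Nat.abs_cast]
    exact mul_le_mul_of_nonneg_right (mod_cast Nat.le_self_pow two_ne_zero k) (abs_nonneg _)
  have hDT : HasSum (fun k => D k * T k) (∑ k ∈ range (L + 1), D k * T k) :=
    hasSum_sum_of_ne_finset_zero fun k hk => by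
      have hk0 : L + 1 - k = 0 := by
        rw [mem_range] at hk
        omega
      simp [T, hk0]
  have hdiff : HasSum (fun k : ℕ => D k * (T k - k * σ))
      (∑ k ∈ range (L + 1), D k * T k + p * σ) := by
    rw [eq_neg_of_add_eq_zero_left hp, neg_mul, ← sub_eq_add_neg]
    exact (hDT.sub (hkD.hasSum.mul_right σ)).congr_fun fun k => by ring
  have hbound : ∀ k : ℕ, |D k * (T k - k * σ)| ≤ (k : ℝ) ^ 2 * |D k| * partialNorm L ζ := by
    intro k
    rw [abs_mul]
    exact (mul_le_mul_of_nonneg_left (abs_sum_window_sub_le ζ L k) (abs_nonneg _)).trans_eq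
      (by ring)
  rw [← hdiff.tsum_eq, ← tsum_mul_right]
  exact tsum_of_norm_bounded (f := fun k : ℕ => D k * (T k - k * σ))
    (hD.mul_right _).hasSum hbound

theorem abs_sum_pair_sub_sum_le {U : ℝ → ℝ} {a D B : ℝ} (hB : 0 ≤ B) {L k : ℕ} {z w : ℕ → ℝ}
    {M : ℝ} (hz : partialNorm L (fun l => z l - a) ≤ M)
    (hw : partialNorm L (fun l => w l - a) ≤ M)
    (h : ∀ i, i + k ≤ L → |U (window z i k) - U (window w i k) - D * (window z i k - window w i k)|
      ≤ B * (|window z i k - window w i k| * (|window z i k - k * a| + |window w i k - k * a|)))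
    (hk : k ≤ L) :
    |∑ i ∈ range (L + 1 - k), U (window z i k) - ∑ i ∈ range (L + 1 - k), U (window w i k)
        - D * ∑ i ∈ range (L + 1 - k), window (z - w) i k|
      ≤ (k : ℝ) ^ 2 * B * (2 * M * partialNorm L (z - w)) := by
  have hCS : ∀ y : ℕ → ℝ, partialNorm L (fun l => y l - a) ≤ M →
      ∑ i ∈ range (L + 1 - k), |window (z - w) i k| * |window (fun l => y l - a) i k|
        ≤ (k : ℝ) ^ 2 * (partialNorm L (z - w) * M) := fun y hy =>
    (sum_abs_window_mul_le _ _ L k).trans (mul_le_mul_of_nonneg_left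
      (mul_le_mul_of_nonneg_left hy (partialNorm_nonneg _ _)) (sq_nonneg _))
  rw [← sum_sub_distrib, mul_sum, ← sum_sub_distrib]
  calc |∑ i ∈ range (L + 1 - k),
        (U (window z i k) - U (window w i k) - D * window (z - w) i k)|
      ≤ ∑ i ∈ range (L + 1 - k), B * (|window (z - w) i k| * |window (fun l => z l - a) i k|
          + |window (z - w) i k| * |window (fun l => w l - a) i k|) := by
        refine (abs_sum_le_sum_abs _ _).trans (sum_le_sum fun i hi => ?_)
        rw [mem_range] at hi
        simpa only [window_sub, window_sub_const, ← mul_add] using h i (by omega)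
    _ ≤ B * ((k : ℝ) ^ 2 * (partialNorm L (z - w) * M)
          + (k : ℝ) ^ 2 * (partialNorm L (z - w) * M)) := by
        rw [← mul_sum, sum_add_distrib]
        exact mul_le_mul_of_nonneg_left (add_le_add (hCS z hz) (hCS w hw)) hB
    _ = (k : ℝ) ^ 2 * B * (2 * M * partialNorm L (z - w)) := by ring

theorem abs_pairEnergy_sub_le {V : ℕ → ℝ → ℝ} (hV : ∀ x, V 0 x = 0) {p a : ℝ} {D B : ℕ → ℝ}
    (hB : ∀ k, 0 ≤ B k) (hDs : Summable fun k : ℕ => (k : ℝ) ^ 2 * |D k|)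
    (hBs : Summable fun k : ℕ => (k : ℝ) ^ 2 * B k) (hp : p + ∑' k : ℕ, k * D k = 0)
    {L : ℕ} {z w : ℕ → ℝ} {M : ℝ} (hz : partialNorm L (fun l => z l - a) ≤ M)
    (hw : partialNorm L (fun l => w l - a) ≤ M)
    (h : ∀ k i, 1 ≤ k → i + k ≤ L →
      |V k (window z i k) - V k (window w i k) - D k * (window z i k - window w i k)|
      ≤ B k * (|window z i k - window w i k|
        * (|window z i k - k * a| + |window w i k - k * a|))) :
    |pairEnergy V p (L + 1) z - pairEnergy V p (L + 1) w|
      ≤ (∑' k : ℕ, (k : ℝ) ^ 2 * |D k| + 2 * M * ∑' k : ℕ, (k : ℝ) ^ 2 * B k)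
        * partialNorm L (z - w) := by
  set R : ℕ → ℝ := fun k => ∑ i ∈ range (L + 1 - k), V k (window z i k)
    - ∑ i ∈ range (L + 1 - k), V k (window w i k)
    - D k * ∑ i ∈ range (L + 1 - k), window (z - w) i k
  have hM : 0 ≤ M := (partialNorm_nonneg _ _).trans hz
  have hR : ∀ k ∈ range (L + 1), |R k| ≤ (k : ℝ) ^ 2 * B k * (2 * M * partialNorm L (z - w)) := by
    intro k hk
    rcases k.eq_zero_or_pos with rfl | hk1
    · simp [R, hV, window_zero]
    · exact abs_sum_pair_sub_sum_le (hB k) hz hw (fun i => h k i hk1) (mem_range_succ_iff.1 hk)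
  have hremainder : |∑ k ∈ range (L + 1), R k|
      ≤ (∑' k : ℕ, (k : ℝ) ^ 2 * B k) * (2 * M * partialNorm L (z - w)) := by
    refine (abs_sum_le_sum_abs _ _).trans ((sum_le_sum hR).trans ?_)
    rw [← sum_mul]
    exact mul_le_mul_of_nonneg_right (hBs.sum_le_tsum _ fun k _ => mul_nonneg (sq_nonneg _) (hB k))
      (mul_nonneg (mul_nonneg zero_le_two hM) (partialNorm_nonneg _ _))
  have hsplit : pairEnergy V p (L + 1) z - pairEnergy V p (L + 1) w
      = ∑ k ∈ range (L + 1), R k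
        + (∑ k ∈ range (L + 1), D k * ∑ i ∈ range (L + 1 - k), window (z - w) i k
          + p * ∑ l ∈ range L, (z - w) l) := by
    simp only [R, pairEnergy_eq_sum_diff hV, sum_sub_distrib, Pi.sub_apply, Nat.add_sub_cancel]
    ring
  rw [hsplit]
  refine (abs_add_le _ _).trans ((add_le_add hremainder
    (abs_sum_mul_window_add_le hDs hp L (z - w))).trans_eq ?_)
  ring

theorem pairEnergy_split (V : ℕ → ℝ → ℝ) (p : ℝ) (n n' : ℕ) (z : ℕ → ℝ) :
    pairEnergy V p (n + n' + 1) z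
      = pairEnergy V p (n + 1) z + pairEnergy V p (n' + 1) (fun l => z (n + l))
        + ∑ i ∈ range n, ∑ q ∈ range n', V (i + q + 2) (window z (n - 1 - i) (i + q + 2)) := by
  have hinner : ∀ q ∈ range n', ∑ i ∈ range (n + 1 + q),
      V (n + 1 + q - i) (window z i (n + 1 + q - i))
      = ∑ i ∈ range n, V (i + q + 2) (window z (n - 1 - i) (i + q + 2))
        + ∑ i ∈ range (q + 1), V (q + 1 - i) (window (fun l => z (n + l)) i (q + 1 - i)) := by
    intro q _
    rw [show n + 1 + q = n + (q + 1) by omega, sum_range_add]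
    congr 1
    · rw [← sum_range_reflect]
      refine sum_congr rfl fun i hi => ?_
      rw [mem_range] at hi
      rw [show n + (q + 1) - (n - 1 - i) = i + q + 2 by omega]
    · refine sum_congr rfl fun i _ => ?_
      rw [show n + (q + 1) - (n + i) = q + 1 - i by omega]
      exact congrArg _ (window_congr fun l _ => by rw [add_assoc])
  unfold pairEnergy
  rw [show n + n' + 1 = n + 1 + n' by omega, sum_range_add, sum_congr rfl hinner,
    sum_add_distrib, show n + 1 + n' - 1 = n + n' by omega, sum_range_add z n n',
    sum_range_succ' (fun j => ∑ i ∈ range j, V (j - i) (window (fun l => z (n + l)) i (j - i))) n',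
    sum_comm (s := range n')]
  simp only [range_zero, sum_empty, Nat.add_sub_cancel]
  ring

theorem pairEnergy_reflect {V : ℕ → ℝ → ℝ} (hV : ∀ x, V 0 x = 0) (p : ℝ) (n : ℕ) (z : ℕ → ℝ) :
    pairEnergy V p (n + 1) (fun l => z (n - 1 - l)) = pairEnergy V p (n + 1) z := by
  rw [pairEnergy_eq_sum_diff hV, pairEnergy_eq_sum_diff hV, Nat.add_sub_cancel, sum_range_reflect]
  congr 1
  refine sum_congr rfl fun k _ => ?_
  rw [← sum_range_reflect]
  refine sum_congr rfl fun i hi => ?_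
  rw [mem_range] at hi
  rw [window_reflect z (by omega), show n - k - (n + 1 - k - 1 - i) = i by omega]

theorem sum_headEnergies_eq {V : ℕ → ℝ → ℝ} (hV : ∀ x, V 0 x = 0) (p : ℝ) (n : ℕ) {z : ℕ → ℝ}
    (hs : ∀ j, Summable fun k => V k (window z j k)) :
    ∑ j ∈ range n, (p * z j + ∑' k, V k (window z j k))
      = pairEnergy V p (n + 1) z
        + ∑ i ∈ range n, ∑' q, V (i + q + 2) (window z (n - 1 - i) (i + q + 2)) := by
  have hcut : ∀ j ∈ range n, p * z j + ∑' k, V k (window z j k)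
      = p * z j + ∑ k ∈ range (n + 1 - j), V k (window z j k)
        + ∑' q, V (q + (n + 1 - j)) (window z j (q + (n + 1 - j))) := by
    intro j _
    rw [← (hs j).sum_add_tsum_nat_add (n + 1 - j)]
    ring
  have htail : ∑ j ∈ range n, ∑' q, V (q + (n + 1 - j)) (window z j (q + (n + 1 - j)))
      = ∑ i ∈ range n, ∑' q, V (i + q + 2) (window z (n - 1 - i) (i + q + 2)) := by
    rw [← sum_range_reflect]
    refine sum_congr rfl fun i hi => tsum_congr fun q => ?_
    rw [mem_range] at hi
    rw [show q + (n + 1 - (n - 1 - i)) = i + q + 2 by omega]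
  rw [sum_congr rfl hcut, sum_add_distrib, sum_add_distrib, htail, pairEnergy_eq_sum_left hV,
    sum_range_succ _ n, Nat.add_sub_cancel_left, range_one, sum_singleton, hV, Nat.add_sub_cancel,
    ← mul_sum]
  ring

theorem hasSum_antidiagonal {f : ℕ → ℝ} (hf : Summable fun n : ℕ => ((n : ℝ) + 1) * f n) :
    HasSum (fun x : ℕ × ℕ => f (x.1 + x.2)) (∑' n : ℕ, ((n : ℝ) + 1) * f n) := by
  have hfiber : ∀ (g : ℕ → ℝ) (n : ℕ),
      HasSum (fun c : HasAntidiagonal.antidiagonal n => g (c.1.1 + c.1.2))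
        (((n : ℝ) + 1) * g n) := by
    intro g n
    have hconst : ∀ c : HasAntidiagonal.antidiagonal n, g (c.1.1 + c.1.2) = g n := fun c => by
      rw [HasAntidiagonal.mem_antidiagonal.1 c.2]
    simp only [hconst]
    simpa using hasSum_fintype (fun _ : HasAntidiagonal.antidiagonal n => g n)
  have hsum : Summable ((fun x : ℕ × ℕ => f (x.1 + x.2))
      ∘ HasAntidiagonal.sigmaAntidiagonalEquivProd) := by
    refine summable_abs_iff.1 ((summable_sigma_of_nonneg fun _ => abs_nonneg _).2
      ⟨fun n => (hfiber (fun n => |f n|) n).summable, hf.abs.congr fun n => ?_⟩)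
    rw [abs_mul, abs_of_nonneg n.cast_add_one_pos.le]
    exact (hfiber (fun n => |f n|) n).tsum_eq.symm
  rw [← HasAntidiagonal.sigmaAntidiagonalEquivProd.hasSum_iff,
    (hsum.hasSum.sigma (hfiber f)).tsum_eq]
  exact hsum.hasSum

/-! ### Rearrangements of finite chains -/

open Classical in
/-- The potential between particles whose labels differ by `k`: it is `v` for `1 ≤ k ≤ m` and
vanishes otherwise. -/
def cutoff (v : ℝ → ℝ) (m : ℕ∞) (k : ℕ) (x : ℝ) : ℝ :=
  if 1 ≤ k ∧ (k : ℕ∞) ≤ m then v x else 0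

theorem cutoff_zero (v : ℝ → ℝ) (m : ℕ∞) (x : ℝ) : cutoff v m 0 x = 0 := by simp [cutoff]

theorem cutoff_of_le (v : ℝ → ℝ) {m : ℕ∞} {k : ℕ} (hk : 1 ≤ k) (hkm : (k : ℕ∞) ≤ m) (x : ℝ) :
    cutoff v m k x = v x := if_pos ⟨hk, hkm⟩

theorem cutoff_of_not_le (v : ℝ → ℝ) {m : ℕ∞} {k : ℕ} (hkm : ¬(k : ℕ∞) ≤ m) (x : ℝ) :
    cutoff v m k x = 0 := if_neg fun h => hkm h.2

theorem cutoff_one (v : ℝ → ℝ) {m : ℕ∞} (hm : 1 ≤ m) (x : ℝ) : cutoff v m 1 x = v x :=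
  cutoff_of_le v le_rfl (by simpa using hm) x

theorem cutoff_eq_or_eq_zero (v : ℝ → ℝ) (m : ℕ∞) (k : ℕ) :
    (∀ x, cutoff v m k x = v x) ∨ ∀ x, cutoff v m k x = 0 := by
  by_cases h : 1 ≤ k ∧ (k : ℕ∞) ≤ m
  · exact Or.inl fun x => if_pos h
  · exact Or.inr fun x => if_neg h

open Classical in
theorem cutoff_succ_sub (v : ℝ → ℝ) (m : ℕ∞) {k : ℕ} (hk : 1 ≤ k) (x : ℝ) :
    cutoff v m (k + 1) x - cutoff v m k x = if (k : ℕ∞) = m then -v x else 0 := by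
  rcases lt_trichotomy (k : ℕ∞) m with hlt | heq | hgt
  · rw [cutoff_of_le v hk hlt.le, cutoff_of_le v (by omega)
      (by simpa using Order.add_one_le_of_lt hlt), sub_self, if_neg hlt.ne]
  · rw [cutoff_of_le v hk heq.le, cutoff_of_not_le v, zero_sub, if_pos heq]
    rw [← heq, Nat.cast_le]
    omega
  · rw [cutoff_of_not_le v hgt.not_ge, cutoff_of_not_le v, sub_self, if_neg hgt.ne']
    exact fun h => hgt.not_ge (le_trans (Nat.cast_le.2 k.le_succ) h)

theorem cutoff_window_clip_le (hv : IsAdmissible v rhc zmin zmax α₁ α₂ s) {m : ℕ∞} (hm : 1 ≤ m)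
    {z : ℕ → ℝ} {i k : ℕ} (hz : ∀ l < k, zmin ≤ z (i + l)) :
    cutoff v m k (window (fun l => min (z l) zmax) i k) ≤ cutoff v m k (window z i k) := by
  rcases Nat.lt_or_ge k 2 with hk | hk
  · interval_cases k
    · simp [cutoff_zero]
    · have hzi : rhc < z i := hv.rhc_lt_zmin.trans_le (hz 0 one_pos)
      rw [cutoff_one v hm, cutoff_one v hm, window_one, window_one]
      exact hv.apply_min_zmax_le hzi
  · rcases cutoff_eq_or_eq_zero v m k with h | h
    · rw [h, h]
      have hk2 : (2 : ℝ) ≤ k := mod_cast hk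
      have hlow : zmax ≤ window (fun l => min (z l) zmax) i k := by
        refine le_trans ?_ (mul_le_window fun l hl => le_min (hz l hl) hv.zmin_lt_zmax.le)
        nlinarith [hv.zmax_lt, hv.zmin_pos]
      have hle : window (fun l => min (z l) zmax) i k ≤ window z i k :=
        window_mono fun l _ => min_le_left _ _
      exact hv.monotoneOn_Ici hlow (hlow.trans hle) hle
    · rw [h, h]

theorem pairEnergy_clip_le (hv : IsAdmissible v rhc zmin zmax α₁ α₂ s) {m : ℕ∞} (hm : 1 ≤ m)
    {p : ℝ} (hp : 0 ≤ p) {N : ℕ} {z : ℕ → ℝ} (hz : ∀ l, l + 1 < N → zmin ≤ z l) {j : ℕ}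
    (hj : j + 1 < N) :
    pairEnergy (cutoff v m) p N (fun l => min (z l) zmax) + (v (z j) - v (min (z j) zmax))
      ≤ pairEnergy (cutoff v m) p N z := by
  set g : ℕ → ℕ → ℝ := fun k i =>
    cutoff v m k (window z i k) - cutoff v m k (window (fun l => min (z l) zmax) i k)
  have hg : ∀ k i, i + k < N → 0 ≤ g k i := fun k i hik =>
    sub_nonneg.2 (cutoff_window_clip_le hv hm fun l hl => hz _ (by omega))
  have hg' : ∀ k, ∀ i ∈ range (N - k), 0 ≤ g k i := fun k i hi => hg k i (by
    rw [mem_range] at hi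
    omega)
  have hbond : v (z j) - v (min (z j) zmax) = g 1 j := by
    simp only [g, cutoff_one v hm, window_one]
  have hgain : g 1 j ≤ ∑ k ∈ range N, ∑ i ∈ range (N - k), g k i :=
    (single_le_sum (hg' 1) (mem_range.2 (by omega : j < N - 1))).trans
      (single_le_sum (f := fun k => ∑ i ∈ range (N - k), g k i)
        (fun k _ => sum_nonneg (hg' k)) (mem_range.2 (by omega : 1 < N)))
  have hlength : p * ∑ l ∈ range (N - 1), min (z l) zmax ≤ p * ∑ l ∈ range (N - 1), z l :=
    mul_le_mul_of_nonneg_left (sum_le_sum fun l _ => min_le_left _ _) hp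
  rw [pairEnergy_eq_sum_diff (cutoff_zero v m), pairEnergy_eq_sum_diff (cutoff_zero v m), hbond]
  simp only [g, sum_sub_distrib] at hgain ⊢
  linarith

/-- The spacings `y, z 0, z 1, …`: a particle is added on the left. -/
def consSpacing (y : ℝ) (z : ℕ → ℝ) : ℕ → ℝ
  | 0 => y
  | l + 1 => z l

theorem pairEnergy_consSpacing_le (hv : IsAdmissible v rhc zmin zmax α₁ α₂ s) {m : ℕ∞}
    (hm : 1 ≤ m) (p : ℝ) {n : ℕ} {z : ℕ → ℝ} (hz : ∀ l < n, 0 ≤ z l) :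
    pairEnergy (cutoff v m) p (n + 2) (consSpacing zmax z)
      ≤ pairEnergy (cutoff v m) p (n + 1) z + (v zmax + p * zmax) := by
  have htail : (fun l => consSpacing zmax z (1 + l)) = z := by
    funext l
    rw [add_comm]
    rfl
  have hbond : pairEnergy (cutoff v m) p (1 + 1) (consSpacing zmax z) = v zmax + p * zmax := by
    simp [pairEnergy, sum_range_succ, window, consSpacing, cutoff_one v hm]
  have hcross : ∀ q ∈ range n,
      cutoff v m (0 + q + 2) (window (consSpacing zmax z) 0 (0 + q + 2)) ≤ 0 := by
    intro q hq
    rw [mem_range] at hq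
    rcases cutoff_eq_or_eq_zero v m (0 + q + 2) with h | h
    · rw [h, show 0 + q + 2 = 1 + (q + 1) by omega, window_add, window_one]
      refine hv.nonpos_of_zmax_le (le_add_of_nonneg_right ?_)
      refine (mul_zero _).ge.trans (mul_le_window (r := 0) fun l hl => ?_)
      rw [show 0 + 1 + l = l + 1 by omega]
      exact hz l (by omega)
    · rw [h]
  have hsplit := pairEnergy_split (cutoff v m) p 1 n (consSpacing zmax z)
  rw [htail, hbond, range_one, sum_singleton, show 1 + n + 1 = n + 2 by omega] at hsplit
  linarith [sum_nonpos hcross]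

/-- The spacings after the removal of particle `j`. -/
def removeParticle (z : ℕ → ℝ) (j l : ℕ) : ℝ :=
  if l + 1 < j then z l else if l + 1 = j then z l + z (l + 1) else z (l + 1)

theorem removeParticle_of_le (z : ℕ → ℝ) {j l : ℕ} (h : j ≤ l) :
    removeParticle z j l = z (l + 1) := by
  rw [removeParticle, if_neg (by omega), if_neg (by omega)]

theorem lt_removeParticle {z : ℕ → ℝ} {ρ : ℝ} (hρ : 0 ≤ ρ) {j l : ℕ} (hl : ρ < z l)
    (hl' : ρ < z (l + 1)) : ρ < removeParticle z j l := by
  unfold removeParticle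
  split_ifs <;> linarith

theorem window_removeParticle_of_le (z : ℕ → ℝ) {i j : ℕ} (k : ℕ) (h : j ≤ i) :
    window (removeParticle z j) i k = window z (i + 1) k :=
  window_congr fun l _ => by rw [removeParticle_of_le z (by omega), add_right_comm]

theorem window_removeParticle_of_lt (z : ℕ → ℝ) {i j k : ℕ} (h : i + k < j) :
    window (removeParticle z j) i k = window z i k :=
  window_congr fun l hl => if_pos (by omega)

theorem window_removeParticle_of_lt_of_le (z : ℕ → ℝ) {i j k : ℕ} (hij : i < j)
    (hjk : j ≤ i + k) : window (removeParticle z j) i k = window z i (k + 1) := by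
  obtain ⟨d, rfl⟩ : ∃ d, j = i + d + 1 := ⟨j - i - 1, by omega⟩
  obtain ⟨e, rfl⟩ : ∃ e, k = d + (1 + e) := ⟨k - d - 1, by omega⟩
  rw [window_add, window_add _ _ 1, window_removeParticle_of_lt z (by omega),
    window_removeParticle_of_le z e le_rfl, show d + (1 + e) + 1 = d + (1 + (1 + e)) by omega,
    window_add, window_add _ _ 1, window_add _ _ 1, window_one, window_one, window_one,
    removeParticle, if_neg (lt_irrefl _), if_pos rfl]
  ring

theorem sum_removeParticle_le {z : ℕ → ℝ} {j n : ℕ} (hz : 0 ≤ z 0) (hj : j ≤ n) :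
    ∑ l ∈ range n, removeParticle z j l ≤ ∑ l ∈ range (n + 1), z l := by
  have hwindow : ∀ (y : ℕ → ℝ) k, ∑ l ∈ range k, y l = window y 0 k := fun y k => by
    simp [window]
  rw [hwindow, hwindow]
  rcases j.eq_zero_or_pos with rfl | hj0
  · rw [window_removeParticle_of_le z n le_rfl, add_comm n 1, window_add, window_one]
    exact le_add_of_nonneg_left hz
  · exact (window_removeParticle_of_lt_of_le z hj0 (by omega)).le

theorem sum_pairs_add (f : ℕ → ℕ → ℝ) (n n' : ℕ) :
    ∑ b ∈ range (n + n'), ∑ a ∈ range b, f a (b - a)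
      = ∑ b ∈ range n, ∑ a ∈ range b, f a (b - a)
        + ∑ i ∈ range n, ∑ q ∈ range n', f (n - 1 - i) (i + 1 + q)
        + ∑ q ∈ range n', ∑ a ∈ range q, f (n + a) (q - a) := by
  have hreflect : ∀ q, ∑ i ∈ range n, f (n - 1 - i) (i + 1 + q)
      = ∑ a ∈ range n, f a (n + q - a) := fun q => by
    rw [← sum_range_reflect (fun a => f a (n + q - a))]
    refine sum_congr rfl fun i hi => ?_
    rw [mem_range] at hi
    rw [show n + q - (n - 1 - i) = i + 1 + q by omega]
  rw [sum_range_add, sum_comm (s := range n), add_assoc, ← sum_add_distrib]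
  simp only [sum_range_add, hreflect, Nat.add_sub_add_left]

theorem sum_pairs_add_one_add (f : ℕ → ℕ → ℝ) (j R : ℕ) :
    ∑ b ∈ range (j + 1 + R), ∑ a ∈ range b, f a (b - a)
      = ∑ b ∈ range j, ∑ a ∈ range b, f a (b - a) + ∑ i ∈ range j, f (j - 1 - i) (i + 1)
        + ∑ q ∈ range R, f j (q + 1)
        + ∑ i ∈ range j, ∑ q ∈ range R, f (j - 1 - i) (i + 1 + q + 1)
        + ∑ q ∈ range R, ∑ a ∈ range q, f (j + 1 + a) (q - a) := by
  have hbonds : ∑ a ∈ range j, f a (j - a) = ∑ i ∈ range j, f (j - 1 - i) (i + 1) := by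
    rw [← sum_range_reflect]
    refine sum_congr rfl fun i hi => ?_
    rw [mem_range] at hi
    rw [show j - (j - 1 - i) = i + 1 by omega]
  have hcross : ∀ i q, f (j + 1 - 1 - (i + 1)) (i + 1 + 1 + q) = f (j - 1 - i) (i + 1 + q + 1) :=
    fun i q => by rw [show j + 1 - 1 - (i + 1) = j - 1 - i by omega, add_right_comm]
  have hright : ∀ q, f (j + 1 - 1 - 0) (0 + 1 + q) = f j (q + 1) := fun q => by
    rw [zero_add, add_comm 1 q, Nat.sub_zero, Nat.add_sub_cancel]
  rw [sum_pairs_add, sum_range_succ, sum_range_succ' _ j, hbonds]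
  simp only [hcross, hright]
  ring

/-- The bonds of the removed particle are lost, and the bonds between its two sides change their
rank by one. -/
theorem pairEnergy_sub_removeParticle (V : ℕ → ℝ → ℝ) (p : ℝ) (z : ℕ → ℝ) (j R : ℕ) :
    pairEnergy V p (j + 1 + R) z - pairEnergy V p (j + R) (removeParticle z j)
      = ∑ i ∈ range j, (V (i + 1) (window z (j - 1 - i) (i + 1))
          + ∑ q ∈ range R, (V (i + 1 + q + 1) (window z (j - 1 - i) (i + 1 + q + 1))
            - V (i + 1 + q) (window z (j - 1 - i) (i + 1 + q + 1))))
        + ∑ q ∈ range R, V (q + 1) (window z j (q + 1))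
        + p * (∑ l ∈ range (j + R), z l - ∑ l ∈ range (j + R - 1), removeParticle z j l) := by
  have hleft : ∀ b ∈ range j, ∑ a ∈ range b, V (b - a) (window (removeParticle z j) a (b - a))
      = ∑ a ∈ range b, V (b - a) (window z a (b - a)) := fun b hb => sum_congr rfl fun a ha => by
    rw [mem_range] at ha hb
    rw [window_removeParticle_of_lt z (by omega)]
  have hcross : ∀ i ∈ range j, ∀ q ∈ range R,
      V (i + 1 + q) (window (removeParticle z j) (j - 1 - i) (i + 1 + q))
        = V (i + 1 + q) (window z (j - 1 - i) (i + 1 + q + 1)) := fun i hi q _ => by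
    rw [mem_range] at hi
    rw [window_removeParticle_of_lt_of_le z (by omega) (by omega)]
  have hright : ∀ a k, window (removeParticle z j) (j + a) k = window z (j + 1 + a) k :=
    fun a k => by rw [window_removeParticle_of_le z k (by omega), add_right_comm]
  simp only [pairEnergy, sum_pairs_add_one_add fun i k => V k (window z i k),
    sum_pairs_add fun i k => V k (window (removeParticle z j) i k), sum_congr rfl hleft,
    sum_congr rfl fun i hi => sum_congr rfl (hcross i hi), hright, sum_add_distrib,
    sum_sub_distrib]
  rw [show j + 1 + R - 1 = j + R by omega]
  ring

theorem sub_tsum_rpow_le_sum {α r : ℝ} (hα : 0 ≤ α) (hs : 1 < s) (hr : 0 < r) {β : ℝ} {f : ℕ → ℝ}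
    {R : ℕ} (hR : 1 ≤ R ∨ β ≤ 0) (hβ : 0 < R → β ≤ f 0)
    (hf : ∀ n, n + 1 < R → -α * (((n : ℝ) + 2) * r) ^ (-s) ≤ f (n + 1)) :
    β - α * ∑' n : ℕ, (((n : ℝ) + 2) * r) ^ (-s) ≤ ∑ n ∈ range R, f n := by
  have hsum : Summable fun n : ℕ => (((n : ℝ) + 2) * r) ^ (-s) := by
    refine (((summable_nat_add_iff 2).2 (Real.summable_nat_rpow.2
      (neg_lt_neg hs))).mul_right (r ^ (-s))).congr fun n => ?_
    rw [← Real.mul_rpow (Nat.cast_nonneg _) hr.le]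
    push_cast
    rfl
  have hnonneg : ∀ n : ℕ, 0 ≤ (((n : ℝ) + 2) * r) ^ (-s) := fun n => by positivity
  rcases R.eq_zero_or_pos with rfl | hRpos
  · have hβ0 : β ≤ 0 := by simpa using hR
    rw [range_zero, sum_empty]
    exact sub_nonpos.2 (hβ0.trans (mul_nonneg hα (tsum_nonneg hnonneg)))
  · obtain ⟨R, rfl⟩ := Nat.exists_eq_succ_of_ne_zero hRpos.ne'
    have htail : -α * ∑ n ∈ range R, (((n : ℝ) + 2) * r) ^ (-s) ≤ ∑ n ∈ range R, f (n + 1) := by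
      rw [mul_sum]
      exact sum_le_sum fun n hn => hf n (by simpa using hn)
    have hpartial := mul_le_mul_of_nonneg_left
      (hsum.sum_le_tsum (range R) fun n _ => hnonneg n) hα
    rw [sum_range_succ']
    linarith [hβ hRpos]

theorem IsAdmissible.neg_rpow_le_cutoff (hv : IsAdmissible v rhc zmin zmax α₁ α₂ s) (m : ℕ∞)
    {r x : ℝ} (hr : rhc < r) {k : ℕ} (hx : k * r ≤ x) :
    -α₁ * ((k : ℝ) * r) ^ (-s) ≤ cutoff v m k x := by
  have hr0 : 0 < r := hv.rhc_nonneg.trans_lt hr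
  by_cases hkm : 1 ≤ k ∧ (k : ℕ∞) ≤ m
  · have hk1 : (1 : ℝ) ≤ k := mod_cast hkm.1
    have hrpow : x ^ (-s) ≤ ((k : ℝ) * r) ^ (-s) :=
      Real.rpow_le_rpow_of_nonpos (by positivity) hx (by linarith [hv.two_lt_s])
    rw [cutoff_of_le v hkm.1 hkm.2]
    refine (mul_le_mul_of_nonpos_left hrpow (neg_nonpos.2 hv.α₁_pos.le)).trans
      (hv.lower_bound x ?_)
    nlinarith
  · rw [cutoff, if_neg hkm, neg_mul]
    exact neg_nonpos.2 (mul_nonneg hv.α₁_pos.le (by positivity))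

/-- Only the bond of rank exactly `m` is lost when a particle moves away by one rank. If it is
repulsive, it is dominated by the shorter bond to the removed particle. -/
theorem IsAdmissible.le_add_sum_cutoff_succ_sub (hv : IsAdmissible v rhc zmin zmax α₁ α₂ s)
    (m : ℕ∞) {i R : ℕ} (hi : 1 ≤ i) {d : ℝ} {e : ℕ → ℝ} (hd : rhc < d) (hde : ∀ q < R, d ≤ e q)
    {β : ℝ} (hβ : β ≤ 0) (hβd : β ≤ cutoff v m i d) :
    β ≤ cutoff v m i d
      + ∑ q ∈ range R, (cutoff v m (i + q + 1) (e q) - cutoff v m (i + q) (e q)) := by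
  classical
  simp only [cutoff_succ_sub v m (Nat.le_add_right_of_le hi)]
  by_cases hex : ∃ q < R, ((i + q : ℕ) : ℕ∞) = m
  · obtain ⟨q, hq, hqm⟩ := hex
    rw [sum_eq_single_of_mem q (mem_range.2 hq) fun b _ hb => if_neg fun h => hb (by
      rw [← hqm, Nat.cast_inj] at h
      omega), if_pos hqm, ← sub_eq_add_neg]
    rcases le_or_gt (v (e q)) 0 with hneg | hpos
    · linarith
    · have him : (i : ℕ∞) ≤ m := hqm ▸ Nat.cast_le.2 (Nat.le_add_right i q)
      have hez := (hv.lt_zmax_of_pos hpos).le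
      have hdom := hv.antitoneOn_Ioc ⟨hd, (hde q hq).trans hez⟩ ⟨hd.trans_le (hde q hq), hez⟩
        (hde q hq)
      rw [cutoff_of_le v hi him]
      linarith
  · rw [sum_eq_zero fun q hq => if_neg fun h => hex ⟨q, mem_range.1 hq, h⟩, add_zero]
    exact hβd

section
variable {m : ℕ∞} {p : ℝ} {j R : ℕ} {z : ℕ → ℝ}

theorem IsAdmissible.le_sum_left_bonds (hv : IsAdmissible v rhc zmin zmax α₁ α₂ s) (hm : 1 ≤ m)
    (hj : rhc < z j) (hmin : ∀ l < j + R, z j ≤ z l) :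
    v zmax - α₁ * ∑' n : ℕ, (((n : ℝ) + 2) * z j) ^ (-s)
      ≤ ∑ i ∈ range j, (cutoff v m (i + 1) (window z (j - 1 - i) (i + 1))
        + ∑ q ∈ range R, (cutoff v m (i + 1 + q + 1) (window z (j - 1 - i) (i + 1 + q + 1))
          - cutoff v m (i + 1 + q) (window z (j - 1 - i) (i + 1 + q + 1)))) := by
  have hzj : 0 < z j := hv.rhc_nonneg.trans_lt hj
  have hwindow : ∀ i < j, ((i + 1 : ℕ) : ℝ) * z j ≤ window z (j - 1 - i) (i + 1) := fun i hi =>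
    mul_le_window fun l hl => hmin _ (by omega)
  have hbond : ∀ i < j, ∀ β ≤ 0, β ≤ cutoff v m (i + 1) (window z (j - 1 - i) (i + 1)) →
      β ≤ cutoff v m (i + 1) (window z (j - 1 - i) (i + 1))
        + ∑ q ∈ range R, (cutoff v m (i + 1 + q + 1) (window z (j - 1 - i) (i + 1 + q + 1))
          - cutoff v m (i + 1 + q) (window z (j - 1 - i) (i + 1 + q + 1))) := by
    intro i hi β hβ hβV
    refine hv.le_add_sum_cutoff_succ_sub m (by omega) ?_ (fun q hq => ?_) hβ hβV
    · have := hwindow i hi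
      push_cast at this
      nlinarith
    · have htail : 0 ≤ window z (j - 1 - i + (i + 1)) (q + 1) :=
        (mul_zero _).ge.trans (mul_le_window fun l hl => hzj.le.trans (hmin _ (by omega)))
      rw [add_assoc _ q 1, window_add _ _ (i + 1) (q + 1)]
      exact le_add_of_nonneg_right htail
  refine sub_tsum_rpow_le_sum hv.α₁_pos.le (by linarith [hv.two_lt_s]) hzj
    (Or.inr hv.v_zmax_neg.le) (fun hj0 => hbond 0 hj0 _ hv.v_zmax_neg.le ?_) fun n hn => ?_
  · rw [zero_add, cutoff_one v hm]
    exact hv.apply_zmax_le (hj.trans_le (by simpa using hwindow 0 hj0))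
  · have hcast : (n : ℝ) + 2 = ((n + 1 + 1 : ℕ) : ℝ) := by
      push_cast
      ring
    rw [hcast]
    refine hbond _ hn _ ?_ (hv.neg_rpow_le_cutoff m hj (hwindow _ hn))
    rw [neg_mul]
    exact neg_nonpos.2 (mul_nonneg hv.α₁_pos.le (by positivity))

theorem IsAdmissible.le_sum_right_bonds (hv : IsAdmissible v rhc zmin zmax α₁ α₂ s) (hm : 1 ≤ m)
    (hR : 1 ≤ R) (hj : rhc < z j) (hmin : ∀ l < j + R, z j ≤ z l) :
    v (z j) - α₁ * ∑' n : ℕ, (((n : ℝ) + 2) * z j) ^ (-s)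
      ≤ ∑ q ∈ range R, cutoff v m (q + 1) (window z j (q + 1)) := by
  refine sub_tsum_rpow_le_sum hv.α₁_pos.le (by linarith [hv.two_lt_s])
    (hv.rhc_nonneg.trans_lt hj) (Or.inl hR) (fun _ => ?_) fun n hn => ?_
  · rw [zero_add, cutoff_one v hm, window_one]
  · have hcast : (n : ℝ) + 2 = ((n + 1 + 1 : ℕ) : ℝ) := by
      push_cast
      ring
    rw [hcast]
    exact hv.neg_rpow_le_cutoff m hj (mul_le_window fun l hl => hmin _ (by omega))

theorem pairEnergy_removeParticle_le (hv : IsAdmissible v rhc zmin zmax α₁ α₂ s) (hm : 1 ≤ m)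
    (hp : 0 ≤ p) (hR : 1 ≤ R) (hrhc : rhc < z j) (hmin : ∀ l < j + R, z j ≤ z l)
    (hj : z j < zmin) :
    pairEnergy (cutoff v m) p (j + R) (removeParticle z j)
      ≤ pairEnergy (cutoff v m) p (j + 1 + R) z := by
  have hlength : ∑ l ∈ range (j + R - 1), removeParticle z j l ≤ ∑ l ∈ range (j + R), z l := by
    have h := sum_removeParticle_le (n := j + R - 1) (j := j)
      (((hv.rhc_nonneg.trans_lt hrhc).le).trans (hmin 0 (by omega))) (by omega)
    rwa [Nat.sub_add_cancel (by omega)] at h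
  have hpressure := mul_nonneg hp (sub_nonneg.2 hlength)
  linarith [pairEnergy_sub_removeParticle (cutoff v m) p z j R, hv.repulsion _ hrhc hj,
    hv.le_sum_left_bonds hm hrhc hmin, hv.le_sum_right_bonds hm hR hrhc hmin]

theorem pairEnergy_exchange_le (hv : IsAdmissible v rhc zmin zmax α₁ α₂ s) (hm : 1 ≤ m)
    (hp : 0 ≤ p) {N : ℕ} (hjN : j + 1 < N) (hz : ∀ l, l + 1 < N → rhc < z l)
    (hmin : ∀ l, l + 1 < N → z j ≤ z l) (hj : z j < zmin) :
    pairEnergy (cutoff v m) p N (consSpacing zmax (removeParticle z j))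
      ≤ pairEnergy (cutoff v m) p N z + (v zmax + p * zmax) := by
  obtain ⟨R, rfl⟩ : ∃ R, N = j + 1 + (R + 1) := ⟨N - (j + 2), by omega⟩
  have hremove := pairEnergy_removeParticle_le hv hm hp (R := R + 1) (by omega) (hz j hjN)
    (fun l hl => hmin l (by omega)) hj
  have hcons := pairEnergy_consSpacing_le hv hm p (n := j + R) (z := removeParticle z j)
    fun l hl => hv.rhc_nonneg.trans
      (lt_removeParticle hv.rhc_nonneg (hz l (by omega)) (hz (l + 1) (by omega))).le
  rw [show j + 1 + (R + 1) = j + R + 2 by omega] at hremove ⊢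
  rw [← add_assoc] at hremove
  linarith

end

/-! ### Uniform bounds for the family of potentials -/

theorem summable_pow_mul_rpow {r C t : ℝ} {d : ℕ} (hr : 0 < r) (ht : 1 + d < t) :
    Summable fun k : ℕ => (k : ℝ) ^ d * (C * ((k : ℝ) * r) ^ (-t)) := by
  have hsum : Summable fun k : ℕ => (k : ℝ) ^ (d - t) * (C * r ^ (-t)) :=
    (Real.summable_nat_rpow.2 (by linarith)).mul_right _
  refine hsum.congr_cofinite ?_
  rw [Nat.cofinite_eq_atTop]
  filter_upwards [eventually_gt_atTop 0] with k hk
  have hk0 : (0 : ℝ) < k := Nat.cast_pos.2 hk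
  rw [Real.mul_rpow hk0.le hr.le, sub_eq_add_neg, Real.rpow_add hk0, Real.rpow_natCast]
  ring

theorem abs_cutoff_le {f : ℝ → ℝ} {C t r : ℝ} (hC : 0 ≤ C) (ht : 0 ≤ t) (hr : 0 < r)
    (hf : ∀ x, r ≤ x → |f x| ≤ C * x ^ (-t)) (m : ℕ∞) {k : ℕ} {x : ℝ}
    (hx : (k : ℝ) * r ≤ x) : |cutoff f m k x| ≤ C * ((k : ℝ) * r) ^ (-t) := by
  have hnonneg : 0 ≤ C * ((k : ℝ) * r) ^ (-t) := by positivity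
  rcases k.eq_zero_or_pos with rfl | hk
  · rwa [cutoff_zero, abs_zero]
  have hk1 : (1 : ℝ) ≤ k := mod_cast hk
  rcases cutoff_eq_or_eq_zero f m k with h | h
  · rw [h]
    exact (hf x (by nlinarith)).trans (mul_le_mul_of_nonneg_left
      (Real.rpow_le_rpow_of_nonpos (by positivity) hx (neg_nonpos.2 ht)) hC)
  · rwa [h, abs_zero]

theorem IsAdmissible.exists_summable_abs_cutoff_le (hv : IsAdmissible v rhc zmin zmax α₁ α₂ s)
    (m : ℕ∞) {r : ℝ} (hr : rhc < r) :
    ∃ G : ℕ → ℝ, (∀ k, 0 ≤ G k) ∧ (Summable fun k : ℕ => (k : ℝ) * G k) ∧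
      ∀ (k : ℕ) (x : ℝ), (k : ℝ) * r ≤ x → |cutoff v m k x| ≤ G k := by
  have hr0 : 0 < r := hv.rhc_nonneg.trans_lt hr
  obtain ⟨C, hC, hdecay⟩ := hv.exists_abs_le_rpow hr
  refine ⟨fun k => C * ((k : ℝ) * r) ^ (-s), fun k => by positivity, ?_, fun k x hx =>
    abs_cutoff_le hC (by linarith [hv.two_lt_s]) hr0 hdecay m hx⟩
  simpa only [pow_one] using
    summable_pow_mul_rpow (C := C) (d := 1) hr0 (by push_cast; linarith [hv.two_lt_s])

theorem IsAdmissible.exists_summable_abs_cutoff_deriv_le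
    (hv : IsAdmissible v rhc zmin zmax α₁ α₂ s) (m : ℕ∞) {r : ℝ} (hr : rhc < r) :
    ∃ G : ℕ → ℝ, (∀ k, 0 ≤ G k) ∧ (Summable fun k : ℕ => (k : ℝ) ^ 2 * G k) ∧
      ∀ (k : ℕ) (x : ℝ), (k : ℝ) * r ≤ x → |cutoff (deriv v) m k x| ≤ G k := by
  have hr0 : 0 < r := hv.rhc_nonneg.trans_lt hr
  obtain ⟨C, hC, hdecay⟩ := hv.exists_abs_deriv_le_rpow hr
  simp only [← neg_add'] at hdecay
  exact ⟨fun k => C * ((k : ℝ) * r) ^ (-(s + 1)), fun k => by positivity,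
    summable_pow_mul_rpow hr0 (by push_cast; linarith [hv.two_lt_s]), fun k x hx =>
    abs_cutoff_le hC (by linarith [hv.two_lt_s]) hr0 hdecay m hx⟩

theorem abs_sub_le_add_abs_sub_of_mem_uIcc {x y ξ : ℝ} (c : ℝ) (hξ : ξ ∈ Set.uIcc y x) :
    |ξ - c| ≤ |x - c| + |y - c| := by
  have hmax : |ξ - c| ≤ max |x - c| |y - c| := by
    rcases Set.mem_uIcc.1 hξ with ⟨hl, hu⟩ | ⟨hl, hu⟩
    · rw [max_comm]
      exact abs_le_max_abs_abs (sub_le_sub_right hl c) (sub_le_sub_right hu c)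
    · exact abs_le_max_abs_abs (sub_le_sub_right hl c) (sub_le_sub_right hu c)
  exact hmax.trans (max_le_add_of_nonneg (abs_nonneg _) (abs_nonneg _))

theorem abs_sub_sub_deriv_mul_le {f f' f'' : ℝ → ℝ} {D : Set ℝ} (hD : Convex ℝ D)
    (hf : ∀ x ∈ D, HasDerivAt f (f' x) x) (hf' : ∀ x ∈ D, HasDerivAt f' (f'' x) x) {B : ℝ}
    (hB : ∀ x ∈ D, |f'' x| ≤ B) {c x y : ℝ} (hc : c ∈ D) (hx : x ∈ D) (hy : y ∈ D) :
    |f x - f y - f' c * (x - y)| ≤ B * (|x - y| * (|x - c| + |y - c|)) := by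
  have hseg : Set.uIcc y x ⊆ D := hD.ordConnected.uIcc_subset hy hx
  have hderiv : ∀ ξ ∈ Set.uIcc y x,
      HasDerivWithinAt (fun ξ => f ξ - f' c * ξ) (f' ξ - f' c) (Set.uIcc y x) ξ := fun ξ hξ =>
    (((hf ξ (hseg hξ)).sub ((hasDerivAt_id ξ).const_mul (f' c))).congr_deriv
      (by ring)).hasDerivWithinAt
  have hbound : ∀ ξ ∈ Set.uIcc y x, ‖f' ξ - f' c‖ ≤ B * (|x - c| + |y - c|) := fun ξ hξ =>
    (hD.norm_image_sub_le_of_norm_hasDerivWithin_le (fun η hη => (hf' η hη).hasDerivWithinAt)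
      hB hc (hseg hξ)).trans (mul_le_mul_of_nonneg_left (abs_sub_le_add_abs_sub_of_mem_uIcc c hξ)
        ((abs_nonneg _).trans (hB c hc)))
  have hmean := (convex_uIcc y x).norm_image_sub_le_of_norm_hasDerivWithin_le hderiv hbound
    Set.left_mem_uIcc Set.right_mem_uIcc
  rw [Real.norm_eq_abs, Real.norm_eq_abs] at hmean
  calc |f x - f y - f' c * (x - y)| = |f x - f' c * x - (f y - f' c * y)| := by
        congr 1
        ring
    _ ≤ B * (|x - c| + |y - c|) * |x - y| := hmean
    _ = B * (|x - y| * (|x - c| + |y - c|)) := by ring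

theorem IsAdmissible.exists_cutoff_taylor (hv : IsAdmissible v rhc zmin zmax α₁ α₂ s) (m : ℕ∞)
    {r a : ℝ} (hr : rhc < r) (hra : r ≤ a) : ∃ B : ℕ → ℝ, (∀ k, 0 ≤ B k) ∧
      (Summable fun k : ℕ => (k : ℝ) ^ 2 * B k) ∧
      ∀ (k : ℕ) (x y : ℝ), 1 ≤ k → (k : ℝ) * r ≤ x → (k : ℝ) * r ≤ y →
        |cutoff v m k x - cutoff v m k y - cutoff (deriv v) m k (k * a) * (x - y)|
          ≤ B k * (|x - y| * (|x - k * a| + |y - k * a|)) := by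
  have hr0 : 0 < r := hv.rhc_nonneg.trans_lt hr
  obtain ⟨C, hC, hdecay⟩ := hv.exists_abs_deriv2_le_rpow hr
  simp only [← neg_add'] at hdecay
  refine ⟨fun k => C * ((k : ℝ) * r) ^ (-(s + 2)), fun k => by positivity,
    summable_pow_mul_rpow hr0 (by push_cast; linarith [hv.two_lt_s]), fun k x y hk hx hy => ?_⟩
  have hk1 : (1 : ℝ) ≤ k := mod_cast hk
  have hkr : r ≤ k * r := le_mul_of_one_le_left hr0.le hk1
  by_cases hkm : (k : ℕ∞) ≤ m
  · simp only [cutoff_of_le _ hk hkm]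
    refine abs_sub_sub_deriv_mul_le (convex_Ici ((k : ℝ) * r))
      (fun ξ hξ => hv.hasDerivAt (hr.trans_le (hkr.trans hξ)))
      (fun ξ hξ => hv.hasDerivAt_deriv (hr.trans_le (hkr.trans hξ))) (fun ξ hξ => ?_)
      (mul_le_mul_of_nonneg_left hra k.cast_nonneg) hx hy
    exact (hdecay ξ (hkr.trans hξ)).trans (mul_le_mul_of_nonneg_left
      (Real.rpow_le_rpow_of_nonpos (by positivity) hξ (by linarith [hv.two_lt_s])) hC)
  · simp only [cutoff_of_not_le _ hkm, sub_self, zero_mul, abs_zero]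
    positivity

/-! ### Convexity constants -/

/-- The lower bound on the second derivative of the potential between `k`-th neighbours while all
spacings stay in `[zmin, zmax]`. Only the one for `k = 1` is positive. -/
def convexityConst (v : ℝ → ℝ) (zmin zmax : ℝ) : ℕ → ℝ
  | 0 => 0
  | 1 => deriv (deriv v) zmax
  | k + 2 => deriv (deriv v) (((k : ℝ) + 2) * zmin)

/-- The modulus of strong convexity of the chain energies on `[zmin, zmax]`, uniform in the number
of particles. -/
def convexityModulus (v : ℝ → ℝ) (zmin zmax : ℝ) : ℝ :=
  ∑' k : ℕ, (k : ℝ) ^ 2 * convexityConst v zmin zmax k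

theorem IsAdmissible.convexityConst_nonpos (hv : IsAdmissible v rhc zmin zmax α₁ α₂ s) {k : ℕ}
    (hk : 2 ≤ k) : convexityConst v zmin zmax k ≤ 0 := by
  obtain ⟨k, rfl⟩ := Nat.exists_eq_add_of_le' hk
  exact hv.deriv2_nonpos _ (mul_le_mul_of_nonneg_right (le_add_of_nonneg_left k.cast_nonneg)
    hv.zmin_pos.le)

theorem IsAdmissible.summable_convexityConst (hv : IsAdmissible v rhc zmin zmax α₁ α₂ s) :
    Summable fun k : ℕ => (k : ℝ) ^ 2 * convexityConst v zmin zmax k := by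
  obtain ⟨C, -, hdecay⟩ := hv.exists_abs_deriv2_le_rpow hv.rhc_lt_zmin
  simp only [← neg_add'] at hdecay
  have hsum := summable_pow_mul_rpow (C := C) (t := s + 2) (d := 2) hv.zmin_pos
    (by push_cast; linarith [hv.two_lt_s])
  rw [← summable_nat_add_iff 2] at hsum ⊢
  refine Summable.of_norm_bounded hsum fun k => ?_
  rw [Real.norm_eq_abs, abs_mul, abs_of_nonneg (sq_nonneg _)]
  refine mul_le_mul_of_nonneg_left ?_ (sq_nonneg _)
  push_cast
  exact hdecay _ (le_mul_of_one_le_left hv.zmin_pos.le (by linarith [k.cast_nonneg (α := ℝ)]))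

theorem IsAdmissible.convexityModulus_pos (hv : IsAdmissible v rhc zmin zmax α₁ α₂ s) :
    0 < convexityModulus v zmin zmax := by
  rw [convexityModulus, ← hv.summable_convexityConst.sum_add_tsum_nat_add 2]
  simpa [sum_range_succ, convexityConst] using hv.deriv2_sum_pos

theorem IsAdmissible.strongConvexOn_cutoff (hv : IsAdmissible v rhc zmin zmax α₁ α₂ s) {m : ℕ∞}
    (hm : 1 ≤ m) (k : ℕ) :
    StrongConvexOn (Set.Icc (k * zmin) (k * zmax)) (convexityConst v zmin zmax k)
      (cutoff v m k) := by
  have hz := hv.zmin_pos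
  match k with
  | 0 =>
    rw [funext (cutoff_zero v m), convexityConst, strongConvexOn_zero]
    exact convexOn_const 0 (convex_Icc _ _)
  | 1 =>
    rw [funext (cutoff_one v hm), Nat.cast_one, one_mul, one_mul]
    exact strongConvexOn_of_hasDerivAt2 (convex_Icc zmin zmax)
      (fun x hx => hv.hasDerivAt (hv.rhc_lt_zmin.trans_le hx.1))
      (fun x hx => hv.hasDerivAt_deriv (hv.rhc_lt_zmin.trans_le hx.1))
      (fun x hx => hv.deriv2_antitone hx (Set.right_mem_Icc.2 hv.zmin_lt_zmax.le) hx.2)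
  | k + 2 =>
    rcases cutoff_eq_or_eq_zero v m (k + 2) with h | h
    · have hk : 2 * zmin ≤ ((k : ℝ) + 2) * zmin :=
        mul_le_mul_of_nonneg_right (le_add_of_nonneg_left k.cast_nonneg) hz.le
      rw [funext h, Nat.cast_add, Nat.cast_two]
      have hlt : ∀ x ∈ Set.Icc (((k : ℝ) + 2) * zmin) (((k : ℝ) + 2) * zmax), rhc < x :=
        fun x hx => by linarith [hx.1, hv.rhc_lt_zmin]
      exact strongConvexOn_of_hasDerivAt2 (convex_Icc _ _) (fun x hx => hv.hasDerivAt (hlt x hx))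
        (fun x hx => hv.hasDerivAt_deriv (hlt x hx))
        (fun x hx => hv.deriv2_monotone hk (hk.trans hx.1) hx.1)
    · rw [funext h]
      exact (strongConvexOn_zero.2 (convexOn_const 0 (convex_Icc _ _))).mono
        (hv.convexityConst_nonpos (by omega))

theorem pairEnergy_strong_convexity_of_mem_Icc (hv : IsAdmissible v rhc zmin zmax α₁ α₂ s)
    {m : ℕ∞} (hm : 1 ≤ m) (p : ℝ) {L : ℕ} {z w : ℕ → ℝ} {t u : ℝ} (ht : 0 ≤ t) (hu : 0 ≤ u)
    (htu : t + u = 1) (hz : ∀ l < L, z l ∈ Set.Icc zmin zmax)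
    (hw : ∀ l < L, w l ∈ Set.Icc zmin zmax) :
    pairEnergy (cutoff v m) p (L + 1) (t • z + u • w)
      ≤ t * pairEnergy (cutoff v m) p (L + 1) z + u * pairEnergy (cutoff v m) p (L + 1) w
        - t * u * (convexityModulus v zmin zmax / 2 * partialNorm L (z - w) ^ 2) := by
  refine pairEnergy_strong_convexity (cutoff_zero v m) (fun k hk => hv.convexityConst_nonpos hk)
    hv.summable_convexityConst ht hu fun k i _ hik => ?_
  have hmem : ∀ y : ℕ → ℝ, (∀ l < L, y l ∈ Set.Icc zmin zmax) →
      window y i k ∈ Set.Icc (k * zmin) (k * zmax) := fun y hy =>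
    ⟨mul_le_window fun l hl => (hy _ (by omega)).1,
      (window_mono fun l hl => (hy _ (by omega)).2).trans_eq (window_const zmax i k)⟩
  simpa only [smul_eq_mul, Real.norm_eq_abs, sq_abs] using
    (hv.strongConvexOn_cutoff hm k).2 (hmem z hz) (hmem w hw) ht hu htu

/-! ### The bulk energy -/

theorem bulkEnergy_eq (v : ℝ → ℝ) (m : ℕ∞) (p r : ℝ) :
    bulkEnergy v m p r = p * r + ∑' k : ℕ, cutoff v m k (k * r) := rfl

/-- The derivative of `bulkEnergy v m p`, so that the optimal spacing is characterised by
`bulkForce v m p a = 0`. -/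
def bulkForce (v : ℝ → ℝ) (m : ℕ∞) (p r : ℝ) : ℝ :=
  p + ∑' k : ℕ, (k : ℝ) * cutoff (deriv v) m k (k * r)

namespace IsAdmissible

theorem summable_cutoff (hv : IsAdmissible v rhc zmin zmax α₁ α₂ s) (m : ℕ∞) {r : ℝ}
    (hr : rhc < r) {x : ℕ → ℝ} (hx : ∀ k : ℕ, (k : ℝ) * r ≤ x k) :
    Summable fun k : ℕ => cutoff v m k (x k) := by
  obtain ⟨G, hG, hGs, hbound⟩ := hv.exists_summable_abs_cutoff_le m hr
  rw [← summable_nat_add_iff 1]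
  refine Summable.of_norm_bounded ((summable_nat_add_iff 1).2 hGs) fun k => ?_
  exact (hbound (k + 1) _ (hx _)).trans
    (le_mul_of_one_le_left (hG _) (Nat.one_le_cast.2 k.succ_pos))

theorem hasDerivAt_mul_cutoff (hv : IsAdmissible v rhc zmin zmax α₁ α₂ s) (m : ℕ∞) (k : ℕ)
    {x : ℝ} (hx : rhc < x) :
    HasDerivAt (fun x => cutoff v m k (k * x)) (k * cutoff (deriv v) m k (k * x)) x := by
  rcases k.eq_zero_or_pos with rfl | hk
  · simp only [cutoff_zero, mul_zero]
    exact hasDerivAt_const _ _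
  by_cases hkm : (k : ℕ∞) ≤ m
  · simp only [cutoff_of_le _ hk hkm]
    have hkx : rhc < k * x := hx.trans_le
      (le_mul_of_one_le_left (hv.rhc_nonneg.trans hx.le) (Nat.one_le_cast.2 hk))
    exact ((hv.hasDerivAt hkx).comp x ((hasDerivAt_id x).const_mul (k : ℝ))).congr_deriv (by ring)
  · simp only [cutoff_of_not_le _ hkm, mul_zero]
    exact hasDerivAt_const _ _

theorem hasDerivAt_bulkEnergy (hv : IsAdmissible v rhc zmin zmax α₁ α₂ s) (m : ℕ∞) (p : ℝ) {x : ℝ}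
    (hx : rhc < x) : HasDerivAt (bulkEnergy v m p) (bulkForce v m p x) x := by
  obtain ⟨r, hr, hrx⟩ := exists_between hx
  obtain ⟨G, -, hGs, hbound⟩ := hv.exists_summable_abs_cutoff_deriv_le m hr
  have hle : ∀ y ∈ Set.Ioi r, ∀ k : ℕ, (k : ℝ) * r ≤ k * y := fun y hy k =>
    mul_le_mul_of_nonneg_left (le_of_lt hy) k.cast_nonneg
  have hderiv : ∀ (k : ℕ) y, y ∈ Set.Ioi r → ‖(k : ℝ) * cutoff (deriv v) m k (k * y)‖
      ≤ (k : ℝ) ^ 2 * G k := fun k y hy => by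
    rw [norm_mul, Real.norm_natCast]
    exact mul_le_mul (mod_cast Nat.le_self_pow two_ne_zero k) (hbound k _ (hle y hy k))
      (norm_nonneg _) (sq_nonneg _)
  have htsum := hasDerivAt_tsum_of_isPreconnected hGs isOpen_Ioi (convex_Ioi r).isPreconnected
    (fun k y hy => hv.hasDerivAt_mul_cutoff m k (hr.trans hy)) hderiv hrx
    (hv.summable_cutoff m hr (hle x hrx)) hrx
  exact (((hasDerivAt_id x).const_mul p).add htsum).congr_deriv (by rw [mul_one, bulkForce])

theorem strongConvexOn_bulkEnergy (hv : IsAdmissible v rhc zmin zmax α₁ α₂ s) {m : ℕ∞}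
    (hm : 1 ≤ m) (p : ℝ) :
    StrongConvexOn (Set.Icc zmin zmax) (convexityModulus v zmin zmax) (bulkEnergy v m p) := by
  refine ⟨convex_Icc _ _, fun x hx y hy t u ht hu htu => ?_⟩
  have hsum : ∀ x ∈ Set.Icc zmin zmax, Summable fun k : ℕ => cutoff v m k (k * x) := fun x hx =>
    hv.summable_cutoff m hv.rhc_lt_zmin fun k => mul_le_mul_of_nonneg_left hx.1 k.cast_nonneg
  have hscale : ∀ x ∈ Set.Icc zmin zmax, ∀ k : ℕ, (k : ℝ) * x ∈ Set.Icc (k * zmin) (k * zmax) :=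
    fun x hx k => ⟨mul_le_mul_of_nonneg_left hx.1 k.cast_nonneg,
      mul_le_mul_of_nonneg_left hx.2 k.cast_nonneg⟩
  have hle := hasSum_le (fun k => ?_) (hsum _ (convex_Icc zmin zmax hx hy ht hu htu)).hasSum
    ((((hsum x hx).hasSum.mul_left t).add ((hsum y hy).hasSum.mul_left u)).sub
      (hv.summable_convexityConst.hasSum.mul_right (t * u * (x - y) ^ 2 / 2)))
  · simp only [bulkEnergy_eq, smul_eq_mul, Real.norm_eq_abs, sq_abs] at hle ⊢
    rw [convexityModulus]
    linarith
  · have hk := (hv.strongConvexOn_cutoff hm k).2 (hscale x hx k) (hscale y hy k) ht hu htu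
    rw [smul_eq_mul, smul_eq_mul, mul_left_comm t, mul_left_comm u, ← mul_add] at hk
    refine hk.trans_eq ?_
    simp only [smul_eq_mul, Real.norm_eq_abs, sq_abs]
    ring

theorem add_mul_zmax_neg (hv : IsAdmissible v rhc zmin zmax α₁ α₂ s) {p : ℝ}
    (hp : p < |v zmax| / zmax) : v zmax + p * zmax < 0 := by
  rw [lt_div_iff₀ hv.zmax_pos, abs_of_neg hv.v_zmax_neg] at hp
  linarith

theorem bulkEnergy_eq_add_tsum (hv : IsAdmissible v rhc zmin zmax α₁ α₂ s) {m : ℕ∞} (hm : 1 ≤ m)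
    (p : ℝ) {r : ℝ} (hr : rhc < r) :
    bulkEnergy v m p r = p * r + (v r + ∑' k : ℕ, cutoff v m (k + 2) ((k + 2) * r)) := by
  rw [bulkEnergy_eq, ← (hv.summable_cutoff m hr fun _ => le_rfl).sum_add_tsum_nat_add 2]
  simp [sum_range_succ, cutoff_zero, cutoff_one v hm]

theorem bulkEnergy_zmax_neg (hv : IsAdmissible v rhc zmin zmax α₁ α₂ s) {m : ℕ∞} (hm : 1 ≤ m)
    {p : ℝ} (hp : p < |v zmax| / zmax) : bulkEnergy v m p zmax < 0 := by
  have htail : ∑' k : ℕ, cutoff v m (k + 2) ((k + 2) * zmax) ≤ 0 := by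
    refine tsum_nonpos fun k => ?_
    rcases cutoff_eq_or_eq_zero v m (k + 2) with h | h
    · rw [h]
      exact hv.nonpos_of_zmax_le
        (le_mul_of_one_le_left hv.zmax_pos.le (by linarith [k.cast_nonneg (α := ℝ)]))
    · rw [h]
  rw [hv.bulkEnergy_eq_add_tsum hm p hv.rhc_lt_zmax]
  linarith [hv.add_mul_zmax_neg hp]

theorem bulkEnergy_pos (hv : IsAdmissible v rhc zmin zmax α₁ α₂ s) {m : ℕ∞} (hm : 1 ≤ m) {p : ℝ}
    (hp : 0 ≤ p) {r : ℝ} (hr : rhc < r) (hr' : r < zmin) : 0 < bulkEnergy v m p r := by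
  have hr0 : 0 < r := hv.rhc_nonneg.trans_lt hr
  have hsum : Summable fun n : ℕ => -α₁ * (((n : ℝ) + 2) * r) ^ (-s) := by
    simpa using (summable_nat_add_iff 2).2 (summable_pow_mul_rpow (C := -α₁) (d := 0) (t := s) hr0
      (by push_cast; linarith [hv.two_lt_s]))
  have hsum' : Summable fun k : ℕ => cutoff v m (k + 2) ((k + 2) * r) := by
    simpa using (summable_nat_add_iff (f := fun k : ℕ => cutoff v m k (k * r)) 2).2
      (hv.summable_cutoff m hr fun _ => le_rfl)
  have htail := hsum.tsum_le_tsum (fun k => (neg_mul α₁ _).le.trans ?_) hsum'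
  · have hseries : 0 ≤ α₁ * ∑' n : ℕ, (((n : ℝ) + 2) * r) ^ (-s) :=
      mul_nonneg hv.α₁_pos.le (tsum_nonneg fun n => by positivity)
    rw [tsum_mul_left] at htail
    rw [hv.bulkEnergy_eq_add_tsum hm p hr]
    linarith [hv.repulsion r hr hr', hv.v_zmax_neg, mul_nonneg hp hr0.le]
  · simpa using hv.neg_rpow_le_cutoff m hr (k := k + 2) le_rfl

theorem bulkEnergy_zmax_lt (hv : IsAdmissible v rhc zmin zmax α₁ α₂ s) {m : ℕ∞} (hm : 1 ≤ m)
    {p : ℝ} (hp : 0 ≤ p) {r : ℝ} (hr : zmax < r) :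
    bulkEnergy v m p zmax < bulkEnergy v m p r := by
  have hlt : ∑' k : ℕ, cutoff v m k (k * zmax) < ∑' k : ℕ, cutoff v m k (k * r) := by
    refine Summable.tsum_lt_tsum (i := 1) (fun k => ?_) ?_
      (hv.summable_cutoff m hv.rhc_lt_zmax fun _ => le_rfl)
      (hv.summable_cutoff m (hv.rhc_lt_zmax.trans hr) fun _ => le_rfl)
    · rcases k.eq_zero_or_pos with rfl | hk
      · simp [cutoff_zero]
      rcases cutoff_eq_or_eq_zero v m k with h | h
      · have hkz : zmax ≤ k * zmax :=
          le_mul_of_one_le_left hv.zmax_pos.le (Nat.one_le_cast.2 hk)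
        have hkr : k * zmax ≤ k * r := mul_le_mul_of_nonneg_left hr.le k.cast_nonneg
        rw [h, h]
        exact hv.monotoneOn_Ici hkz (hkz.trans hkr) hkr
      · rw [h, h]
    · rw [cutoff_one v hm, cutoff_one v hm, Nat.cast_one, one_mul, one_mul]
      exact hv.zmax_unique_min r (hv.rhc_lt_zmax.trans hr) hr.ne'
  exact add_lt_add_of_le_of_lt (mul_le_mul_of_nonneg_left hr.le hp) hlt

theorem exists_bulkEnergy_minimizer (hv : IsAdmissible v rhc zmin zmax α₁ α₂ s) {m : ℕ∞}
    (hm : 1 ≤ m) {p : ℝ} (hp₀ : 0 ≤ p) (hp : p < |v zmax| / zmax) :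
    ∃ a ∈ Set.Icc zmin zmax, bulkForce v m p a = 0 ∧
      ∀ r, rhc < r → r ≠ a → bulkEnergy v m p a < bulkEnergy v m p r := by
  obtain ⟨a, ha, hmin⟩ := isCompact_Icc.exists_isMinOn (Set.nonempty_Icc.2 hv.zmin_lt_zmax.le)
    fun x hx => (hv.hasDerivAt_bulkEnergy m p
      (hv.rhc_lt_zmin.trans_le hx.1)).continuousAt.continuousWithinAt
  have hzmax : bulkEnergy v m p a ≤ bulkEnergy v m p zmax :=
    hmin (Set.right_mem_Icc.2 hv.zmin_lt_zmax.le)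
  have hlt : ∀ r, rhc < r → r ≠ a → bulkEnergy v m p a < bulkEnergy v m p r := by
    intro r hr hra
    rcases lt_or_ge r zmin with hrmin | hrmin
    · linarith [hv.bulkEnergy_pos hm hp₀ hr hrmin, hv.bulkEnergy_zmax_neg hm hp]
    rcases lt_or_ge zmax r with hrmax | hrmax
    · exact hzmax.trans_lt (hv.bulkEnergy_zmax_lt hm hp₀ hrmax)
    refine lt_of_not_ge fun hle => hra ?_
    exact ((hv.strongConvexOn_bulkEnergy hm p).strictConvexOn hv.convexityModulus_pos).eq_of_isMinOn
      (fun y hy => hle.trans (hmin hy)) hmin ⟨hrmin, hrmax⟩ ha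
  have harhc : rhc < a := hv.rhc_lt_zmin.trans_le ha.1
  refine ⟨a, ha, IsLocalMin.hasDerivAt_eq_zero ?_ (hv.hasDerivAt_bulkEnergy m p harhc), hlt⟩
  filter_upwards [Ioi_mem_nhds harhc] with r hr
  rcases eq_or_ne r a with rfl | hra
  · exact le_rfl
  · exact (hlt r hr hra).le

end IsAdmissible

/-! ### Minimal energies of finite chains -/

theorem lt_window {z : ℕ → ℝ} {r : ℝ} (hr : 0 ≤ r) {i k : ℕ} (hk : 1 ≤ k)
    (hz : ∀ l < k, r < z (i + l)) : r < window z i k := by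
  calc r < z i := hz 0 hk
    _ = window z i 1 := (window_one z i).symm
    _ ≤ window z i k := sum_le_sum_of_subset_of_nonneg (range_mono hk)
        fun l hl _ => hr.trans (hz l (mem_range.1 hl)).le

theorem coe_sum_ereal {ι : Type*} (S : Finset ι) (f : ι → ℝ) :
    ((∑ i ∈ S, f i : ℝ) : EReal) = ∑ i ∈ S, (f i : EReal) :=
  map_sum (⟨⟨Real.toEReal, EReal.coe_zero⟩, EReal.coe_add⟩ : ℝ →+ EReal) f S

theorem sum_ereal_ne_bot {ι : Type*} {S : Finset ι} {f : ι → EReal} (hf : ∀ i ∈ S, f i ≠ ⊥) :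
    ∑ i ∈ S, f i ≠ ⊥ :=
  sum_induction f (· ≠ ⊥) (fun _ _ hx hy => EReal.add_ne_bot_iff.2 ⟨hx, hy⟩) (by simp) hf

theorem sum_ereal_eq_top {ι : Type*} {S : Finset ι} {f : ι → EReal} (hf : ∀ i ∈ S, f i ≠ ⊥)
    {i : ι} (hi : i ∈ S) (h : f i = ⊤) : ∑ i ∈ S, f i = ⊤ := by
  classical
  rw [← add_sum_erase S f hi, h]
  exact EReal.top_add_of_ne_bot (sum_ereal_ne_bot fun i hi => hf i (mem_of_mem_erase hi))

theorem chainEnergy_eq_coe (hrhc : 0 ≤ rhc) (v : ℝ → ℝ) (m : ℕ∞) (p : ℝ) {N : ℕ} {z : ℕ → ℝ}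
    (hz : ∀ l, l + 1 < N → rhc < z l) :
    chainEnergy rhc v m p N z = (pairEnergy (cutoff v m) p N z : EReal) := by
  unfold chainEnergy pairEnergy
  rw [EReal.coe_add, coe_sum_ereal]
  congr 1
  refine sum_congr rfl fun j hj => ?_
  rw [coe_sum_ereal]
  refine sum_congr rfl fun i hi => ?_
  rw [mem_range] at hi hj
  have hwindow : ∑ l ∈ Ico i j, z l = window z i (j - i) := sum_Ico_eq_sum_range _ _ _
  rw [hwindow]
  by_cases hm : ((j - i : ℕ) : ℕ∞) ≤ m
  · rw [if_pos hm, cutoff_of_le v (by omega) hm, pairPotential, if_neg]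
    exact not_le.2 (lt_window hrhc (by omega) fun l hl => hz _ (by omega))
  · rw [if_neg hm, cutoff_of_not_le v hm, EReal.coe_zero]

theorem chainEnergy_eq_top (v : ℝ → ℝ) {m : ℕ∞} (hm : 1 ≤ m) (p : ℝ) {N l : ℕ} {z : ℕ → ℝ}
    (hl : l + 1 < N) (hz : z l ≤ rhc) : chainEnergy rhc v m p N z = ⊤ := by
  have hne : ∀ j i, (if ((j - i : ℕ) : ℕ∞) ≤ m then
      pairPotential rhc v (∑ l ∈ Ico i j, z l) else 0) ≠ ⊥ := by
    intro j i
    unfold pairPotential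
    split_ifs <;> simp
  have hneighbours : (if ((l + 1 - l : ℕ) : ℕ∞) ≤ m then
      pairPotential rhc v (∑ i ∈ Ico l (l + 1), z i) else 0) = ⊤ := by
    rw [if_pos (by simpa using hm), pairPotential, if_pos (by simpa using hz)]
  unfold chainEnergy
  rw [sum_ereal_eq_top (fun j _ => sum_ereal_ne_bot fun i _ => hne j i) (mem_range.2 hl)
    (sum_ereal_eq_top (fun i _ => hne _ i) (mem_range.2 l.lt_succ_self) hneighbours)]
  exact EReal.top_add_coe _

theorem sum_pairs_le_pairEnergy (hv : IsAdmissible v rhc zmin zmax α₁ α₂ s) (m : ℕ∞) {p : ℝ}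
    (hp : 0 ≤ p) (N : ℕ) {z : ℕ → ℝ} (hz : ∀ l, rhc < z l) :
    ∑ j ∈ range N, ∑ _i ∈ range j, v zmax ≤ pairEnergy (cutoff v m) p N z := by
  refine le_add_of_le_of_nonneg (sum_le_sum fun j _ => sum_le_sum fun i hi => ?_)
    (mul_nonneg hp (sum_nonneg fun l _ => hv.rhc_nonneg.trans (hz l).le))
  rw [mem_range] at hi
  rcases cutoff_eq_or_eq_zero v m (j - i) with hcut | hcut
  · rw [hcut]
    exact hv.apply_zmax_le (lt_window hv.rhc_nonneg (by omega) fun l _ => hz _)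
  · rw [hcut]
    exact hv.v_zmax_neg.le

theorem continuousOn_pairEnergy_cutoff (hv : IsAdmissible v rhc zmin zmax α₁ α₂ s) (m : ℕ∞)
    (p : ℝ) (N : ℕ) : ContinuousOn (pairEnergy (cutoff v m) p N) {z | ∀ l, rhc < z l} := by
  refine ContinuousOn.add ?_ (Continuous.continuousOn (by fun_prop))
  refine continuousOn_finsetSum _ fun j _ => continuousOn_finsetSum _ fun i hi => ?_
  rw [mem_range] at hi
  rcases cutoff_eq_or_eq_zero v m (j - i) with hcut | hcut
  · simp only [hcut]
    exact hv.contDiffOn.continuousOn.comp (Continuous.continuousOn (by unfold window; fun_prop))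
      fun z hz => lt_window hv.rhc_nonneg (by omega) fun l _ => hz _
  · simp only [hcut]
    exact continuousOn_const

theorem exists_pairEnergy_add_le (hv : IsAdmissible v rhc zmin zmax α₁ α₂ s) {m : ℕ∞}
    (hm : 1 ≤ m) {p : ℝ} (hp : 0 ≤ p) {N l : ℕ} {z : ℕ → ℝ} (hz : ∀ l, rhc < z l)
    (hl : l + 1 < N) (hlz : z l < zmin) :
    ∃ w : ℕ → ℝ, (∀ l, rhc < w l) ∧
      pairEnergy (cutoff v m) p N w ≤ pairEnergy (cutoff v m) p N z + (v zmax + p * zmax) := by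
  obtain ⟨j, hj, hjmin⟩ := exists_min_image (range (N - 1)) z ⟨l, mem_range.2 (by omega)⟩
  replace hjmin : ∀ i, i + 1 < N → z j ≤ z i := fun i hi => hjmin i (mem_range.2 (by omega))
  rw [mem_range] at hj
  refine ⟨consSpacing zmax (removeParticle z j), fun i => ?_,
    pairEnergy_exchange_le hv hm hp (by omega) (fun i _ => hz i) hjmin ((hjmin l hl).trans_lt hlz)⟩
  match i with
  | 0 => exact hv.rhc_lt_zmax
  | i + 1 => exact lt_removeParticle hv.rhc_nonneg (hz i) (hz (i + 1))

theorem exists_mem_Icc_pairEnergy_le (hv : IsAdmissible v rhc zmin zmax α₁ α₂ s) {m : ℕ∞}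
    (hm : 1 ≤ m) {p : ℝ} (hp : 0 ≤ p) {N : ℕ} (hN : 2 ≤ N) {z : ℕ → ℝ}
    (hz : ∀ l, l + 1 < N → zmin ≤ z l) :
    ∃ w : ℕ → ℝ, (∀ l, w l ∈ Set.Icc zmin zmax) ∧
      pairEnergy (cutoff v m) p N w ≤ pairEnergy (cutoff v m) p N z := by
  have hzz := hv.zmin_lt_zmax.le
  refine ⟨fun l => if l + 1 < N then min (z l) zmax else zmin, fun l => ?_, ?_⟩
  · dsimp only
    split_ifs with hl
    · exact ⟨le_min (hz l hl) hzz, min_le_right _ _⟩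
    · exact ⟨le_rfl, hzz⟩
  · have hgain := hv.apply_min_zmax_le (hv.rhc_lt_zmin.trans_le (hz 0 (by omega)))
    rw [pairEnergy_congr (w := fun l => min (z l) zmax) _ _ fun l hl => if_pos hl]
    linarith [pairEnergy_clip_le hv hm hp hz (j := 0) (by omega)]

/-- Exchanging a particle at a spacing below `zmin` lowers the energy by a fixed amount, so
near-minimal configurations have all spacings at least `zmin`; clipping moves them into the compact
box `[zmin, zmax]`. -/
theorem exists_pairEnergy_minimizer (hv : IsAdmissible v rhc zmin zmax α₁ α₂ s) {m : ℕ∞}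
    (hm : 1 ≤ m) {p : ℝ} (hp₀ : 0 ≤ p) (hp : p < |v zmax| / zmax) {N : ℕ} (hN : 2 ≤ N) :
    ∃ z : ℕ → ℝ, (∀ l, z l ∈ Set.Icc zmin zmax) ∧ ∀ w : ℕ → ℝ, (∀ l, rhc < w l) →
      pairEnergy (cutoff v m) p N z ≤ pairEnergy (cutoff v m) p N w := by
  have hbox : ∀ z : ℕ → ℝ, z ∈ Set.univ.pi (fun _ => Set.Icc zmin zmax) ↔
      ∀ l, z l ∈ Set.Icc zmin zmax := fun z => by
    simp only [Set.mem_pi, Set.mem_univ, true_imp_iff]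
  obtain ⟨z, hz, hzmin⟩ := (isCompact_univ_pi fun _ : ℕ => isCompact_Icc).exists_isMinOn
    ⟨fun _ => zmin, (hbox _).2 fun _ => Set.left_mem_Icc.2 hv.zmin_lt_zmax.le⟩
    ((continuousOn_pairEnergy_cutoff hv m p N).mono fun z hz l =>
      hv.rhc_lt_zmin.trans_le ((hbox z).1 hz l).1)
  refine ⟨z, (hbox z).1 hz, ?_⟩
  set T : Set ℝ := pairEnergy (cutoff v m) p N '' {w | ∀ l, rhc < w l}
  have hbdd : BddBelow T := ⟨_, by
    rintro _ ⟨w, hw, rfl⟩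
    exact sum_pairs_le_pairEnergy hv m hp₀ N hw⟩
  have hne : T.Nonempty := ⟨_, fun _ => zmin, fun _ => hv.rhc_lt_zmin, rfl⟩
  have hgap := hv.add_mul_zmax_neg hp
  suffices hle : pairEnergy (cutoff v m) p N z ≤ sInf T from
    fun w hw => hle.trans (csInf_le hbdd ⟨w, hw, rfl⟩)
  refine le_of_forall_pos_lt_add fun ε hε => ?_
  obtain ⟨_, ⟨w, hw, rfl⟩, hwlt⟩ := exists_lt_of_csInf_lt hne
    (lt_add_of_pos_right (sInf T) (lt_min hε (neg_pos.2 hgap)))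
  have hlow : ∀ l, l + 1 < N → zmin ≤ w l := by
    by_contra! hcon
    obtain ⟨l, hl, hlz⟩ := hcon
    obtain ⟨y, hy, hyle⟩ := exists_pairEnergy_add_le hv hm hp₀ hw hl hlz
    linarith [csInf_le hbdd ⟨y, hy, rfl⟩, min_le_right ε (-(v zmax + p * zmax))]
  obtain ⟨y, hy, hyle⟩ := exists_mem_Icc_pairEnergy_le hv hm hp₀ hN hlow
  linarith [isMinOn_iff.1 hzmin y ((hbox y).2 hy), min_le_left ε (-(v zmax + p * zmax))]

theorem minEnergy_eq_coe (hv : IsAdmissible v rhc zmin zmax α₁ α₂ s) {m : ℕ∞} (hm : 1 ≤ m)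
    {p : ℝ} {N : ℕ} {z : ℕ → ℝ} (hz : ∀ l, rhc < z l)
    (hmin : ∀ w : ℕ → ℝ, (∀ l, rhc < w l) →
      pairEnergy (cutoff v m) p N z ≤ pairEnergy (cutoff v m) p N w) :
    minEnergy rhc v m p N = (pairEnergy (cutoff v m) p N z : EReal) := by
  refine le_antisymm ?_ (le_iInf₂ fun w _ => ?_)
  · rw [← chainEnergy_eq_coe hv.rhc_nonneg v m p fun l _ => hz l]
    exact iInf₂_le z fun j => hv.rhc_nonneg.trans_lt (hz j)
  · by_cases hw : ∀ l, l + 1 < N → rhc < w l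
    · rw [chainEnergy_eq_coe hv.rhc_nonneg v m p hw, EReal.coe_le_coe_iff,
        ← pairEnergy_congr (z := fun l => if l + 1 < N then w l else zmin) _ _
          fun l hl => if_pos hl]
      refine hmin _ fun l => ?_
      split_ifs with hl
      · exact hw l hl
      · exact hv.rhc_lt_zmin
    · push Not at hw
      obtain ⟨l, hl, hle⟩ := hw
      rw [chainEnergy_eq_top v hm p hl hle]
      exact le_top

/-! ### Half-infinite chains -/

theorem summable_antidiagonal_add_two {G : ℕ → ℝ} (hG : ∀ k, 0 ≤ G k)
    (hGs : Summable fun k : ℕ => (k : ℝ) * G k) : Summable fun x : ℕ × ℕ => G (x.1 + x.2 + 2) := by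
  refine (hasSum_antidiagonal (f := fun n => G (n + 2)) ?_).summable
  refine Summable.of_nonneg_of_le (fun n => mul_nonneg (by positivity) (hG _)) (fun n => ?_)
    ((summable_nat_add_iff 2).2 hGs)
  push_cast
  nlinarith [hG (n + 2)]

theorem tsum_antidiagonal_add_two {f : ℕ → ℝ} (hf₀ : f 0 = 0) (hf : Summable f)
    (hkf : Summable fun k : ℕ => (k : ℝ) * f k) :
    ∑' x : ℕ × ℕ, f (x.1 + x.2 + 2) = ∑' k : ℕ, (k : ℝ) * f k - ∑' k, f k := by
  have hshift : HasSum (fun n : ℕ => ((n : ℝ) + 1) * f (n + 2))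
      (∑' k : ℕ, ((k : ℝ) * f k - f k)) := by
    have hsum := (hasSum_nat_add_iff' 2).2 (hkf.sub hf).hasSum
    simp only [sum_range_succ, sum_range_zero, hf₀, Nat.cast_one, one_mul, mul_zero, sub_self,
      add_zero, sub_zero] at hsum
    refine hsum.congr_fun fun n => ?_
    push_cast
    ring
  rw [(hasSum_antidiagonal (f := fun n => f (n + 2)) hshift.summable).tsum_eq, hshift.tsum_eq,
    hkf.tsum_sub hf]

/-- The interaction energy across particle `n` of a half-infinite chain. -/
def crossEnergy (V : ℕ → ℝ → ℝ) (n : ℕ) (z : ℕ → ℝ) : ℝ :=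
  ∑' x : ℕ × ℕ, if x.1 < n then V (x.1 + x.2 + 2) (window z (n - 1 - x.1) (x.1 + x.2 + 2)) else 0

/-- The interaction energy across a particle of the infinite chain with spacing `a`. -/
def bulkCrossEnergy (V : ℕ → ℝ → ℝ) (a : ℝ) : ℝ :=
  ∑' x : ℕ × ℕ, V (x.1 + x.2 + 2) ((x.1 + x.2 + 2 : ℕ) * a)

/-- The surface functional with the bulk energy per particle at spacing `a` subtracted. -/
abbrev surfaceEnergyAt (v : ℝ → ℝ) (m : ℕ∞) (p a : ℝ) (z : ℕ → ℝ) : ℝ :=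
  surfaceEnergy v m p (bulkEnergy v m p a) z

/-- Replace all spacings from the index `n` on by `a`. -/
def truncation (a : ℝ) (n : ℕ) (z : ℕ → ℝ) (l : ℕ) : ℝ := if l < n then z l else a

theorem truncation_of_le (a : ℝ) {n l : ℕ} (h : n ≤ l) (z : ℕ → ℝ) : truncation a n z l = a :=
  if_neg h.not_gt

theorem truncation_of_lt (a : ℝ) {n l : ℕ} (h : l < n) (z : ℕ → ℝ) : truncation a n z l = z l :=
  if_pos h

theorem truncation_mem {a : ℝ} {A : Set ℝ} (ha : a ∈ A) {z : ℕ → ℝ} (hz : ∀ l, z l ∈ A)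
    (n l : ℕ) : truncation a n z l ∈ A := by
  unfold truncation
  split_ifs
  exacts [hz l, ha]

theorem headEnergy_eq (v : ℝ → ℝ) (m : ℕ∞) (p : ℝ) (z : ℕ → ℝ) (j : ℕ) :
    headEnergy v m p (fun i => z (j + i)) = p * z j + ∑' k, cutoff v m k (window z j k) := rfl

theorem bulkEnergy_add_bulkCrossEnergy (hv : IsAdmissible v rhc zmin zmax α₁ α₂ s) (m : ℕ∞)
    (p : ℝ) {a : ℝ} (ha : rhc < a) :
    bulkEnergy v m p a + bulkCrossEnergy (cutoff v m) a
      = p * a + sumTo m (fun k => k * v (k * a)) := by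
  obtain ⟨G, _, hGs, hbound⟩ := hv.exists_summable_abs_cutoff_le m ha
  have hweighted : Summable fun k : ℕ => (k : ℝ) * cutoff v m k (k * a) := by
    refine Summable.of_norm_bounded hGs fun k => ?_
    rw [Real.norm_eq_abs, abs_mul, Nat.abs_cast]
    exact mul_le_mul_of_nonneg_left (hbound k _ le_rfl) (Nat.cast_nonneg k)
  have hsumTo : sumTo m (fun k => k * v (k * a)) = ∑' k : ℕ, (k : ℝ) * cutoff v m k (k * a) :=
    tsum_congr fun k => by
      unfold cutoff
      split_ifs <;> simp
  rw [bulkCrossEnergy, tsum_antidiagonal_add_two (f := fun k => cutoff v m k (k * a))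
    (cutoff_zero v m _) (hv.summable_cutoff m ha fun k => le_rfl) hweighted, hsumTo, bulkEnergy_eq]
  ring

theorem norm_ite_window_le {V : ℕ → ℝ → ℝ} {r : ℝ} {G : ℕ → ℝ} (hG : ∀ k, 0 ≤ G k)
    (hbound : ∀ (k : ℕ) (x : ℝ), (k : ℝ) * r ≤ x → |V k x| ≤ G k) {z : ℕ → ℝ} (hz : ∀ l, r ≤ z l)
    (P : Prop) [Decidable P] (i k : ℕ) : ‖if P then V k (window z i k) else 0‖ ≤ G k := by
  split_ifs
  · exact hbound k _ (mul_le_window fun l _ => hz _)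
  · simpa using hG k

theorem crossEnergy_eq_sum (hv : IsAdmissible v rhc zmin zmax α₁ α₂ s) (m : ℕ∞) {r : ℝ}
    (hr : rhc < r) {z : ℕ → ℝ} (hz : ∀ l, r ≤ z l) (n : ℕ) :
    crossEnergy (cutoff v m) n z
      = ∑ i ∈ range n, ∑' q, cutoff v m (i + q + 2) (window z (n - 1 - i) (i + q + 2)) := by
  obtain ⟨G, hG, hGs, hbound⟩ := hv.exists_summable_abs_cutoff_le m hr
  have hsum : Summable fun x : ℕ × ℕ => if x.1 < n then
      cutoff v m (x.1 + x.2 + 2) (window z (n - 1 - x.1) (x.1 + x.2 + 2)) else 0 :=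
    (summable_antidiagonal_add_two hG hGs).of_norm_bounded
      fun x => norm_ite_window_le hG hbound hz _ _ _
  rw [crossEnergy, hsum.tsum_prod, tsum_eq_sum (s := range n)]
  · exact sum_congr rfl fun i hi => tsum_congr fun q => if_pos (mem_range.1 hi)
  · intro i hi
    rw [mem_range] at hi
    simp [hi]

theorem surfaceEnergyAt_eq (hv : IsAdmissible v rhc zmin zmax α₁ α₂ s) (m : ℕ∞) (p : ℝ)
    {a r : ℝ} (hr : rhc < r) {z : ℕ → ℝ} (hz : ∀ l, r ≤ z l) {n : ℕ}
    (hn : ∀ l, n ≤ l → z l = a) :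
    surfaceEnergyAt v m p a z
      = pairEnergy (cutoff v m) p (n + 1) z + crossEnergy (cutoff v m) n z
        - n * bulkEnergy v m p a := by
  have hbulk : ∀ j, n ≤ j → headEnergy v m p (fun i => z (j + i)) = bulkEnergy v m p a := by
    intro j hj
    rw [headEnergy_eq, bulkEnergy_eq, hn j hj]
    simp only [← window_const a j]
    congr! 4
    exact window_congr fun l _ => hn _ (by omega)
  have hfinite : surfaceEnergyAt v m p a z
      = ∑ j ∈ range n, (headEnergy v m p (fun i => z (j + i)) - bulkEnergy v m p a) := by
    refine tsum_eq_sum fun j hj => ?_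
    rw [hbulk j (by simpa using hj), sub_self]
  rw [hfinite, sum_sub_distrib, crossEnergy_eq_sum hv m hr hz]
  simp only [headEnergy_eq, sum_const, card_range, nsmul_eq_mul]
  rw [sum_headEnergies_eq (cutoff_zero v m) p n fun j => hv.summable_cutoff m hr fun k =>
    mul_le_window fun l _ => hz _]

theorem tendsto_crossEnergy (hv : IsAdmissible v rhc zmin zmax α₁ α₂ s) (m : ℕ∞) {a r : ℝ}
    (hr : rhc < r) {z : ℕ → ℕ → ℝ} (hz : ∀ N l, r ≤ z N l) {n : ℕ → ℕ}
    (hn : ∀ i, ∀ᶠ N in atTop, i < n N ∧ ∀ l, n N ≤ l + 1 + i → z N l = a) :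
    Tendsto (fun N => crossEnergy (cutoff v m) (n N) (z N)) atTop
      (𝓝 (bulkCrossEnergy (cutoff v m) a)) := by
  obtain ⟨G, hG, hGs, hbound⟩ := hv.exists_summable_abs_cutoff_le m hr
  refine tendsto_tsum_of_dominated_convergence (summable_antidiagonal_add_two hG hGs) (fun x => ?_)
    (Eventually.of_forall fun N x => norm_ite_window_le hG hbound (hz N) _ _ _)
  refine tendsto_const_nhds.congr' ?_
  filter_upwards [hn x.1] with N ⟨hlt, heq⟩
  rw [if_pos hlt, ← window_const a 0]
  congr 1
  exact window_congr fun l _ => (heq _ (by omega)).symm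

theorem tendsto_pairEnergy_sub (hv : IsAdmissible v rhc zmin zmax α₁ α₂ s) (m : ℕ∞) (p : ℝ)
    {a r : ℝ} (hr : rhc < r) {z : ℕ → ℝ} (hz : ∀ l, r ≤ z l) {n₀ : ℕ}
    (hn : ∀ l, n₀ ≤ l → z l = a) :
    Tendsto (fun n : ℕ => pairEnergy (cutoff v m) p (n + 1) z - n * bulkEnergy v m p a) atTop
      (𝓝 (surfaceEnergyAt v m p a z - bulkCrossEnergy (cutoff v m) a)) := by
  have hcross := tendsto_crossEnergy hv m (a := a) hr (z := fun _ => z) (fun _ => hz)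
    (n := fun N => N) fun i => by
      filter_upwards [eventually_gt_atTop (n₀ + i)] with N hN
      exact ⟨by omega, fun l hl => hn l (by omega)⟩
  refine (tendsto_const_nhds.sub hcross).congr' ?_
  filter_upwards [eventually_ge_atTop n₀] with N hN
  rw [surfaceEnergyAt_eq hv m p hr hz (n := N) fun l hl => hn l (hN.trans hl)]
  ring

theorem tendsto_sum_window_cross (hv : IsAdmissible v rhc zmin zmax α₁ α₂ s) (m : ℕ∞) {a r : ℝ}
    (hr : rhc < r) {z : ℕ → ℕ → ℝ} (hz : ∀ N l, r ≤ z N l) {n n' : ℕ → ℕ}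
    (hn : ∀ i, ∀ᶠ N in atTop, i < n N ∧ i < n' N ∧
      ∀ l, n N ≤ l + 1 + i → l ≤ n N + i → z N l = a) :
    Tendsto (fun N => ∑ i ∈ range (n N), ∑ q ∈ range (n' N),
        cutoff v m (i + q + 2) (window (z N) (n N - 1 - i) (i + q + 2))) atTop
      (𝓝 (bulkCrossEnergy (cutoff v m) a)) := by
  obtain ⟨G, hG, hGs, hbound⟩ := hv.exists_summable_abs_cutoff_le m hr
  have htsum : ∀ N, (∑' x : ℕ × ℕ, if x.1 < n N ∧ x.2 < n' N then
      cutoff v m (x.1 + x.2 + 2) (window (z N) (n N - 1 - x.1) (x.1 + x.2 + 2)) else 0)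
      = ∑ i ∈ range (n N), ∑ q ∈ range (n' N),
        cutoff v m (i + q + 2) (window (z N) (n N - 1 - i) (i + q + 2)) := by
    intro N
    rw [tsum_eq_sum (s := range (n N) ×ˢ range (n' N)), sum_product]
    · exact sum_congr rfl fun i hi => sum_congr rfl fun q hq =>
        if_pos ⟨mem_range.1 hi, mem_range.1 hq⟩
    · exact fun x hx => if_neg fun h => hx (mem_product.2 ⟨mem_range.2 h.1, mem_range.2 h.2⟩)
  refine Tendsto.congr htsum ?_
  refine tendsto_tsum_of_dominated_convergence (summable_antidiagonal_add_two hG hGs) (fun x => ?_)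
    (Eventually.of_forall fun N x => norm_ite_window_le hG hbound (hz N) _ _ _)
  refine tendsto_const_nhds.congr' ?_
  filter_upwards [hn (max x.1 x.2)] with N ⟨hlt, hlt', heq⟩
  have hle₁ := le_max_left x.1 x.2
  have hle₂ := le_max_right x.1 x.2
  rw [if_pos ⟨by omega, by omega⟩, ← window_const a 0]
  congr 1
  exact window_congr fun l hl => (heq _ (by omega) (by omega)).symm

theorem pairEnergy_eq_sum_truncation (V : ℕ → ℝ → ℝ) (hV : ∀ x, V 0 x = 0) (p a : ℝ) (n n' : ℕ)
    (z : ℕ → ℝ) :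
    pairEnergy V p (n + n' + 1) z
      = pairEnergy V p (n + 1) (truncation a n z)
        + pairEnergy V p (n' + 1) (truncation a n' fun l => z (n + (n' - 1 - l)))
        + ∑ i ∈ range n, ∑ q ∈ range n', V (i + q + 2) (window z (n - 1 - i) (i + q + 2)) := by
  rw [pairEnergy_split, ← pairEnergy_reflect hV p n' fun l => z (n + l),
    pairEnergy_congr V p fun l hl => truncation_of_lt a (by omega) z,
    pairEnergy_congr V p fun l hl => truncation_of_lt a (by omega) _]

/-- If the chain is in its bulk state around particle `n N`, then cutting it there produces two
half-infinite chains. The cut counts the bulk interaction across it twice instead of once. -/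
theorem tendsto_pairEnergy_sub_surfaceEnergyAt (hv : IsAdmissible v rhc zmin zmax α₁ α₂ s)
    (m : ℕ∞) (p : ℝ) {a r : ℝ} (hr : rhc < r) (hra : r ≤ a) {z : ℕ → ℕ → ℝ} (hz : ∀ N l, r ≤ z N l)
    {n n' : ℕ → ℕ} (hn : ∀ i, ∀ᶠ N in atTop, i < n N ∧ i < n' N ∧
      ∀ l, n N ≤ l + 1 + i → l ≤ n N + i → z N l = a) :
    Tendsto (fun N => pairEnergy (cutoff v m) p (n N + n' N + 1) (z N)
      - ((n N : ℝ) + n' N) * bulkEnergy v m p a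
      - surfaceEnergyAt v m p a (truncation a (n N) (z N))
      - surfaceEnergyAt v m p a (truncation a (n' N) fun l => z N (n N + (n' N - 1 - l)))) atTop
      (𝓝 (-bulkCrossEnergy (cutoff v m) a)) := by
  have hleft : ∀ N l, r ≤ truncation a (n N) (z N) l := fun N =>
    truncation_mem (A := Set.Ici r) hra (hz N) _
  have hright : ∀ N l, r ≤ truncation a (n' N) (fun l => z N (n N + (n' N - 1 - l))) l := fun N =>
    truncation_mem (A := Set.Ici r) hra (fun _ => hz N _) _
  have hcrossLeft := tendsto_crossEnergy hv m (a := a) hr hleft (n := n) fun i => by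
    filter_upwards [hn i] with N ⟨hlt, _, heq⟩
    refine ⟨hlt, fun l hl => ?_⟩
    unfold truncation
    split_ifs with h
    exacts [heq l hl (by omega), rfl]
  have hcrossRight := tendsto_crossEnergy hv m (a := a) hr hright (n := n') fun i => by
    filter_upwards [hn i] with N ⟨_, hlt, heq⟩
    refine ⟨hlt, fun l hl => ?_⟩
    unfold truncation
    split_ifs with h
    exacts [heq _ (by omega) (by omega), rfl]
  have hlim := ((tendsto_sum_window_cross hv m hr hz hn).sub hcrossLeft).sub hcrossRight
  rw [sub_self, zero_sub] at hlim
  refine hlim.congr fun N => ?_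
  rw [surfaceEnergyAt_eq hv m p hr (hleft N) fun l hl => truncation_of_le a hl _,
    surfaceEnergyAt_eq hv m p hr (hright N) fun l hl => truncation_of_le a hl _,
    pairEnergy_eq_sum_truncation _ (cutoff_zero v m) p a]
  ring

/-! ### Extension of the surface functional -/

/-- The extension of the surface functional from finite strains to square summable ones. -/
def extSurfaceEnergy (v : ℝ → ℝ) (m : ℕ∞) (p a : ℝ) (z : ℕ → ℝ) : ℝ :=
  limUnder atTop fun n => surfaceEnergyAt v m p a (truncation a n z)

theorem partialNorm_truncation_sub_le (a : ℝ) (n : ℕ) (z w : ℕ → ℝ) (L : ℕ) :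
    partialNorm L (truncation a n z - truncation a n w) ≤ partialNorm L (z - w) := by
  refine partialNorm_le_partialNorm fun l _ => ?_
  simp only [Pi.sub_apply, truncation]
  split_ifs
  · exact le_rfl
  · simp

theorem partialNorm_truncation_sub_const_le (a : ℝ) (n : ℕ) (z : ℕ → ℝ) (L : ℕ) :
    partialNorm L (fun l => truncation a n z l - a) ≤ partialNorm L (fun l => z l - a) := by
  refine partialNorm_le_partialNorm fun l _ => ?_
  unfold truncation
  split_ifs
  · exact le_rfl
  · simp

theorem partialNorm_le_sqrt_tsum {ζ : ℕ → ℝ} (hζ : Summable fun l => ζ l ^ 2) (L : ℕ) :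
    partialNorm L ζ ≤ √(∑' l, ζ l ^ 2) :=
  Real.sqrt_le_sqrt (hζ.sum_le_tsum _ fun _ _ => sq_nonneg _)

theorem partialNorm_truncation_sub_truncation_le {a : ℝ} {z : ℕ → ℝ}
    (hz : Summable fun l => (z l - a) ^ 2) {n n' N : ℕ} (hn : N ≤ n) (hn' : N ≤ n') (L : ℕ) :
    partialNorm L (truncation a n z - truncation a n' z) ≤ √(∑' l, (z (l + N) - a) ^ 2) := by
  refine Real.sqrt_le_sqrt ?_
  calc ∑ l ∈ range L, (truncation a n z - truncation a n' z) l ^ 2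
      ≤ ∑ l ∈ range (N + L), (truncation a n z - truncation a n' z) l ^ 2 :=
        sum_le_sum_of_subset_of_nonneg (range_mono (by omega)) fun _ _ _ => sq_nonneg _
    _ = ∑ l ∈ range L, (truncation a n z - truncation a n' z) (N + l) ^ 2 := by
        rw [sum_range_add, add_eq_right]
        refine sum_eq_zero fun l hl => ?_
        rw [mem_range] at hl
        rw [Pi.sub_apply, truncation_of_lt a (by omega), truncation_of_lt a (by omega), sub_self,
          zero_pow two_ne_zero]
    _ ≤ ∑ l ∈ range L, (z (l + N) - a) ^ 2 := by
        refine sum_le_sum fun l _ => sq_le_sq.2 ?_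
        rw [Pi.sub_apply, add_comm N]
        unfold truncation
        split_ifs <;> simp [abs_sub_comm a]
    _ ≤ ∑' l, (z (l + N) - a) ^ 2 :=
        ((summable_nat_add_iff N).2 hz).sum_le_tsum _ fun _ _ => sq_nonneg _

theorem mem_finiteStrains_iff {rhc a : ℝ} {z : ℕ → ℝ} :
    z ∈ finiteStrains rhc a ↔ (∀ j, rhc < z j) ∧ ∃ n, ∀ l, n ≤ l → z l = a := by
  refine and_congr_right fun _ => ?_
  rw [← eventually_atTop, ← Nat.cofinite_eq_atTop, eventually_cofinite]

theorem finiteStrains_subset (rhc a : ℝ) : finiteStrains rhc a ⊆ squareSummableStrains rhc a := by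
  rintro z ⟨hz, hfin⟩
  refine ⟨hz, summable_of_hasFiniteSupport (hfin.subset fun l hl => ?_)⟩
  exact fun heq => hl (by simp [heq])

theorem truncation_mem_finiteStrains {rhc a : ℝ} (ha : rhc < a) {z : ℕ → ℝ}
    (hz : ∀ j, rhc < z j) (n : ℕ) : truncation a n z ∈ finiteStrains rhc a :=
  mem_finiteStrains_iff.2 ⟨truncation_mem (A := Set.Ioi rhc) ha hz n,
    n, fun _ hl => truncation_of_le a hl z⟩

theorem exists_lt_forall_le_of_mem_squareSummableStrains {rhc a : ℝ} (ha : rhc < a) {z : ℕ → ℝ}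
    (hz : z ∈ squareSummableStrains rhc a) : ∃ r, rhc < r ∧ r ≤ a ∧ ∀ l, r ≤ z l := by
  have hlim : Tendsto z atTop (𝓝 a) := by
    have hsqrt := hz.2.tendsto_atTop_zero.sqrt
    simp only [Real.sqrt_sq_eq_abs, Real.sqrt_zero] at hsqrt
    exact tendsto_sub_nhds_zero_iff.1 ((tendsto_zero_iff_abs_tendsto_zero _).2 hsqrt)
  have hlim' : Tendsto (fun l => (⟨z l, hz.1 l⟩ : Set.Ioi rhc)) atTop (𝓝 ⟨a, ha⟩) :=
    tendsto_subtype_rng.2 hlim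
  obtain ⟨⟨r, hr⟩, hle⟩ := hlim'.bddBelow_range
  have hrz : ∀ l, r ≤ z l := fun l => hle ⟨l, rfl⟩
  exact ⟨r, hr, ge_of_tendsto' hlim hrz, hrz⟩

theorem exists_abs_pairEnergy_sub_le (hv : IsAdmissible v rhc zmin zmax α₁ α₂ s) {m : ℕ∞}
    {p a : ℝ} (hcrit : bulkForce v m p a = 0) {r : ℝ} (hr : rhc < r) (hra : r ≤ a) {M : ℝ}
    (hM : 0 ≤ M) : ∃ K, 0 ≤ K ∧ ∀ (L : ℕ) (z w : ℕ → ℝ),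
      (∀ l < L, r ≤ z l) → (∀ l < L, r ≤ w l) →
      partialNorm L (fun l => z l - a) ≤ M → partialNorm L (fun l => w l - a) ≤ M →
      |pairEnergy (cutoff v m) p (L + 1) z - pairEnergy (cutoff v m) p (L + 1) w|
        ≤ K * partialNorm L (z - w) := by
  obtain ⟨B, hB, hBs, htaylor⟩ := hv.exists_cutoff_taylor m hr hra
  obtain ⟨G, -, hGs, hbound⟩ := hv.exists_summable_abs_cutoff_deriv_le m hr
  have hDs : Summable fun k : ℕ => (k : ℝ) ^ 2 * |cutoff (deriv v) m k (k * a)| :=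
    Summable.of_nonneg_of_le (fun k => by positivity) (fun k => mul_le_mul_of_nonneg_left
      (hbound k _ (mul_le_mul_of_nonneg_left hra (Nat.cast_nonneg k))) (sq_nonneg _)) hGs
  refine ⟨_, ?_, fun L z w hz hw hzM hwM => abs_pairEnergy_sub_le (cutoff_zero v m)
    (D := fun k => cutoff (deriv v) m k (k * a)) hB hDs hBs hcrit hzM hwM fun k i hk hik => ?_⟩
  · have : 0 ≤ ∑' k : ℕ, (k : ℝ) ^ 2 * B k :=
      tsum_nonneg fun k => mul_nonneg (sq_nonneg _) (hB k)
    have : 0 ≤ ∑' k : ℕ, (k : ℝ) ^ 2 * |cutoff (deriv v) m k (k * a)| :=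
      tsum_nonneg fun k => by positivity
    positivity
  · exact htaylor k _ _ hk (mul_le_window fun l hl => hz _ (by omega))
      (mul_le_window fun l hl => hw _ (by omega))

theorem surfaceEnergyAt_add_le_of_pairEnergy_add_le (hv : IsAdmissible v rhc zmin zmax α₁ α₂ s)
    (m : ℕ∞) (p : ℝ) {a : ℝ} (ha : rhc < a) {z w : ℕ → ℝ} (hz : z ∈ finiteStrains rhc a)
    (hw : w ∈ finiteStrains rhc a) {c : ℝ}
    (h : ∀ᶠ n : ℕ in atTop,
      pairEnergy (cutoff v m) p (n + 1) z + c ≤ pairEnergy (cutoff v m) p (n + 1) w) :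
    surfaceEnergyAt v m p a z + c ≤ surfaceEnergyAt v m p a w := by
  obtain ⟨r, hr, -, hzr⟩ :=
    exists_lt_forall_le_of_mem_squareSummableStrains ha (finiteStrains_subset _ _ hz)
  obtain ⟨r', hr', -, hwr⟩ :=
    exists_lt_forall_le_of_mem_squareSummableStrains ha (finiteStrains_subset _ _ hw)
  obtain ⟨-, n, hn⟩ := mem_finiteStrains_iff.1 hz
  obtain ⟨-, n', hn'⟩ := mem_finiteStrains_iff.1 hw
  have hle := le_of_tendsto_of_tendsto ((tendsto_pairEnergy_sub hv m p hr hzr hn).add_const c)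
    (tendsto_pairEnergy_sub hv m p hr' hwr hn') (h.mono fun n hn => by dsimp only; linarith)
  linarith

theorem exists_abs_surfaceEnergyAt_sub_le (hv : IsAdmissible v rhc zmin zmax α₁ α₂ s) {m : ℕ∞}
    {p a : ℝ} (hcrit : bulkForce v m p a = 0) {r : ℝ} (hr : rhc < r) (hra : r ≤ a) {M : ℝ}
    (hM : 0 ≤ M) : ∃ K, 0 ≤ K ∧
      ∀ z ∈ finiteStrains rhc a, ∀ w ∈ finiteStrains rhc a, (∀ l, r ≤ z l) → (∀ l, r ≤ w l) →
      (∀ L, partialNorm L (fun l => z l - a) ≤ M) →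
      (∀ L, partialNorm L (fun l => w l - a) ≤ M) →
      ∀ d, (∀ L, partialNorm L (z - w) ≤ d) →
      |surfaceEnergyAt v m p a z - surfaceEnergyAt v m p a w| ≤ K * d := by
  obtain ⟨K, hK, hlip⟩ := exists_abs_pairEnergy_sub_le hv hcrit hr hra hM
  refine ⟨K, hK, fun z hz w hw hzr hwr hzM hwM d hzw => ?_⟩
  have hchain : ∀ n : ℕ,
      |pairEnergy (cutoff v m) p (n + 1) z - pairEnergy (cutoff v m) p (n + 1) w| ≤ K * d :=
    fun n => (hlip n z w (fun l _ => hzr l) (fun l _ => hwr l) (hzM n) (hwM n)).trans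
      (mul_le_mul_of_nonneg_left (hzw n) hK)
  have ha := hr.trans_le hra
  have hzw' := surfaceEnergyAt_add_le_of_pairEnergy_add_le hv m p ha hz hw (c := -(K * d))
    (Eventually.of_forall fun n => by linarith [(abs_le.1 (hchain n)).2])
  have hwz' := surfaceEnergyAt_add_le_of_pairEnergy_add_le hv m p ha hw hz (c := -(K * d))
    (Eventually.of_forall fun n => by linarith [(abs_le.1 (hchain n)).1])
  exact abs_le.2 ⟨by linarith, by linarith⟩

theorem tendsto_extSurfaceEnergy (hv : IsAdmissible v rhc zmin zmax α₁ α₂ s) {m : ℕ∞} {p a : ℝ}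
    (hcrit : bulkForce v m p a = 0) (ha : rhc < a) {z : ℕ → ℝ}
    (hz : z ∈ squareSummableStrains rhc a) :
    Tendsto (fun n => surfaceEnergyAt v m p a (truncation a n z)) atTop
      (𝓝 (extSurfaceEnergy v m p a z)) := by
  obtain ⟨r, hr, hra, hzr⟩ := exists_lt_forall_le_of_mem_squareSummableStrains ha hz
  obtain ⟨K, -, hlip⟩ := exists_abs_surfaceEnergyAt_sub_le hv hcrit hr hra
    (Real.sqrt_nonneg (∑' l, (z l - a) ^ 2))
  have hmem := truncation_mem_finiteStrains ha hz.1
  have hge : ∀ n l, r ≤ truncation a n z l := truncation_mem (A := Set.Ici r) hra hzr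
  have hnorm : ∀ n L, partialNorm L (fun l => truncation a n z l - a) ≤ √(∑' l, (z l - a) ^ 2) :=
    fun n L => (partialNorm_truncation_sub_const_le a n z L).trans (partialNorm_le_sqrt_tsum hz.2 L)
  have htail : Tendsto (fun N => K * √(∑' l, (z (l + N) - a) ^ 2)) atTop (𝓝 0) := by
    simpa using (tendsto_sum_nat_add fun l => (z l - a) ^ 2).sqrt.const_mul K
  have hcauchy : CauchySeq fun n => surfaceEnergyAt v m p a (truncation a n z) := by
    refine cauchySeq_of_le_tendsto_0 _ (fun n n' N hn hn' => ?_) htail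
    exact hlip _ (hmem n) _ (hmem n') (hge n) (hge n') (hnorm n) (hnorm n') _
      (partialNorm_truncation_sub_truncation_le hz.2 hn hn')
  exact hcauchy.tendsto_limUnder

theorem extSurfaceEnergy_eq {m : ℕ∞} {p a : ℝ} {z : ℕ → ℝ} (hz : z ∈ finiteStrains rhc a) :
    extSurfaceEnergy v m p a z = surfaceEnergyAt v m p a z := by
  obtain ⟨-, n, hn⟩ := mem_finiteStrains_iff.1 hz
  refine Tendsto.limUnder_eq (tendsto_const_nhds.congr' ?_)
  filter_upwards [eventually_ge_atTop n] with N hN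
  congr 1
  funext l
  unfold truncation
  split_ifs with h
  · rfl
  · exact hn l (by omega)

theorem exists_abs_extSurfaceEnergy_sub_le (hv : IsAdmissible v rhc zmin zmax α₁ α₂ s) {m : ℕ∞}
    {p a : ℝ} (hcrit : bulkForce v m p a = 0) {r : ℝ} (hr : rhc < r) (hra : r ≤ a) {M : ℝ}
    (hM : 0 ≤ M) : ∃ K, ∀ z ∈ squareSummableStrains rhc a, ∀ w ∈ squareSummableStrains rhc a,
      (∀ l, r ≤ z l) → (∀ l, r ≤ w l) →
      (∀ L, partialNorm L (fun l => z l - a) ≤ M) →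
      (∀ L, partialNorm L (fun l => w l - a) ≤ M) →
      ∀ d, (∀ L, partialNorm L (z - w) ≤ d) →
      |extSurfaceEnergy v m p a z - extSurfaceEnergy v m p a w| ≤ K * d := by
  obtain ⟨K, -, hlip⟩ := exists_abs_surfaceEnergyAt_sub_le hv hcrit hr hra hM
  refine ⟨K, fun z hz w hw hzr hwr hzM hwM d hzw => ?_⟩
  have ha := hr.trans_le hra
  refine le_of_tendsto ((tendsto_extSurfaceEnergy hv hcrit ha hz).sub
    (tendsto_extSurfaceEnergy hv hcrit ha hw)).abs (Eventually.of_forall fun n => ?_)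
  exact hlip _ (truncation_mem_finiteStrains ha hz.1 n) _
    (truncation_mem_finiteStrains ha hw.1 n) (truncation_mem (A := Set.Ici r) hra hzr n)
    (truncation_mem (A := Set.Ici r) hra hwr n)
    (fun L => (partialNorm_truncation_sub_const_le a n z L).trans (hzM L))
    (fun L => (partialNorm_truncation_sub_const_le a n w L).trans (hwM L)) d
    (fun L => (partialNorm_truncation_sub_le a n z w L).trans (hzw L))

theorem partialNorm_le_norm (f : lp (fun _ : ℕ => ℝ) 2) (L : ℕ) : partialNorm L f ≤ ‖f‖ := by
  rw [partialNorm_le_iff (norm_nonneg f)]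
  simpa using lp.sum_rpow_le_norm_rpow (p := 2) (by norm_num) f (range L)

theorem coe_strain_sub_strain {a : ℝ} (z w : StrainSpace rhc a) :
    ⇑(z.strain - w.strain) = z.1 - w.1 :=
  funext fun l => sub_sub_sub_cancel_right (z.1 l) (w.1 l) a

theorem continuous_extSurfaceEnergy (hv : IsAdmissible v rhc zmin zmax α₁ α₂ s) {m : ℕ∞}
    {p a : ℝ} (hcrit : bulkForce v m p a = 0) (ha : rhc < a) :
    Continuous fun z : StrainSpace rhc a => extSurfaceEnergy v m p a z.1 := by
  refine continuous_iff_continuousAt.2 fun z => ?_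
  obtain ⟨r, hr, hra, hzr⟩ := exists_lt_forall_le_of_mem_squareSummableStrains ha z.2
  set ε := (r - rhc) / 2 with hε
  obtain ⟨K, hlip⟩ := exists_abs_extSurfaceEnergy_sub_le hv hcrit (r := r - ε)
    (by linarith) (by linarith) (M := ‖z.strain‖ + ε) (by linarith [norm_nonneg z.strain])
  refine continuousAt_of_locally_lipschitz (r := ε) (by linarith) K fun w hw => ?_
  have hdist : dist w z = ‖w.strain - z.strain‖ := dist_eq_norm w.strain z.strain
  have hwM : ‖w.strain‖ ≤ ‖z.strain‖ + ε := by
    linarith [norm_le_norm_add_norm_sub z.strain w.strain, norm_sub_rev z.strain w.strain]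
  have hpointwise : ∀ l, |w.1 l - z.1 l| ≤ dist w z := fun l => by
    have hle := lp.norm_apply_le_norm (p := 2) two_ne_zero (w.strain - z.strain) l
    rwa [coe_strain_sub_strain, Pi.sub_apply, ← hdist] at hle
  refine hlip w.1 w.2 z.1 z.2 (fun l => ?_) (fun l => by linarith [hzr l])
    (fun L => (partialNorm_le_norm w.strain L).trans hwM)
    (fun L => (partialNorm_le_norm z.strain L).trans (by linarith)) _ fun L => ?_
  · linarith [neg_le_of_abs_le (hpointwise l), hzr l]
  · rw [hdist, ← coe_strain_sub_strain]
    exact partialNorm_le_norm _ L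

/-! ### Convexity and coercivity of the surface functional -/

theorem convex_finiteStrains (rhc a : ℝ) : Convex ℝ (finiteStrains rhc a) := by
  intro z hz w hw t u ht hu htu
  obtain ⟨hzr, n, hn⟩ := mem_finiteStrains_iff.1 hz
  obtain ⟨hwr, n', hn'⟩ := mem_finiteStrains_iff.1 hw
  refine mem_finiteStrains_iff.2 ⟨fun l => convex_Ioi rhc (hzr l) (hwr l) ht hu htu,
    max n n', fun l hl => ?_⟩
  rw [Pi.add_apply, Pi.smul_apply, Pi.smul_apply, hn l ((le_max_left _ _).trans hl),
    hn' l ((le_max_right _ _).trans hl), ← add_smul, htu, one_smul]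

theorem convex_squareSummableStrains (rhc a : ℝ) : Convex ℝ (squareSummableStrains rhc a) := by
  intro z hz w hw t u ht hu htu
  refine ⟨fun l => convex_Ioi rhc (hz.1 l) (hw.1 l) ht hu htu, Summable.of_nonneg_of_le
    (fun _ => sq_nonneg _) (fun l => ?_) ((hz.2.mul_left t).add (hw.2.mul_left u))⟩
  have hcombo : (t • z + u • w) l - a = t • (z l - a) + u • (w l - a) := by
    rw [Pi.add_apply, Pi.smul_apply, Pi.smul_apply, smul_sub, smul_sub, sub_add_sub_comm,
      ← add_smul, htu, one_smul]
  rw [hcombo]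
  exact even_two.convexOn_pow.2 (Set.mem_univ _) (Set.mem_univ _) ht hu htu

theorem convex_forall_mem {A : Set ℝ} (hA : Convex ℝ A) : Convex ℝ {z : ℕ → ℝ | ∀ l, z l ∈ A} :=
  fun _ hz _ hw _ _ ht hu htu l => hA (hz l) (hw l) ht hu htu

theorem const_mem_finiteStrains {a : ℝ} (ha : rhc < a) : (fun _ => a) ∈ finiteStrains rhc a :=
  mem_finiteStrains_iff.2 ⟨fun _ => ha, 0, fun _ _ => rfl⟩

theorem truncation_combo (a : ℝ) (n : ℕ) (z w : ℕ → ℝ) {t u : ℝ} (htu : t + u = 1) :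
    truncation a n (t • z + u • w) = t • truncation a n z + u • truncation a n w := by
  funext l
  simp only [truncation, Pi.add_apply, Pi.smul_apply, smul_eq_mul]
  split_ifs
  · rfl
  · rw [← add_mul, htu, one_mul]

theorem surfaceEnergyAt_strong_convexity (hv : IsAdmissible v rhc zmin zmax α₁ α₂ s) {m : ℕ∞}
    (hm : 1 ≤ m) (p : ℝ) {a : ℝ} {z w : ℕ → ℝ} (hz : z ∈ finiteStrains rhc a)
    (hw : w ∈ finiteStrains rhc a) (hzb : ∀ l, z l ∈ Set.Icc zmin zmax)
    (hwb : ∀ l, w l ∈ Set.Icc zmin zmax) {t u : ℝ} (ht : 0 ≤ t) (hu : 0 ≤ u) (htu : t + u = 1)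
    (L : ℕ) :
    surfaceEnergyAt v m p a (t • z + u • w)
      ≤ t * surfaceEnergyAt v m p a z + u * surfaceEnergyAt v m p a w
        - t * u * (convexityModulus v zmin zmax / 2 * partialNorm L (z - w) ^ 2) := by
  obtain ⟨-, n, hn⟩ := mem_finiteStrains_iff.1 hz
  obtain ⟨-, n', hn'⟩ := mem_finiteStrains_iff.1 hw
  obtain ⟨-, n'', hn''⟩ := mem_finiteStrains_iff.1 (convex_finiteStrains rhc a hz hw ht hu htu)
  have hbox := convex_forall_mem (convex_Icc zmin zmax) hzb hwb ht hu htu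
  have hle := le_of_tendsto_of_tendsto
    (tendsto_pairEnergy_sub hv m p hv.rhc_lt_zmin (fun l => (hbox l).1) hn'')
    ((((tendsto_pairEnergy_sub hv m p hv.rhc_lt_zmin (fun l => (hzb l).1) hn).const_mul t).add
      ((tendsto_pairEnergy_sub hv m p hv.rhc_lt_zmin (fun l => (hwb l).1)
        hn').const_mul u)).sub_const
      (t * u * (convexityModulus v zmin zmax / 2 * partialNorm L (z - w) ^ 2))) ?_
  · obtain rfl : u = 1 - t := by linarith
    linarith
  filter_upwards [eventually_ge_atTop L] with N hN
  have hconv := pairEnergy_strong_convexity_of_mem_Icc hv hm p (L := N) ht hu htu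
    (fun l _ => hzb l) (fun l _ => hwb l)
  have hnorm : t * u * (convexityModulus v zmin zmax / 2 * partialNorm L (z - w) ^ 2)
      ≤ t * u * (convexityModulus v zmin zmax / 2 * partialNorm N (z - w) ^ 2) := by
    have := hv.convexityModulus_pos
    have := partialNorm_nonneg L (z - w)
    have := partialNorm_mono (z - w) hN
    gcongr
  obtain rfl : u = 1 - t := by linarith
  linarith

theorem extSurfaceEnergy_strong_convexity (hv : IsAdmissible v rhc zmin zmax α₁ α₂ s) {m : ℕ∞}
    (hm : 1 ≤ m) {p a : ℝ} (ha : a ∈ Set.Icc zmin zmax) (hcrit : bulkForce v m p a = 0)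
    {z w : ℕ → ℝ} (hz : z ∈ squareSummableStrains rhc a) (hw : w ∈ squareSummableStrains rhc a)
    (hzb : ∀ l, z l ∈ Set.Icc zmin zmax) (hwb : ∀ l, w l ∈ Set.Icc zmin zmax) {t u : ℝ}
    (ht : 0 ≤ t) (hu : 0 ≤ u) (htu : t + u = 1) (L : ℕ) :
    extSurfaceEnergy v m p a (t • z + u • w)
      ≤ t * extSurfaceEnergy v m p a z + u * extSurfaceEnergy v m p a w
        - t * u * (convexityModulus v zmin zmax / 2 * partialNorm L (z - w) ^ 2) := by
  have har := hv.rhc_lt_zmin.trans_le ha.1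
  refine le_of_tendsto_of_tendsto (tendsto_extSurfaceEnergy hv hcrit har
      (convex_squareSummableStrains rhc a hz hw ht hu htu))
    ((((tendsto_extSurfaceEnergy hv hcrit har hz).const_mul t).add
      ((tendsto_extSurfaceEnergy hv hcrit har hw).const_mul u)).sub_const _) ?_
  filter_upwards [eventually_ge_atTop L] with n hn
  have htrunc : partialNorm L (truncation a n z - truncation a n w) = partialNorm L (z - w) :=
    partialNorm_congr fun l hl => by
      simp only [Pi.sub_apply, truncation_of_lt a (hl.trans_le hn)]
  rw [truncation_combo a n z w htu, ← htrunc]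
  exact surfaceEnergyAt_strong_convexity hv hm p (truncation_mem_finiteStrains har hz.1 n)
    (truncation_mem_finiteStrains har hw.1 n) (truncation_mem ha hzb n) (truncation_mem ha hwb n)
    ht hu htu L

theorem strictConvexOn_extSurfaceEnergy (hv : IsAdmissible v rhc zmin zmax α₁ α₂ s) {m : ℕ∞}
    (hm : 1 ≤ m) {p a : ℝ} (ha : a ∈ Set.Icc zmin zmax) (hcrit : bulkForce v m p a = 0) :
    StrictConvexOn ℝ (squareSummableStrains rhc a ∩ {z | ∀ j, z j ∈ Set.Icc zmin zmax})
      (extSurfaceEnergy v m p a) := by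
  refine ⟨(convex_squareSummableStrains rhc a).inter (convex_forall_mem (convex_Icc zmin zmax)),
    fun z hz w hw hzw t u ht hu htu => ?_⟩
  obtain ⟨L, hL⟩ := exists_partialNorm_pos (sub_ne_zero.2 hzw)
  have hconv := extSurfaceEnergy_strong_convexity hv hm ha hcrit hz.1 hw.1 hz.2 hw.2 ht.le hu.le
    htu L
  have hpos : 0 < t * u * (convexityModulus v zmin zmax / 2 * partialNorm L (z - w) ^ 2) := by
    have := hv.convexityModulus_pos
    positivity
  exact hconv.trans_lt (sub_lt_self _ hpos)

/-- Along a segment of length `d`, a Lipschitz bound within distance `1` of the initial point is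
amplified by strong convexity to a quadratic lower bound at the end point. -/
theorem sub_mul_add_le_of_strong_convexity {g : ℝ → ℝ} {K κ d : ℝ} (hκ : 0 ≤ κ) (hd : 0 ≤ d)
    (hconv : ∀ t, 0 ≤ t → t ≤ 1 →
      g t ≤ t * g 1 + (1 - t) * g 0 - t * (1 - t) * (κ / 2 * d ^ 2))
    (hlip : ∀ t, 0 ≤ t → t ≤ 1 → t * d ≤ 1 → g 0 - K * (t * d) ≤ g t) :
    g 0 - K * d + κ / 2 * (d ^ 2 - d) ≤ g 1 := by
  rcases le_or_gt d 1 with hd1 | hd1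
  · have hsq : d ^ 2 - d ≤ 0 := by nlinarith
    have hlip1 := hlip 1 zero_le_one le_rfl (by rwa [one_mul])
    rw [one_mul] at hlip1
    linarith [mul_nonpos_of_nonneg_of_nonpos (div_nonneg hκ zero_le_two) hsq]
  · have hinv : d⁻¹ * d = 1 := inv_mul_cancel₀ (by positivity)
    have hinv1 : d⁻¹ ≤ 1 := inv_le_one_of_one_le₀ hd1.le
    have hle := (hlip d⁻¹ (by positivity) hinv1 hinv.le).trans (hconv d⁻¹ (by positivity) hinv1)
    have hscaled := mul_le_mul_of_nonneg_right hle hd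
    have hexpand : (d⁻¹ * g 1 + (1 - d⁻¹) * g 0 - d⁻¹ * (1 - d⁻¹) * (κ / 2 * d ^ 2)) * d
        = g 1 + (d - 1) * g 0 - κ / 2 * (d ^ 2 - d) := by
      field_simp
    rw [hexpand, hinv] at hscaled
    linarith

theorem exists_pairEnergy_coercive (hv : IsAdmissible v rhc zmin zmax α₁ α₂ s) {m : ℕ∞}
    (hm : 1 ≤ m) {p a : ℝ} (ha : a ∈ Set.Icc zmin zmax) (hcrit : bulkForce v m p a = 0) :
    ∃ K, 0 ≤ K ∧ ∀ (L : ℕ) (z : ℕ → ℝ), (∀ l < L, z l ∈ Set.Icc zmin zmax) →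
      pairEnergy (cutoff v m) p (L + 1) (fun _ => a) - K * partialNorm L (fun l => z l - a)
        + convexityModulus v zmin zmax / 2
          * (partialNorm L (fun l => z l - a) ^ 2 - partialNorm L (fun l => z l - a))
      ≤ pairEnergy (cutoff v m) p (L + 1) z := by
  obtain ⟨K, hK, hlip⟩ := exists_abs_pairEnergy_sub_le hv hcrit hv.rhc_lt_zmin ha.1 zero_le_one
  refine ⟨K, hK, fun L z hz => ?_⟩
  set y : ℕ → ℝ := fun _ => a
  have hstrain : ∀ t : ℝ, t • z + (1 - t) • y - y = t • (z - y) := fun t => by module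
  have hdist : ∀ t : ℝ, 0 ≤ t →
      partialNorm L (t • z + (1 - t) • y - y) = t * partialNorm L (z - y) := fun t ht => by
    rw [hstrain, partialNorm_smul ht]
  have hsegment := sub_mul_add_le_of_strong_convexity (K := K)
    (g := fun t => pairEnergy (cutoff v m) p (L + 1) (t • z + (1 - t) • y))
    hv.convexityModulus_pos.le (partialNorm_nonneg L (z - y)) (fun t ht ht1 => ?_)
    (fun t ht ht1 htd => ?_)
  · have hstrain₁ : (fun l => z l - a) = z - y := rfl
    simpa [hstrain₁] using hsegment
  · simpa using pairEnergy_strong_convexity_of_mem_Icc hv hm p ht (sub_nonneg.2 ht1)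
      (add_sub_cancel _ _) hz fun _ _ => ha
  · have hle := hlip L (t • z + (1 - t) • y) y
      (fun l hl => (convex_Icc zmin zmax (hz l hl) ha ht (sub_nonneg.2 ht1)
        (add_sub_cancel _ _)).1)
      (fun _ _ => ha.1) ((hdist t ht).trans_le htd) (by simp [y, partialNorm])
    rw [hdist t ht] at hle
    simpa using sub_le_of_abs_sub_le_left hle

theorem exists_partialNorm_le_of_pairEnergy_le (hv : IsAdmissible v rhc zmin zmax α₁ α₂ s)
    {m : ℕ∞} (hm : 1 ≤ m) {p a : ℝ} (ha : a ∈ Set.Icc zmin zmax)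
    (hcrit : bulkForce v m p a = 0) :
    ∃ M, 0 ≤ M ∧ ∀ (L : ℕ) (z : ℕ → ℝ), (∀ l < L, z l ∈ Set.Icc zmin zmax) →
      pairEnergy (cutoff v m) p (L + 1) z ≤ pairEnergy (cutoff v m) p (L + 1) (fun _ => a) →
      partialNorm L (fun l => z l - a) ≤ M := by
  obtain ⟨K, hK, hcoercive⟩ := exists_pairEnergy_coercive hv hm ha hcrit
  have hκ := hv.convexityModulus_pos
  set κ := convexityModulus v zmin zmax
  refine ⟨1 + 2 * K / κ, by positivity, fun L z hz hle => ?_⟩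
  have hlower := (hcoercive L z hz).trans hle
  set d := partialNorm L fun l => z l - a
  by_contra! hlt
  have hd : 0 < d := lt_of_le_of_lt (by positivity) hlt
  have hκd : κ * (d - 1) ≤ 2 * K := le_of_mul_le_mul_left (by linarith) hd
  have hκd' : κ * (2 * K / κ) < κ * (d - 1) := mul_lt_mul_of_pos_left (by linarith) hκ
  rw [mul_div_cancel₀ _ hκ.ne'] at hκd'
  linarith

theorem bddBelow_surfaceEnergyAt (hv : IsAdmissible v rhc zmin zmax α₁ α₂ s) {m : ℕ∞}
    (hm : 1 ≤ m) {p a : ℝ} (hp₀ : 0 ≤ p) (hp : p < |v zmax| / zmax) (ha : a ∈ Set.Icc zmin zmax)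
    (hcrit : bulkForce v m p a = 0) :
    BddBelow (surfaceEnergyAt v m p a '' finiteStrains rhc a) := by
  have har := hv.rhc_lt_zmin.trans_le ha.1
  obtain ⟨K, -, hcoercive⟩ := exists_pairEnergy_coercive hv hm ha hcrit
  have hκ := hv.convexityModulus_pos
  set κ := convexityModulus v zmin zmax
  refine ⟨surfaceEnergyAt v m p a (fun _ => a) + -((K + κ / 2) ^ 2 / (2 * κ)), ?_⟩
  rintro _ ⟨w, hw, rfl⟩
  refine surfaceEnergyAt_add_le_of_pairEnergy_add_le hv m p har (const_mem_finiteStrains har) hw ?_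
  filter_upwards [eventually_ge_atTop 1] with n hn
  obtain ⟨z, hz, hzmin⟩ := exists_pairEnergy_minimizer hv hm hp₀ hp (N := n + 1) (by omega)
  refine le_trans ?_ ((hcoercive n z fun l _ => hz l).trans (hzmin w hw.1))
  set d := partialNorm n fun l => z l - a
  have hsquare : κ / 2 * d ^ 2 - (K + κ / 2) * d + (K + κ / 2) ^ 2 / (2 * κ)
      = (κ * d - (K + κ / 2)) ^ 2 / (2 * κ) := by
    field_simp
    ring
  have hnonneg : 0 ≤ (κ * d - (K + κ / 2)) ^ 2 / (2 * κ) := by positivity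
  linarith

/-! ### The minimizer of the surface functional -/

/-- The infimum of the surface functional over finite strains. It is a junk value unless the
functional is bounded below there, see `bddBelow_surfaceEnergyAt`. -/
def surfaceInf (v : ℝ → ℝ) (m : ℕ∞) (p rhc a : ℝ) : ℝ :=
  sInf (surfaceEnergyAt v m p a '' finiteStrains rhc a)

theorem surfaceInf_le (hv : IsAdmissible v rhc zmin zmax α₁ α₂ s) {m : ℕ∞} (hm : 1 ≤ m)
    {p a : ℝ} (hp₀ : 0 ≤ p) (hp : p < |v zmax| / zmax) (ha : a ∈ Set.Icc zmin zmax)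
    (hcrit : bulkForce v m p a = 0) {z : ℕ → ℝ} (hz : z ∈ finiteStrains rhc a) :
    surfaceInf v m p rhc a ≤ surfaceEnergyAt v m p a z :=
  csInf_le (bddBelow_surfaceEnergyAt hv hm hp₀ hp ha hcrit) (Set.mem_image_of_mem _ hz)

theorem exists_surfaceEnergyAt_add_le (hv : IsAdmissible v rhc zmin zmax α₁ α₂ s) {m : ℕ∞}
    (hm : 1 ≤ m) {p a : ℝ} (hp : 0 ≤ p) (ha : a ∈ Set.Icc zmin zmax) {w : ℕ → ℝ}
    (hw : w ∈ finiteStrains rhc a) {i : ℕ} (hi : w i < zmin) : ∃ z ∈ finiteStrains rhc a,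
      surfaceEnergyAt v m p a z + -(v zmax + p * zmax) ≤ surfaceEnergyAt v m p a w := by
  have har := hv.rhc_lt_zmin.trans_le ha.1
  obtain ⟨hwr, n, hn⟩ := mem_finiteStrains_iff.1 hw
  obtain ⟨j, -, hjmin⟩ := exists_min_image (range (max n (i + 1))) w ⟨i, mem_range.2 (by omega)⟩
  have hj : w j < zmin := (hjmin i (mem_range.2 (by omega))).trans_lt hi
  have hmin : ∀ l, w j ≤ w l := fun l => by
    rcases Nat.lt_or_ge l n with hl | hl
    · exact hjmin l (mem_range.2 (by omega))
    · rw [hn l hl]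
      exact hj.le.trans ha.1
  have hz : consSpacing zmax (removeParticle w j) ∈ finiteStrains rhc a := by
    refine mem_finiteStrains_iff.2 ⟨fun l => ?_, max j n + 1, fun l hl => ?_⟩
    · match l with
      | 0 => exact hv.rhc_lt_zmax
      | l + 1 => exact lt_removeParticle hv.rhc_nonneg (hwr l) (hwr (l + 1))
    · match l with
      | 0 => omega
      | l + 1 =>
        rw [consSpacing, removeParticle_of_le w (by omega), hn _ (by omega)]
  refine ⟨_, hz, surfaceEnergyAt_add_le_of_pairEnergy_add_le hv m p har hz hw ?_⟩
  filter_upwards [eventually_gt_atTop j] with N hN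
  linarith [pairEnergy_exchange_le hv hm hp (N := N + 1) (by omega) (fun l _ => hwr l)
    (fun l _ => hmin l) hj]

theorem clip_mem_finiteStrains {a : ℝ} (hr : rhc < zmax) (ha : a ≤ zmax) {w : ℕ → ℝ}
    (hw : w ∈ finiteStrains rhc a) : (fun l => min (w l) zmax) ∈ finiteStrains rhc a := by
  obtain ⟨hwr, n, hn⟩ := mem_finiteStrains_iff.1 hw
  exact mem_finiteStrains_iff.2 ⟨fun l => lt_min (hwr l) hr, n,
    fun l hl => by rw [hn l hl, min_eq_left ha]⟩

theorem surfaceEnergyAt_clip_add_le (hv : IsAdmissible v rhc zmin zmax α₁ α₂ s) {m : ℕ∞}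
    (hm : 1 ≤ m) {p a : ℝ} (hp : 0 ≤ p) (ha : a ∈ Set.Icc zmin zmax) {w : ℕ → ℝ}
    (hw : w ∈ finiteStrains rhc a) (hwz : ∀ l, zmin ≤ w l) (j : ℕ) :
    surfaceEnergyAt v m p a (fun l => min (w l) zmax) + (v (w j) - v (min (w j) zmax))
      ≤ surfaceEnergyAt v m p a w := by
  refine surfaceEnergyAt_add_le_of_pairEnergy_add_le hv m p (hv.rhc_lt_zmin.trans_le ha.1)
    (clip_mem_finiteStrains hv.rhc_lt_zmax ha.2 hw) hw ?_
  filter_upwards [eventually_gt_atTop j] with N hN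
  exact pairEnergy_clip_le hv hm hp (fun l _ => hwz l) (by omega)

theorem exists_surfaceEnergyAt_lt (hv : IsAdmissible v rhc zmin zmax α₁ α₂ s) {m : ℕ∞}
    (hm : 1 ≤ m) {p a : ℝ} (hp₀ : 0 ≤ p) (hp : p < |v zmax| / zmax) (ha : a ∈ Set.Icc zmin zmax)
    (hcrit : bulkForce v m p a = 0) {ε : ℝ} (hε : 0 < ε) :
    ∃ z ∈ finiteStrains rhc a, (∀ l, z l ∈ Set.Icc zmin zmax) ∧
      surfaceEnergyAt v m p a z < surfaceInf v m p rhc a + ε := by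
  have har := hv.rhc_lt_zmin.trans_le ha.1
  have hgap : 0 < -(v zmax + p * zmax) := neg_pos.2 (hv.add_mul_zmax_neg hp)
  obtain ⟨_, ⟨w, hw, rfl⟩, hlt⟩ := exists_lt_of_csInf_lt
    (Set.image_nonempty.2 ⟨_, const_mem_finiteStrains har⟩)
    (lt_add_of_pos_right (surfaceInf v m p rhc a) (lt_min hε hgap))
  have hwz : ∀ l, zmin ≤ w l := by
    by_contra! ⟨i, hi⟩
    obtain ⟨z, hz, hle⟩ := exists_surfaceEnergyAt_add_le hv hm hp₀ ha hw hi
    linarith [surfaceInf_le hv hm hp₀ hp ha hcrit hz, min_le_right ε (-(v zmax + p * zmax))]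
  refine ⟨_, clip_mem_finiteStrains hv.rhc_lt_zmax ha.2 hw,
    fun l => ⟨le_min (hwz l) hv.zmin_lt_zmax.le, min_le_right _ _⟩, ?_⟩
  linarith [surfaceEnergyAt_clip_add_le hv hm hp₀ ha hw hwz 0, hv.apply_min_zmax_le (hw.1 0),
    min_le_left ε (-(v zmax + p * zmax))]

theorem partialNorm_sub_le_of_surfaceEnergyAt_le (hv : IsAdmissible v rhc zmin zmax α₁ α₂ s)
    {m : ℕ∞} (hm : 1 ≤ m) {p a : ℝ} (hp₀ : 0 ≤ p) (hp : p < |v zmax| / zmax)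
    (ha : a ∈ Set.Icc zmin zmax) (hcrit : bulkForce v m p a = 0) {z w : ℕ → ℝ}
    (hz : z ∈ finiteStrains rhc a) (hw : w ∈ finiteStrains rhc a)
    (hzb : ∀ l, z l ∈ Set.Icc zmin zmax) (hwb : ∀ l, w l ∈ Set.Icc zmin zmax) {ε : ℝ}
    (hzε : surfaceEnergyAt v m p a z ≤ surfaceInf v m p rhc a + ε)
    (hwε : surfaceEnergyAt v m p a w ≤ surfaceInf v m p rhc a + ε) (L : ℕ) :
    partialNorm L (z - w) ≤ √(8 / convexityModulus v zmin zmax * ε) := by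
  have hhalf : (0 : ℝ) ≤ 1 / 2 := by norm_num
  have hmid := surfaceInf_le hv hm hp₀ hp ha hcrit
    (convex_finiteStrains rhc a hz hw hhalf hhalf (add_halves 1))
  have hconv := surfaceEnergyAt_strong_convexity hv hm p hz hw hzb hwb hhalf hhalf (add_halves 1) L
  refine Real.le_sqrt_of_sq_le ?_
  rw [div_mul_eq_mul_div, le_div_iff₀ hv.convexityModulus_pos]
  linarith

theorem StrainSpace.dist_le_of_partialNorm_le {a d : ℝ} (hd : 0 ≤ d) {z w : StrainSpace rhc a}
    (h : ∀ L, partialNorm L (z.1 - w.1) ≤ d) : dist z w ≤ d := by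
  change dist z.strain w.strain ≤ d
  rw [dist_eq_norm]
  refine lp.norm_le_of_forall_sum_le (by norm_num) hd fun S => ?_
  obtain ⟨L, hL⟩ := S.exists_nat_subset_range
  have hsq : ∑ l ∈ range L, (z.1 - w.1) l ^ 2 ≤ d ^ 2 := (partialNorm_le_iff hd).1 (h L)
  rw [coe_strain_sub_strain]
  simpa using (sum_le_sum_of_subset_of_nonneg hL fun _ _ _ => sq_nonneg _).trans hsq

theorem StrainSpace.exists_tendsto_of_cauchySeq {a : ℝ} {A : Set ℝ} (hA : IsClosed A)
    (hAr : A ⊆ Set.Ioi rhc) {W : ℕ → StrainSpace rhc a} (hW : CauchySeq W)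
    (hWA : ∀ n l, (W n).1 l ∈ A) :
    ∃ z : StrainSpace rhc a, (∀ l, z.1 l ∈ A) ∧ Tendsto W atTop (𝓝 z) := by
  have hiso : Isometry (StrainSpace.strain : StrainSpace rhc a → lp (fun _ : ℕ => ℝ) 2) :=
    Isometry.of_dist_eq fun _ _ => rfl
  obtain ⟨f, hf⟩ := cauchySeq_tendsto_of_complete (hiso.uniformContinuous.comp_cauchySeq hW)
  have hcoord : ∀ l, Tendsto (fun n => (W n).1 l) atTop (𝓝 (a + f l)) := fun l => by
    refine tendsto_iff_dist_tendsto_zero.2 (squeeze_zero (fun _ => dist_nonneg) (fun n => ?_)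
      (tendsto_iff_dist_tendsto_zero.1 hf))
    have hle := lp.norm_apply_le_norm (p := 2) two_ne_zero ((W n).strain - f) l
    rwa [← dist_eq_norm, lp.coeFn_sub, Pi.sub_apply, Real.norm_eq_abs,
      show (W n).strain l - f l = (W n).1 l - (a + f l) from sub_sub _ _ _] at hle
  have hmem : ∀ l, a + f l ∈ A := fun l =>
    hA.mem_of_tendsto (hcoord l) (Eventually.of_forall fun n => hWA n l)
  have hz : (fun l => a + f l) ∈ squareSummableStrains rhc a :=
    ⟨fun l => hAr (hmem l), by simpa using (lp.memℓp f).summable (by norm_num)⟩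
  have hstrain : StrainSpace.strain ⟨_, hz⟩ = f := lp.ext (funext fun l => add_sub_cancel_left a _)
  exact ⟨⟨_, hz⟩, hmem, hiso.isEmbedding.tendsto_nhds_iff.2 (by rwa [hstrain])⟩

theorem exists_extSurfaceEnergy_eq_surfaceInf (hv : IsAdmissible v rhc zmin zmax α₁ α₂ s)
    {m : ℕ∞} (hm : 1 ≤ m) {p a : ℝ} (hp₀ : 0 ≤ p) (hp : p < |v zmax| / zmax)
    (ha : a ∈ Set.Icc zmin zmax) (hcrit : bulkForce v m p a = 0) :
    ∃ z ∈ squareSummableStrains rhc a, (∀ l, z l ∈ Set.Icc zmin zmax) ∧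
      extSurfaceEnergy v m p a z = surfaceInf v m p rhc a := by
  have har := hv.rhc_lt_zmin.trans_le ha.1
  choose w hw hwb hwlt using fun n : ℕ =>
    exists_surfaceEnergyAt_lt hv hm hp₀ hp ha hcrit (Nat.one_div_pos_of_nat (α := ℝ) (n := n))
  have hnear : ∀ N n : ℕ, N ≤ n →
      surfaceEnergyAt v m p a (w n) ≤ surfaceInf v m p rhc a + 1 / ((N : ℝ) + 1) :=
    fun N n hn => (hwlt n).le.trans (add_le_add_right (Nat.one_div_le_one_div hn) _)
  set W : ℕ → StrainSpace rhc a := fun n => ⟨w n, finiteStrains_subset rhc a (hw n)⟩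
  have hrate : Tendsto (fun N : ℕ => √(8 / convexityModulus v zmin zmax * (1 / ((N : ℝ) + 1))))
      atTop (𝓝 0) := by
    simpa using ((tendsto_one_div_add_atTop_nhds_zero_nat (𝕜 := ℝ)).const_mul
      (8 / convexityModulus v zmin zmax)).sqrt
  have hcauchy : CauchySeq W := cauchySeq_of_le_tendsto_0 _ (fun n n' N hn hn' =>
    StrainSpace.dist_le_of_partialNorm_le (Real.sqrt_nonneg _)
      (partialNorm_sub_le_of_surfaceEnergyAt_le hv hm hp₀ hp ha hcrit (hw n) (hw n') (hwb n)
        (hwb n') (hnear N n hn) (hnear N n' hn'))) hrate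
  obtain ⟨z, hzb, hWz⟩ := StrainSpace.exists_tendsto_of_cauchySeq isClosed_Icc
    (fun _ hx => hv.rhc_lt_zmin.trans_le hx.1) hcauchy hwb
  refine ⟨z.1, z.2, hzb, tendsto_nhds_unique
    (((continuous_extSurfaceEnergy hv hcrit har).tendsto z).comp hWz) ?_⟩
  have hupper : Tendsto (fun n : ℕ => surfaceInf v m p rhc a + 1 / ((n : ℝ) + 1)) atTop
      (𝓝 (surfaceInf v m p rhc a)) := by
    simpa using tendsto_one_div_add_atTop_nhds_zero_nat.const_add (surfaceInf v m p rhc a)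
  have heq : ∀ n, extSurfaceEnergy v m p a (W n).1 = surfaceEnergyAt v m p a (w n) :=
    fun n => extSurfaceEnergy_eq (hw n)
  exact tendsto_of_tendsto_of_tendsto_of_le_of_le tendsto_const_nhds hupper
    (fun n => (surfaceInf_le hv hm hp₀ hp ha hcrit (hw n)).trans_eq (heq n).symm)
    (fun n => (heq n).trans_le (hwlt n).le)

theorem surfaceInf_le_extSurfaceEnergy (hv : IsAdmissible v rhc zmin zmax α₁ α₂ s) {m : ℕ∞}
    (hm : 1 ≤ m) {p a : ℝ} (hp₀ : 0 ≤ p) (hp : p < |v zmax| / zmax) (ha : a ∈ Set.Icc zmin zmax)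
    (hcrit : bulkForce v m p a = 0) {w : ℕ → ℝ} (hw : w ∈ squareSummableStrains rhc a) :
    surfaceInf v m p rhc a ≤ extSurfaceEnergy v m p a w :=
  have har := hv.rhc_lt_zmin.trans_le ha.1
  ge_of_tendsto' (tendsto_extSurfaceEnergy hv hcrit har hw) fun n =>
    surfaceInf_le hv hm hp₀ hp ha hcrit (truncation_mem_finiteStrains har hw.1 n)

theorem surfaceInf_lt_of_lt_zmin (hv : IsAdmissible v rhc zmin zmax α₁ α₂ s) {m : ℕ∞}
    (hm : 1 ≤ m) {p a : ℝ} (hp₀ : 0 ≤ p) (hp : p < |v zmax| / zmax) (ha : a ∈ Set.Icc zmin zmax)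
    (hcrit : bulkForce v m p a = 0) {w : ℕ → ℝ} (hw : w ∈ squareSummableStrains rhc a) {i : ℕ}
    (hi : w i < zmin) : surfaceInf v m p rhc a < extSurfaceEnergy v m p a w := by
  have har := hv.rhc_lt_zmin.trans_le ha.1
  refine (lt_add_of_pos_right _ (neg_pos.2 (hv.add_mul_zmax_neg hp))).trans_le
    (ge_of_tendsto (tendsto_extSurfaceEnergy hv hcrit har hw) ?_)
  filter_upwards [eventually_gt_atTop i] with n hn
  obtain ⟨y, hy, hle⟩ := exists_surfaceEnergyAt_add_le hv hm hp₀ ha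
    (truncation_mem_finiteStrains har hw.1 n) (i := i) (by rwa [truncation_of_lt a hn])
  linarith [surfaceInf_le hv hm hp₀ hp ha hcrit hy]

theorem surfaceInf_lt_of_zmax_lt (hv : IsAdmissible v rhc zmin zmax α₁ α₂ s) {m : ℕ∞}
    (hm : 1 ≤ m) {p a : ℝ} (hp₀ : 0 ≤ p) (hp : p < |v zmax| / zmax) (ha : a ∈ Set.Icc zmin zmax)
    (hcrit : bulkForce v m p a = 0) {w : ℕ → ℝ} (hw : w ∈ squareSummableStrains rhc a)
    (hwz : ∀ l, zmin ≤ w l) {j : ℕ} (hj : zmax < w j) :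
    surfaceInf v m p rhc a < extSurfaceEnergy v m p a w := by
  have har := hv.rhc_lt_zmin.trans_le ha.1
  refine (lt_add_of_pos_right _ (sub_pos.2 (hv.zmax_unique_min (w j) (hw.1 j) hj.ne'))).trans_le
    (ge_of_tendsto (tendsto_extSurfaceEnergy hv hcrit har hw) ?_)
  filter_upwards [eventually_gt_atTop j] with n hn
  have hmem := truncation_mem_finiteStrains har hw.1 n
  have hclip := surfaceEnergyAt_clip_add_le hv hm hp₀ ha hmem
    (truncation_mem (A := Set.Ici zmin) ha.1 hwz n) j
  rw [truncation_of_lt a hn, min_eq_right hj.le] at hclip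
  linarith [surfaceInf_le hv hm hp₀ hp ha hcrit (clip_mem_finiteStrains hv.rhc_lt_zmax ha.2 hmem)]

theorem surfaceInf_lt_extSurfaceEnergy (hv : IsAdmissible v rhc zmin zmax α₁ α₂ s) {m : ℕ∞}
    (hm : 1 ≤ m) {p a : ℝ} (hp₀ : 0 ≤ p) (hp : p < |v zmax| / zmax) (ha : a ∈ Set.Icc zmin zmax)
    (hcrit : bulkForce v m p a = 0) {z w : ℕ → ℝ} (hz : z ∈ squareSummableStrains rhc a)
    (hzb : ∀ l, z l ∈ Set.Icc zmin zmax)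
    (hzinf : extSurfaceEnergy v m p a z = surfaceInf v m p rhc a)
    (hw : w ∈ squareSummableStrains rhc a) (hwz : w ≠ z) :
    surfaceInf v m p rhc a < extSurfaceEnergy v m p a w := by
  by_cases hlow : ∃ i, w i < zmin
  · exact surfaceInf_lt_of_lt_zmin hv hm hp₀ hp ha hcrit hw hlow.choose_spec
  push Not at hlow
  by_cases hhigh : ∃ j, zmax < w j
  · exact surfaceInf_lt_of_zmax_lt hv hm hp₀ hp ha hcrit hw hlow hhigh.choose_spec
  push Not at hhigh
  have hinf : ∀ y ∈ squareSummableStrains rhc a,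
      surfaceInf v m p rhc a ≤ extSurfaceEnergy v m p a y :=
    fun y hy => surfaceInf_le_extSurfaceEnergy hv hm hp₀ hp ha hcrit hy
  refine (hinf w hw).lt_of_ne fun hwinf => hwz ?_
  exact (strictConvexOn_extSurfaceEnergy hv hm ha hcrit).eq_of_isMinOn
    (fun y hy => hwinf ▸ hinf y hy.1) (fun y hy => hzinf ▸ hinf y hy.1)
    ⟨hw, fun l => ⟨hlow l, hhigh l⟩⟩ ⟨hz, hzb⟩

/-! ### Long finite chains -/

theorem sum_range_mul (f : ℕ → ℝ) (B q : ℕ) :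
    ∑ l ∈ range (B * q), f l = ∑ b ∈ range B, ∑ l ∈ Ico (b * q) (b * q + q), f l := by
  induction B with
  | zero => simp
  | succ B ih => rw [sum_range_succ, ← ih, Nat.succ_mul, sum_range_add_sum_Ico _ (by omega)]

theorem exists_sum_Ico_le {f : ℕ → ℝ} (hf : ∀ l, 0 ≤ f l) {q : ℕ} (hq : 0 < q) {L : ℕ}
    (hL : q * q ≤ L) :
    ∃ b, b + q ≤ L ∧ ∑ l ∈ Ico b (b + q), f l ≤ (∑ l ∈ range L, f l) / q := by
  obtain ⟨b, hb, hle⟩ : ∃ b ∈ range q,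
      ∑ l ∈ Ico (b * q) (b * q + q), f l ≤ (∑ l ∈ range L, f l) / q := by
    refine exists_le_of_sum_le ⟨0, mem_range.2 hq⟩ ?_
    rw [← sum_range_mul, sum_const, card_range, nsmul_eq_mul, mul_div_cancel₀ _ (by positivity)]
    exact sum_le_sum_of_subset_of_nonneg (range_mono hL) fun l _ _ => hf l
  refine ⟨b * q, ?_, hle⟩
  calc b * q + q = (b + 1) * q := by ring
    _ ≤ q * q := Nat.mul_le_mul_right q (mem_range.1 hb)
    _ ≤ L := hL

/-- One of `√L` disjoint blocks of length `√L` carries at most the average squared strain. -/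
theorem exists_partialNorm_piecewise_sub_le (a : ℝ) (z : ℕ → ℝ) {L : ℕ} (hL : 0 < L) :
    ∃ b, b + L.sqrt ≤ L ∧
      partialNorm L ((Ico b (b + L.sqrt)).piecewise (fun _ => a) z - z)
        ≤ partialNorm L (fun l => z l - a) / √L.sqrt := by
  obtain ⟨b, hb, hle⟩ := exists_sum_Ico_le (f := fun l => (z l - a) ^ 2) (fun l => sq_nonneg _)
    (Nat.sqrt_pos.2 hL) (Nat.sqrt_le L)
  refine ⟨b, hb, ?_⟩
  rw [partialNorm_le_iff (div_nonneg (partialNorm_nonneg _ _) (Real.sqrt_nonneg _)), div_pow,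
    sq_partialNorm, Real.sq_sqrt (Nat.cast_nonneg _)]
  refine le_trans ?_ hle
  calc ∑ l ∈ range L, ((Ico b (b + L.sqrt)).piecewise (fun _ => a) z - z) l ^ 2
      = ∑ l ∈ range L, if l ∈ Ico b (b + L.sqrt) then (z l - a) ^ 2 else 0 := by
        refine sum_congr rfl fun l _ => ?_
        rw [Pi.sub_apply, Finset.piecewise]
        split_ifs
        · exact sub_sq_comm _ _
        · simp
    _ ≤ ∑ l ∈ Ico b (b + L.sqrt), (z l - a) ^ 2 := by
        rw [← sum_filter]
        exact sum_le_sum_of_subset_of_nonneg (fun l hl => (mem_filter.1 hl).2)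
          fun _ _ _ => sq_nonneg _

theorem partialNorm_piecewise_sub_const_le (S : Finset ℕ) (a : ℝ) (z : ℕ → ℝ) (L : ℕ) :
    partialNorm L (fun l => S.piecewise (fun _ => a) z l - a)
      ≤ partialNorm L (fun l => z l - a) := by
  refine partialNorm_le_partialNorm fun l _ => ?_
  rw [Finset.piecewise]
  split_ifs
  · simp
  · exact le_rfl

/-- Chains of bounded strain contain long blocks of small strain; putting the spacings there equal
to `a` separates the two ends of the chain at a vanishing cost in energy. -/
theorem exists_tendsto_pairEnergy_cut_sub (hv : IsAdmissible v rhc zmin zmax α₁ α₂ s) {m : ℕ∞}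
    {p a : ℝ} (hcrit : bulkForce v m p a = 0) {r : ℝ} (hr : rhc < r) (hra : r ≤ a) {M : ℝ}
    {ζ : ℕ → ℕ → ℝ} (hζ : ∀ N l, r ≤ ζ N l)
    (hM : ∀ N, partialNorm (N + 1) (fun l => ζ N l - a) ≤ M) :
    ∃ (n n' : ℕ → ℕ) (y : ℕ → ℕ → ℝ), (∀ N, n N + n' N = N + 1) ∧ (∀ N l, r ≤ y N l) ∧
      (∀ i, ∀ᶠ N in atTop, i < n N ∧ i < n' N ∧
        ∀ l, n N ≤ l + 1 + i → l ≤ n N + i → y N l = a) ∧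
      Tendsto (fun N => pairEnergy (cutoff v m) p (N + 2) (y N)
        - pairEnergy (cutoff v m) p (N + 2) (ζ N)) atTop (𝓝 0) := by
  have hM0 : 0 ≤ M := (partialNorm_nonneg _ _).trans (hM 0)
  obtain ⟨K, hK, hlip⟩ := exists_abs_pairEnergy_sub_le hv hcrit hr hra hM0
  have hsqrt : Tendsto (fun N : ℕ => (N + 1).sqrt) atTop atTop := tendsto_atTop.2 fun i => by
    filter_upwards [eventually_ge_atTop (i * i)] with N hN
    exact Nat.le_sqrt.2 (by omega)
  choose b hb hbM using fun N =>
    exists_partialNorm_piecewise_sub_le a (ζ N) (L := N + 1) (by omega)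
  set y : ℕ → ℕ → ℝ := fun N => (Ico (b N) (b N + (N + 1).sqrt)).piecewise (fun _ => a) (ζ N)
  have hy : ∀ N l, r ≤ y N l := fun N l => by
    simp only [y, Finset.piecewise]
    split_ifs
    exacts [hra, hζ N l]
  refine ⟨fun N => b N + (N + 1).sqrt / 2, fun N => N + 1 - (b N + (N + 1).sqrt / 2), y,
    fun N => ?_, hy, fun i => ?_, ?_⟩
  · have := hb N
    dsimp only
    omega
  · filter_upwards [hsqrt.eventually_ge_atTop (2 * (i + 1))] with N hN
    have := hb N
    exact ⟨by omega, by omega, fun l hl hl' => piecewise_eq_of_mem _ _ _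
      (mem_Ico.2 ⟨by omega, by omega⟩)⟩
  · have hrate : Tendsto (fun N : ℕ => K * (M / √(N + 1).sqrt)) atTop (𝓝 0) := by
      simpa using ((tendsto_const_nhds (x := M)).div_atTop (Real.tendsto_sqrt_atTop.comp
        (tendsto_natCast_atTop_atTop.comp hsqrt))).const_mul K
    refine squeeze_zero_norm (fun N => ?_) hrate
    refine (hlip (N + 1) (y N) (ζ N) (fun l _ => hy N l) (fun l _ => hζ N l)
      ((partialNorm_piecewise_sub_const_le _ a _ _).trans (hM N)) (hM N)).trans
      (mul_le_mul_of_nonneg_left ((hbM N).trans ?_) hK)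
    exact div_le_div_of_nonneg_right (hM N) (Real.sqrt_nonneg _)

theorem eventually_lt_pairEnergy_sub (hv : IsAdmissible v rhc zmin zmax α₁ α₂ s) {m : ℕ∞}
    (hm : 1 ≤ m) {p a : ℝ} (hp₀ : 0 ≤ p) (hp : p < |v zmax| / zmax) (ha : a ∈ Set.Icc zmin zmax)
    (hcrit : bulkForce v m p a = 0) {M : ℝ} {ζ : ℕ → ℕ → ℝ} (hζ : ∀ N l, zmin ≤ ζ N l)
    (hM : ∀ N, partialNorm (N + 1) (fun l => ζ N l - a) ≤ M) {c : ℝ}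
    (hc : c < 2 * surfaceInf v m p rhc a
      - (bulkEnergy v m p a + bulkCrossEnergy (cutoff v m) a)) :
    ∀ᶠ N : ℕ in atTop,
      c < pairEnergy (cutoff v m) p (N + 2) (ζ N) - ((N : ℝ) + 2) * bulkEnergy v m p a := by
  have har := hv.rhc_lt_zmin.trans_le ha.1
  obtain ⟨n, n', y, hnn, hy, hya, hcut⟩ :=
    exists_tendsto_pairEnergy_cut_sub hv hcrit hv.rhc_lt_zmin ha.1 hζ hM
  have hyr : ∀ N l, rhc < y N l := fun N l => hv.rhc_lt_zmin.trans_le (hy N l)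
  have hlower := ((tendsto_pairEnergy_sub_surfaceEnergyAt hv m p hv.rhc_lt_zmin ha.1 hy hya).sub
    hcut).const_add (2 * surfaceInf v m p rhc a - bulkEnergy v m p a)
  filter_upwards [hlower.eventually_const_lt (u := c) (by linarith)] with N hN
  have hleft := surfaceInf_le hv hm hp₀ hp ha hcrit
    (truncation_mem_finiteStrains har (hyr N) (n N))
  have hright := surfaceInf_le hv hm hp₀ hp ha hcrit (truncation_mem_finiteStrains har
    (z := fun l => y N (n N + (n' N - 1 - l))) (fun l => hyr N _) (n' N))
  have hcast : (n N : ℝ) + n' N = N + 1 := by exact_mod_cast hnn N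
  rw [hnn N, hcast] at hN
  linarith

theorem tendsto_pairEnergy_mirror_sub (hv : IsAdmissible v rhc zmin zmax α₁ α₂ s) (m : ℕ∞) (p : ℝ)
    {a r : ℝ} (hr : rhc < r) (hra : r ≤ a) {z : ℕ → ℝ} (hz : ∀ l, r ≤ z l) {n₀ : ℕ}
    (hn : ∀ l, n₀ ≤ l → z l = a) :
    Tendsto (fun N : ℕ => pairEnergy (cutoff v m) p (N + 2) (fun l => z (min l (N - l)))
      - ((N : ℝ) + 2) * bulkEnergy v m p a) atTop
      (𝓝 (2 * surfaceEnergyAt v m p a z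
        - (bulkEnergy v m p a + bulkCrossEnergy (cutoff v m) a))) := by
  have hglue := (tendsto_pairEnergy_sub_surfaceEnergyAt hv m p hr hra
    (z := fun N l => z (min l (N - l))) (fun N l => hz _)
    (n := fun N => (N + 1) / 2) (n' := fun N => N + 1 - (N + 1) / 2) fun i => by
      filter_upwards [eventually_ge_atTop (2 * (n₀ + i + 2))] with N hN
      exact ⟨by omega, by omega, fun l hl hl' => hn _ (by omega)⟩).const_add
    (2 * surfaceEnergyAt v m p a z - bulkEnergy v m p a)
  convert hglue.congr' ?_ using 2
  · ring
  filter_upwards [eventually_ge_atTop (2 * (n₀ + 2))] with N hN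
  have hleft : truncation a ((N + 1) / 2) (fun l => z (min l (N - l))) = z := by
    funext l
    dsimp only [truncation]
    split_ifs
    · congr 1
      omega
    · exact (hn l (by omega)).symm
  have hright : truncation a (N + 1 - (N + 1) / 2) (fun l =>
      z (min ((N + 1) / 2 + (N + 1 - (N + 1) / 2 - 1 - l))
        (N - ((N + 1) / 2 + (N + 1 - (N + 1) / 2 - 1 - l))))) = z := by
    funext l
    dsimp only [truncation]
    split_ifs
    · congr 1
      omega
    · exact (hn l (by omega)).symm
  have hsum : (N + 1) / 2 + (N + 1 - (N + 1) / 2) = N + 1 := by omega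
  have hcast : (((N + 1) / 2 : ℕ) : ℝ) + ((N + 1 - (N + 1) / 2 : ℕ) : ℝ) = N + 1 := by
    exact_mod_cast hsum
  rw [hleft, hright, hsum, hcast]
  ring

theorem tendsto_pairEnergy_minimizer_sub (hv : IsAdmissible v rhc zmin zmax α₁ α₂ s) {m : ℕ∞}
    (hm : 1 ≤ m) {p a : ℝ} (hp₀ : 0 ≤ p) (hp : p < |v zmax| / zmax) (ha : a ∈ Set.Icc zmin zmax)
    (hcrit : bulkForce v m p a = 0) {ζ : ℕ → ℕ → ℝ} (hζ : ∀ N l, ζ N l ∈ Set.Icc zmin zmax)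
    (hmin : ∀ N (w : ℕ → ℝ), (∀ l, rhc < w l) →
      pairEnergy (cutoff v m) p (N + 2) (ζ N) ≤ pairEnergy (cutoff v m) p (N + 2) w) :
    Tendsto (fun N : ℕ => pairEnergy (cutoff v m) p (N + 2) (ζ N)
      - ((N : ℝ) + 2) * bulkEnergy v m p a) atTop
      (𝓝 (2 * surfaceInf v m p rhc a
        - (bulkEnergy v m p a + bulkCrossEnergy (cutoff v m) a))) := by
  have har := hv.rhc_lt_zmin.trans_le ha.1
  refine tendsto_order.2 ⟨fun c hc => ?_, fun c hc => ?_⟩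
  · obtain ⟨M, -, hM⟩ := exists_partialNorm_le_of_pairEnergy_le hv hm ha hcrit
    exact eventually_lt_pairEnergy_sub hv hm hp₀ hp ha hcrit (fun N l => (hζ N l).1)
      (fun N => hM (N + 1) (ζ N) (fun l _ => hζ N l) (hmin N _ fun _ => har)) hc
  · obtain ⟨z, hz, hzb, hlt⟩ := exists_surfaceEnergyAt_lt hv hm hp₀ hp ha hcrit
      (half_pos (sub_pos.2 hc))
    obtain ⟨hzr, n, hn⟩ := mem_finiteStrains_iff.1 hz
    filter_upwards [(tendsto_pairEnergy_mirror_sub hv m p hv.rhc_lt_zmin ha.1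
      (fun l => (hzb l).1) hn).eventually_lt_const (u := c) (by linarith)] with N hN
    linarith [hmin N _ fun l => hzr (min l (N - l))]

theorem coe_toReal_minEnergy (hv : IsAdmissible v rhc zmin zmax α₁ α₂ s) {m : ℕ∞} (hm : 1 ≤ m)
    {p : ℝ} (hp₀ : 0 ≤ p) (hp : p < |v zmax| / zmax) {N : ℕ} (hN : 2 ≤ N) :
    ((minEnergy rhc v m p N).toReal : EReal) = minEnergy rhc v m p N := by
  obtain ⟨z, hz, hmin⟩ := exists_pairEnergy_minimizer hv hm hp₀ hp hN
  rw [minEnergy_eq_coe hv hm (fun l => hv.rhc_lt_zmin.trans_le (hz l).1) hmin, EReal.toReal_coe]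

theorem tendsto_toReal_minEnergy_sub (hv : IsAdmissible v rhc zmin zmax α₁ α₂ s) {m : ℕ∞}
    (hm : 1 ≤ m) {p a : ℝ} (hp₀ : 0 ≤ p) (hp : p < |v zmax| / zmax) (ha : a ∈ Set.Icc zmin zmax)
    (hcrit : bulkForce v m p a = 0) :
    Tendsto (fun N : ℕ => (minEnergy rhc v m p N).toReal - N * bulkEnergy v m p a) atTop
      (𝓝 (2 * surfaceInf v m p rhc a - p * a - sumTo m (fun k => k * v (k * a)))) := by
  choose ζ hζ hmin using fun N : ℕ =>
    exists_pairEnergy_minimizer hv hm hp₀ hp (N := N + 2) (by omega)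
  rw [← tendsto_add_atTop_iff_nat 2, sub_sub,
    ← bulkEnergy_add_bulkCrossEnergy hv m p (hv.rhc_lt_zmin.trans_le ha.1)]
  refine (tendsto_pairEnergy_minimizer_sub hv hm hp₀ hp ha hcrit hζ hmin).congr fun N => ?_
  rw [minEnergy_eq_coe hv hm (fun l => hv.rhc_lt_zmin.trans_le (hζ N l).1) (hmin N),
    EReal.toReal_coe]
  push_cast
  rfl

theorem tendsto_minEnergy_sub (hv : IsAdmissible v rhc zmin zmax α₁ α₂ s) {m : ℕ∞}
    (hm : 1 ≤ m) {p a : ℝ} (hp₀ : 0 ≤ p) (hp : p < |v zmax| / zmax) (ha : a ∈ Set.Icc zmin zmax)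
    (hcrit : bulkForce v m p a = 0) :
    Tendsto (fun N : ℕ => minEnergy rhc v m p N - ((N * bulkEnergy v m p a : ℝ) : EReal)) atTop
      (𝓝 ((2 * surfaceInf v m p rhc a - p * a - sumTo m (fun k => k * v (k * a)) : ℝ)
        : EReal)) := by
  refine ((continuous_coe_real_ereal.tendsto _).comp
    (tendsto_toReal_minEnergy_sub hv hm hp₀ hp ha hcrit)).congr' ?_
  filter_upwards [eventually_ge_atTop 2] with N hN
  rw [Function.comp_apply, EReal.coe_sub, coe_toReal_minEnergy hv hm hp₀ hp hN]

theorem tendsto_div_natCast_of_tendsto_sub {x : ℕ → ℝ} {c L : ℝ}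
    (hx : Tendsto (fun N : ℕ => x N - N * c) atTop (𝓝 L)) :
    Tendsto (fun N : ℕ => x N / N) atTop (𝓝 c) := by
  have hmean := (hx.div_atTop tendsto_natCast_atTop_atTop).add_const c
  rw [zero_add] at hmean
  refine hmean.congr' ?_
  filter_upwards [eventually_ne_atTop 0] with N hN
  field_simp
  ring

theorem tendsto_minEnergy_div (hv : IsAdmissible v rhc zmin zmax α₁ α₂ s) {m : ℕ∞}
    (hm : 1 ≤ m) {p a : ℝ} (hp₀ : 0 ≤ p) (hp : p < |v zmax| / zmax) (ha : a ∈ Set.Icc zmin zmax)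
    (hcrit : bulkForce v m p a = 0) :
    Tendsto (fun N : ℕ => minEnergy rhc v m p N / (N : EReal)) atTop
      (𝓝 (bulkEnergy v m p a : EReal)) := by
  refine ((continuous_coe_real_ereal.tendsto _).comp (tendsto_div_natCast_of_tendsto_sub
    (tendsto_toReal_minEnergy_sub hv hm hp₀ hp ha hcrit))).congr' ?_
  filter_upwards [eventually_ge_atTop 2] with N hN
  rw [Function.comp_apply, EReal.coe_div, coe_toReal_minEnergy hv hm hp₀ hp hN,
    EReal.coe_coe_eq_natCast]

theorem bulkEnergyExt_lt_of_bulkEnergy_lt {m : ℕ∞} {p a : ℝ} (har : rhc < a)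
    (hmin : ∀ r, rhc < r → r ≠ a → bulkEnergy v m p a < bulkEnergy v m p r) {r : ℝ}
    (hra : r ≠ a) : bulkEnergyExt rhc v m p a < bulkEnergyExt rhc v m p r := by
  unfold bulkEnergyExt
  rw [if_neg har.not_ge]
  split_ifs with hr
  · exact EReal.coe_lt_top _
  · exact EReal.coe_lt_coe_iff.2 (hmin r (not_le.1 hr) hra)

end AtomChain

end

theorem mainTheorem3 (v : ℝ → ℝ) (rhc zmin zmax α₁ α₂ s : ℝ)
    (hv : AtomChain.IsAdmissible v rhc zmin zmax α₁ α₂ s)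
    (m : ℕ∞) (hm : 1 ≤ m) (p : ℝ) (hp₀ : 0 ≤ p) (hp : p < |v zmax| / zmax) :
    ∃ a e₀ : ℝ,
      -- `a` is the unique minimizer of `r ↦ p r + ∑_{k=1}^m v(k r)` on `(0, ∞)`
      (0 < a ∧ ∀ r, 0 < r → r ≠ a →
        AtomChain.bulkEnergyExt rhc v m p a < AtomChain.bulkEnergyExt rhc v m p r) ∧
      -- `e₀` is the energy per particle
      e₀ = AtomChain.bulkEnergy v m p a ∧
      Tendsto (fun N : ℕ => AtomChain.minEnergy rhc v m p N / (N : EReal)) atTop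
        (𝓝 (e₀ : EReal)) ∧
      ∃ E : (ℕ → ℝ) → ℝ,
        -- continuous extension of the surface functional
        (∀ z ∈ AtomChain.finiteStrains rhc a, E z = AtomChain.surfaceEnergy v m p e₀ z) ∧
        Continuous (fun z : AtomChain.StrainSpace rhc a => E z.1) ∧
        -- strict convexity
        StrictConvexOn ℝ
          (AtomChain.squareSummableStrains rhc a ∩ {z | ∀ j, z j ∈ Set.Icc zmin zmax}) E ∧
        -- unique minimizer `z`, and the surface energy
        ∃ z ∈ AtomChain.squareSummableStrains rhc a ∩ {z | ∀ j, z j ∈ Set.Icc zmin zmax},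
          (∀ w ∈ AtomChain.squareSummableStrains rhc a, w ≠ z → E z < E w) ∧
          Tendsto
            (fun N : ℕ => AtomChain.minEnergy rhc v m p N - (((N : ℝ) * e₀ : ℝ) : EReal)) atTop
            (𝓝 ((2 * E z - p * a - AtomChain.sumTo m (fun k => k * v (k * a)) : ℝ) : EReal)) := by
  obtain ⟨a, ha, hcrit, hmin⟩ := hv.exists_bulkEnergy_minimizer hm hp₀ hp
  have har := hv.rhc_lt_zmin.trans_le ha.1
  obtain ⟨z, hz, hzb, hzinf⟩ :=
    AtomChain.exists_extSurfaceEnergy_eq_surfaceInf hv hm hp₀ hp ha hcrit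
  refine ⟨a, AtomChain.bulkEnergy v m p a, ⟨hv.rhc_nonneg.trans_lt har, fun r _ hra =>
      AtomChain.bulkEnergyExt_lt_of_bulkEnergy_lt har hmin hra⟩,
    rfl, AtomChain.tendsto_minEnergy_div hv hm hp₀ hp ha hcrit,
    AtomChain.extSurfaceEnergy v m p a, fun w hw => AtomChain.extSurfaceEnergy_eq hw,
    AtomChain.continuous_extSurfaceEnergy hv hcrit har,
    AtomChain.strictConvexOn_extSurfaceEnergy hv hm ha hcrit, z, ⟨hz, hzb⟩, fun w hw hwz => ?_, ?_⟩
  · rw [hzinf]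
    exact AtomChain.surfaceInf_lt_extSurfaceEnergy hv hm hp₀ hp ha hcrit hz hzb hzinf hw hwz
  · rw [hzinf]
    exact AtomChain.tendsto_minEnergy_sub hv hm hp₀ hp ha hcrit
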